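/- **Setting.** Let $d,p\ge 1$, $\Theta=[\theta_{inf},\theta_{sup}]^p$ and $\theta_0\in\Theta$ with $\theta_{inf}<(\theta_0)_i<\theta_{sup}$ for all $i$. Let $\{K_\theta,\theta\in\Theta\}$ be functions $\mathbb R^d\to\mathbb R$ such that: 1. every $K_\theta$ is a stationary covariance function; $\theta\mapsto K_\theta(t)$ is three times differentiable on $\Theta$ for every $t$; for all $q\in\{0,\dots,3\}$ and $i_1,\dots,i_q$ there is $C<\infty$ with $\left|\frac{\partial}{\partial\theta_{i_1}}\cdots\frac{\partial}{\partial\theta_{i_q}}K_\theta(t)\right|\le \frac{C}{1+|t|^{d+1}}$ for all $\theta\in\Theta$, $t\in\mathbb R^d$ ($|t|$ is the Euclidean norm); 2. with $\hat K_\theta(f)=(2\pi)^{-d}\int_{\mathbb R^d}K_\theta(t)e^{-\mathrm i f\cdot t}dt$, one has $K_\theta(t)=\int_{\mathbb R^d}\hat K_\theta(f)e^{\mathrm i f\cdot t}df$ for all $\theta\in\Theta$ and $t$ (with $\hat K_\theta$ integrable), and $(f,\theta)\mapsto\hat K_\theta(f)$ is real-valued, positive and continuous on $\mathbb R^d\times\Theta$;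 3. for all $\theta\in\Theta$ and $1\le i\le p$, $K_\theta(t)$ and $\frac{\partial}{\partial\theta_i}K_\theta(t)$ are three times differentiable in $t$ for $t\ne0$, and for all $T>0$, $\theta\in\Theta$, $1\le i\le p$, $k\in\{1,2,3\}$, $i_1,\dots,i_k\in\{1,\dots,d\}$ there is $C_T<\infty$ such that $\left|\frac{\partial}{\partial t_{i_1}}\cdots\frac{\partial}{\partial t_{i_k}}K_\theta(t)\right|\le\frac{C_T}{1+|t|^{d+1}}$ and $\left|\frac{\partial}{\partial t_{i_1}}\cdots\frac{\partial}{\partial t_{i_k}}\frac{\partial}{\partial\theta_i}K_\theta(t)\right|\le\frac{C_T}{1+|t|^{d+1}}$ for $|t|\ge T$. Let $(v_a)_{a\ge1}$ be a sequence in $\{1,2,\dots\}^d$ with $\{v_a:1\le a\le N^d\}=\{1,\dots,N\}^d$ for all $N\ge1$. Let $(X_a)_{a\ge1}$ be i.i.d. with a symmetric distribution with support $S_X\subset[-1,1]^d$ that has a probability density, positive on $S_X$. For $\epsilon\in[0,\frac12)$ and $n\ge1$ let $R$ and $D_i=\frac{\partial R}{\partial\theta_i}$ be the $n\times n$ random matrices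 with entries $R_{a,b}=K_{\theta_0}(v_a-v_b+\epsilon(X_a-X_b))$ and $(D_i)_{a,b}=\frac{\partial}{\partial\theta_i}K_{\theta_0}(v_a-v_b+\epsilon(X_a-X_b))$. Let $\mathrm{diag}(A)$ be $A$ with its off-diagonal entries set to $0$, let $A^t$ be the transpose of $A$, and put $$M_{ML}^{i,j}=\tfrac12R^{-1}D_iR^{-1}D_j,$$ $$M^i=R^{-1}\mathrm{diag}(R^{-1})^{-2}\left\{\mathrm{diag}(R^{-1}D_iR^{-1})\,\mathrm{diag}(R^{-1})^{-1}-R^{-1}D_i\right\}R^{-1},$$ $$M_{CV,1}^{i,j}=2\{M^i+(M^i)^t\}R\{M^j+(M^j)^t\}R,$$ $$M_{CV,2}^{i,j}=-8\,\mathrm{diag}(R^{-1})^{-3}\mathrm{diag}(R^{-1}D_iR^{-1})R^{-1}D_jR^{-1}+2\,\mathrm{diag}(R^{-1})^{-2}R^{-1}D_iR^{-1}D_jR^{-1}+6\,\mathrm{diag}(R^{-1})^{-4}\mathrm{diag}(R^{-1}D_iR^{-1})\mathrm{diag}(R^{-1}D_jR^{-1})R^{-1}.$$ **Proposition.** There are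 deterministic $p\times p$ matrices $\Sigma_{ML}$, $\Sigma_{CV,1}$, $\Sigma_{CV,2}$, functions of $\epsilon\in[0,\frac12)$, such that, for $(\Sigma,M)$ being $(\Sigma_{ML},M_{ML})$, $(\Sigma_{CV,1},M_{CV,1})$ or $(\Sigma_{CV,2},M_{CV,2})$ and for all $1\le i,j\le p$: * for every $\epsilon\in[0,\frac12)$, $\frac1n\mathrm{Tr}(M^{i,j})\to(\Sigma)_{i,j}$ almost surely as $n\to\infty$ (this determines $\Sigma$); * $(\Sigma)_{i,j}$ is $C^2$ in $\epsilon$ on $[0,\frac12)$; * almost surely, for every $n$, $\mathrm{Tr}(M^{i,j})$ is $C^2$ in $\epsilon$ on $[0,\frac12)$; for every $\epsilon\in[0,\frac12)$ its second derivative is integrable, and $$\frac{\partial^2}{\partial\epsilon^2}(\Sigma)_{i,j}=\lim_{n\to+\infty}\frac1n\,\mathbb E\left\{\frac{\partial^2}{\partial\epsilon^2}\mathrm{Tr}(M^{i,j})\right\}.$$ Derivatives in $\epsilon$ at $\epsilon=0$ are right derivatives. -/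

import Mathlib

open MeasureTheory ProbabilityTheory Filter Set
open scoped Topology Matrix ENNReal

noncomputable section

namespace PerturbedGrid

/-- `f` is `n` times (Frechet) differentiable on `s`: all derivatives of order `m < n`, taken
within `s`, are differentiable on `s`. -/
def TimesDifferentiableOn {F : Type*} [NormedAddCommGroup F] [NormedSpace ℝ F]
    (n : ℕ) (f : F → ℝ) (s : Set F) : Prop :=
  ∀ m < n, DifferentiableOn ℝ (fun x => iteratedFDerivWithin ℝ m f s x) s

/-- The parameter set `Θ = [a, b]^p`. -/
def paramBox (p : ℕ) (a b : ℝ) : Set (Fin p → ℝ) := {θ | ∀ i, a ≤ θ i ∧ θ i ≤ b}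

/-- The iterated partial derivative `∂/∂θ_{I 0} ⋯ ∂/∂θ_{I (q-1)} K_θ(t)`
(one-sided at the boundary of `Θ`). -/
def thetaPartial {p d : ℕ} (Θ : Set (Fin p → ℝ))
    (K : (Fin p → ℝ) → EuclideanSpace ℝ (Fin d) → ℝ) {q : ℕ} (I : Fin q → Fin p)
    (θ : Fin p → ℝ) (t : EuclideanSpace ℝ (Fin d)) : ℝ :=
  iteratedFDerivWithin ℝ q (fun θ' => K θ' t) Θ θ (fun l => Pi.single (I l) 1)

/-- The first partial derivative `∂/∂θ_i K_θ(t)`. -/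
def thetaPartial₁ {p d : ℕ} (Θ : Set (Fin p → ℝ))
    (K : (Fin p → ℝ) → EuclideanSpace ℝ (Fin d) → ℝ) (i : Fin p)
    (θ : Fin p → ℝ) (t : EuclideanSpace ℝ (Fin d)) : ℝ :=
  thetaPartial Θ K (fun _ : Fin 1 => i) θ t

/-- The iterated partial derivative `∂/∂t_{J 0} ⋯ ∂/∂t_{J (k-1)} h(t)`, for `t ≠ 0`. -/
def spacePartial {d : ℕ} (h : EuclideanSpace ℝ (Fin d) → ℝ) {k : ℕ} (J : Fin k → Fin d)
    (t : EuclideanSpace ℝ (Fin d)) : ℝ :=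
  iteratedFDerivWithin ℝ k h {0}ᶜ t (fun l => EuclideanSpace.single (J l) 1)

/-- `k` is a stationary covariance function: `(s, t) ↦ k (s - t)` is symmetric and
positive semidefinite. -/
def IsStationaryCovariance {d : ℕ} (k : EuclideanSpace ℝ (Fin d) → ℝ) : Prop :=
  (∀ t, k (-t) = k t) ∧
  ∀ (n : ℕ) (t : Fin n → EuclideanSpace ℝ (Fin d)) (c : Fin n → ℝ),
    0 ≤ ∑ a, ∑ b, c a * c b * k (t a - t b)

/-- The Fourier transform `ĥ(f) = (2π)^{-d} ∫ h(t) e^{-i f·t} dt`. -/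
def fourierHat {d : ℕ} (h : EuclideanSpace ℝ (Fin d) → ℝ) (f : EuclideanSpace ℝ (Fin d)) : ℂ :=
  (1 / (2 * (Real.pi : ℂ)) ^ d) *
    ∫ t : EuclideanSpace ℝ (Fin d),
      (h t : ℂ) * Complex.exp (-(Complex.I * ((inner ℝ f t : ℝ) : ℂ)))

/-- The basic regularity condition on the parametric family `K_θ`, `θ ∈ Θ`. -/
structure CovarianceCondition {p d : ℕ} (Θ : Set (Fin p → ℝ))
    (K : (Fin p → ℝ) → EuclideanSpace ℝ (Fin d) → ℝ) : Prop where
  stationary : ∀ θ ∈ Θ, IsStationaryCovariance (K θ)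
  differentiable : ∀ t, TimesDifferentiableOn 3 (fun θ => K θ t) Θ
  bound : ∀ q ≤ 3, ∀ I : Fin q → Fin p, ∃ C : ℝ, ∀ θ ∈ Θ, ∀ t,
    |thetaPartial Θ K I θ t| ≤ C / (1 + ‖t‖ ^ (d + 1))
  fourier_integrable : ∀ θ ∈ Θ, Integrable (fourierHat (K θ))
  fourier_inversion : ∀ θ ∈ Θ, ∀ t,
    (K θ t : ℂ) = ∫ f : EuclideanSpace ℝ (Fin d),
      fourierHat (K θ) f * Complex.exp (Complex.I * ((inner ℝ f t : ℝ) : ℂ))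
  fourier_real : ∀ θ ∈ Θ, ∀ f, (fourierHat (K θ) f).im = 0
  fourier_pos : ∀ θ ∈ Θ, ∀ f, 0 < (fourierHat (K θ) f).re
  fourier_continuous : ContinuousOn
    (fun z : EuclideanSpace ℝ (Fin d) × (Fin p → ℝ) => fourierHat (K z.2) z.1) (univ ×ˢ Θ)

/-- The strengthened condition: in addition, `K_θ` and `∂K_θ/∂θ_i` are three times differentiable
in `t ≠ 0`, and their `t`-derivatives of order 1, 2, 3 decay like `|t|^{-(d+1)}` away from `0`. -/
structure SmoothCovarianceCondition {p d : ℕ} (Θ : Set (Fin p → ℝ))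
    (K : (Fin p → ℝ) → EuclideanSpace ℝ (Fin d) → ℝ) : Prop
    extends CovarianceCondition Θ K where
  differentiable_space : ∀ θ ∈ Θ, TimesDifferentiableOn 3 (K θ) {0}ᶜ
  differentiable_space_theta : ∀ θ ∈ Θ, ∀ i,
    TimesDifferentiableOn 3 (thetaPartial₁ Θ K i θ) {0}ᶜ
  bound_space : ∀ T > (0 : ℝ), ∀ θ ∈ Θ, ∀ k ∈ Finset.Icc 1 3, ∀ J : Fin k → Fin d,
    ∃ C : ℝ, ∀ t, T ≤ ‖t‖ → |spacePartial (K θ) J t| ≤ C / (1 + ‖t‖ ^ (d + 1))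
  bound_space_theta : ∀ T > (0 : ℝ), ∀ θ ∈ Θ, ∀ i, ∀ k ∈ Finset.Icc 1 3, ∀ J : Fin k → Fin d,
    ∃ C : ℝ, ∀ t, T ≤ ‖t‖ →
      |spacePartial (thetaPartial₁ Θ K i θ) J t| ≤ C / (1 + ‖t‖ ^ (d + 1))

/-- `v 0, v 1, …` runs through the points of `{1, 2, …}^d` in such a way that the first `N^d` of
them are the points of `{1, …, N}^d`. -/
def IsGridEnumeration {d : ℕ} (v : ℕ → Fin d → ℕ) : Prop :=
  ∀ N : ℕ, 0 < N → v '' {i | i < N ^ d} = {w | ∀ k, 1 ≤ w k ∧ w k ≤ N}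

/-- The law of one perturbation: a symmetric probability distribution whose support is contained
in `[-1,1]^d`, with a probability density that is positive on the support. -/
structure IsPerturbationLaw {d : ℕ} (μ : Measure (EuclideanSpace ℝ (Fin d))) : Prop where
  isProbability : IsProbabilityMeasure μ
  symmetric : μ.map (fun x => -x) = μ
  support_subset : μ.support ⊆ {x | ∀ k, |x k| ≤ 1}
  density : ∃ g : EuclideanSpace ℝ (Fin d) → ℝ≥0∞, Measurable g ∧
    μ = volume.withDensity g ∧ ∀ x ∈ μ.support, 0 < g x

/-- The `a`-th observation point `v_a + ε x_a`. -/
def obsPoint {d : ℕ} (v : ℕ → Fin d → ℕ) (x : ℕ → EuclideanSpace ℝ (Fin d)) (ε : ℝ) (a : ℕ) :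
    EuclideanSpace ℝ (Fin d) :=
  WithLp.toLp 2 (fun k => (v a k : ℝ)) + ε • x a

/-- The `n × n` matrix with entries `k((v_a - v_b) + ε (x_a - x_b))`. For `k = K_θ` it is `R_θ`,
and for `k = ∂K_θ/∂θ_i` it is `∂R_θ/∂θ_i`. -/
def gridMatrix {d : ℕ} (k : EuclideanSpace ℝ (Fin d) → ℝ) (v : ℕ → Fin d → ℕ)
    (x : ℕ → EuclideanSpace ℝ (Fin d)) (ε : ℝ) (n : ℕ) : Matrix (Fin n) (Fin n) ℝ :=
  Matrix.of fun a b => k (obsPoint v x ε a - obsPoint v x ε b)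

/-- `diag(A)`: the matrix `A` with all off-diagonal elements set to `0`. -/
def dg {n : ℕ} (A : Matrix (Fin n) (Fin n) ℝ) : Matrix (Fin n) (Fin n) ℝ :=
  Matrix.diagonal fun a => A a a

/-- `M_ML^{i,j}` in terms of `R`, `Di = ∂R/∂θ_i` and `Dj = ∂R/∂θ_j`. -/
def matML {n : ℕ} (R Di Dj : Matrix (Fin n) (Fin n) ℝ) : Matrix (Fin n) (Fin n) ℝ :=
  (1 / 2 : ℝ) • (R⁻¹ * Di * R⁻¹ * Dj)

/-- The matrix `M^i` of the gradient of the cross validation criterion. -/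
def matGradCV {n : ℕ} (R Di : Matrix (Fin n) (Fin n) ℝ) : Matrix (Fin n) (Fin n) ℝ :=
  R⁻¹ * (dg R⁻¹)⁻¹ ^ 2 * (dg (R⁻¹ * Di * R⁻¹) * (dg R⁻¹)⁻¹ - R⁻¹ * Di) * R⁻¹

/-- `M_{CV,1}^{i,j}`. -/
def matCV1 {n : ℕ} (R Di Dj : Matrix (Fin n) (Fin n) ℝ) : Matrix (Fin n) (Fin n) ℝ :=
  (2 : ℝ) • ((matGradCV R Di + (matGradCV R Di)ᵀ) * R *
    (matGradCV R Dj + (matGradCV R Dj)ᵀ) * R)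

/-- `M_{CV,2}^{i,j}`. -/
def matCV2 {n : ℕ} (R Di Dj : Matrix (Fin n) (Fin n) ℝ) : Matrix (Fin n) (Fin n) ℝ :=
  (-8 : ℝ) • ((dg R⁻¹)⁻¹ ^ 3 * dg (R⁻¹ * Di * R⁻¹) * R⁻¹ * Dj * R⁻¹)
  + (2 : ℝ) • ((dg R⁻¹)⁻¹ ^ 2 * R⁻¹ * Di * R⁻¹ * Dj * R⁻¹)
  + (6 : ℝ) • ((dg R⁻¹)⁻¹ ^ 4 * dg (R⁻¹ * Di * R⁻¹) * dg (R⁻¹ * Dj * R⁻¹) * R⁻¹)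

/-- `Tr(M^{i,j})` at the parameter `θ₀`, for the `n` first observation points, where `M` is one of
`matML`, `matCV1`, `matCV2`. -/
def traceAt {p d : ℕ}
    (M : ∀ {n : ℕ}, Matrix (Fin n) (Fin n) ℝ → Matrix (Fin n) (Fin n) ℝ →
      Matrix (Fin n) (Fin n) ℝ → Matrix (Fin n) (Fin n) ℝ)
    (Θ : Set (Fin p → ℝ)) (K : (Fin p → ℝ) → EuclideanSpace ℝ (Fin d) → ℝ) (θ₀ : Fin p → ℝ)
    (v : ℕ → Fin d → ℕ) (i j : Fin p) (x : ℕ → EuclideanSpace ℝ (Fin d)) (n : ℕ) (ε : ℝ) : ℝ :=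
  (M (gridMatrix (K θ₀) v x ε n)
    (gridMatrix (thetaPartial₁ Θ K i θ₀) v x ε n)
    (gridMatrix (thetaPartial₁ Θ K j θ₀) v x ε n)).trace

/-- `S(ε)` is, for every `ε ∈ [0, 1/2)`, the almost sure limit of `(1/n) T_n(ε)` as `n → ∞`. -/
def IsAlmostSureLimit {Ω : Type*} [MeasurableSpace Ω] (P : Measure Ω)
    (T : Ω → ℕ → ℝ → ℝ) (S : ℝ → ℝ) : Prop :=
  ∀ ε ∈ Ico (0 : ℝ) (1 / 2), ∀ᵐ ω ∂P,
    Tendsto (fun n : ℕ => (1 / (n : ℝ)) * T ω n ε) atTop (𝓝 (S ε))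

/-- `S` is `C²` on `[0, 1/2)`, and for every `ε` in this interval
`∂²S/∂ε² = lim_n (1/n) E{∂²T_n/∂ε²}`, where it is part of the claim that `T_n` is almost surely
`C²` in `ε` and that the expectation exists. Derivatives at `ε = 0` are taken
within `[0, 1/2)`. -/
def SecondDerivativeExchange {Ω : Type*} [MeasurableSpace Ω] (P : Measure Ω)
    (T : Ω → ℕ → ℝ → ℝ) (S : ℝ → ℝ) : Prop :=
  ContDiffOn ℝ 2 S (Ico 0 (1 / 2)) ∧
  (∀ᵐ ω ∂P, ∀ n : ℕ, ContDiffOn ℝ 2 (T ω n) (Ico 0 (1 / 2))) ∧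
  ∀ ε ∈ Ico (0 : ℝ) (1 / 2),
    (∀ n : ℕ, Integrable (fun ω => iteratedDerivWithin 2 (T ω n) (Ico 0 (1 / 2)) ε) P) ∧
    Tendsto
      (fun n : ℕ => (1 / (n : ℝ)) * ∫ ω, iteratedDerivWithin 2 (T ω n) (Ico 0 (1 / 2)) ε ∂P)
      atTop (𝓝 (iteratedDerivWithin 2 S (Ico 0 (1 / 2)) ε))

end PerturbedGrid

end

namespace PerturbedGrid

noncomputable section

open scoped Matrix.Norms.L2Operator

section Families

/-- A family of functions is uniformly bounded on `s`. -/
def FamBdd {T S : Type*} {E : T → Type*} [∀ τ, Norm (E τ)] (s : Set S) (A : ∀ τ, S → E τ) : Prop :=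
  ∃ C : ℝ, ∀ τ, ∀ x ∈ s, ‖A τ x‖ ≤ C

/-- A family of functions has `k` successive derivatives within `s`, all uniformly bounded. -/
def FamJet {T : Type*} {E : T → Type*} [∀ τ, NormedAddCommGroup (E τ)] [∀ τ, NormedSpace ℝ (E τ)]
    (s : Set ℝ) : ℕ → (∀ τ, ℝ → E τ) → Prop
  | 0, A => FamBdd s A
  | k + 1, A => FamBdd s A ∧ ∃ A' : ∀ τ, ℝ → E τ,
      (∀ τ, ∀ x ∈ s, HasDerivWithinAt (A τ) (A' τ x) s x) ∧ FamJet s k A'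

variable {T S : Type*} {E : T → Type*} [∀ τ, NormedAddCommGroup (E τ)]

theorem FamBdd.add {s : Set S} {A B : ∀ τ, S → E τ} (hA : FamBdd s A) (hB : FamBdd s B) :
    FamBdd s (fun τ x => A τ x + B τ x) := by
  obtain ⟨C, hC⟩ := hA
  obtain ⟨D, hD⟩ := hB
  exact ⟨C + D, fun τ x hx => (norm_add_le _ _).trans (add_le_add (hC τ x hx) (hD τ x hx))⟩

variable [∀ τ, NormedSpace ℝ (E τ)]

theorem FamBdd.map {E' : T → Type*} [∀ τ, NormedAddCommGroup (E' τ)] [∀ τ, NormedSpace ℝ (E' τ)]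
    {s : Set S} {A : ∀ τ, S → E τ} (hA : FamBdd s A) {c : ℝ} (L : ∀ τ, E τ →ₗ[ℝ] E' τ)
    (hL : ∀ τ x, ‖L τ x‖ ≤ c * ‖x‖) : FamBdd s (fun τ x => L τ (A τ x)) := by
  obtain ⟨C, hC⟩ := hA
  refine ⟨|c| * C, fun τ x hx => (hL τ _).trans ?_⟩
  calc c * ‖A τ x‖ ≤ |c| * ‖A τ x‖ := by gcongr; exact le_abs_self c
    _ ≤ |c| * C := by gcongr; exact hC τ x hx

theorem FamJet.bdd {s : Set ℝ} {k : ℕ} {A : ∀ τ, ℝ → E τ} (hA : FamJet s k A) : FamBdd s A := by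
  cases k with
  | zero => exact hA
  | succ k => exact hA.1

theorem FamJet.pred {s : Set ℝ} {k : ℕ} {A : ∀ τ, ℝ → E τ} (hA : FamJet s (k + 1) A) :
    FamJet s k A := by
  induction k generalizing A with
  | zero => exact hA.1
  | succ k ih =>
    obtain ⟨h0, A', h1, h2⟩ := hA
    exact ⟨h0, A', h1, ih h2⟩

theorem FamJet.add {s : Set ℝ} {k : ℕ} {A B : ∀ τ, ℝ → E τ} (hA : FamJet s k A)
    (hB : FamJet s k B) : FamJet s k (fun τ x => A τ x + B τ x) := by
  induction k generalizing A B with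
  | zero => exact FamBdd.add hA hB
  | succ k ih =>
    obtain ⟨hA0, A', hA1, hA2⟩ := hA
    obtain ⟨hB0, B', hB1, hB2⟩ := hB
    exact ⟨hA0.add hB0, _, fun τ x hx => (hA1 τ x hx).add (hB1 τ x hx), ih hA2 hB2⟩

theorem FamJet.map {E' : T → Type*} [∀ τ, NormedAddCommGroup (E' τ)] [∀ τ, NormedSpace ℝ (E' τ)]
    {s : Set ℝ} {k : ℕ} {A : ∀ τ, ℝ → E τ} (hA : FamJet s k A) {c : ℝ} (L : ∀ τ, E τ →ₗ[ℝ] E' τ)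
    (hL : ∀ τ x, ‖L τ x‖ ≤ c * ‖x‖) : FamJet s k (fun τ x => L τ (A τ x)) := by
  induction k generalizing A with
  | zero => exact FamBdd.map hA L hL
  | succ k ih =>
    obtain ⟨hA0, A', hA1, hA2⟩ := hA
    refine ⟨hA0.map L hL, _, fun τ x hx => ?_, ih hA2⟩
    exact ((L τ).mkContinuous c (hL τ)).hasFDerivAt.comp_hasDerivWithinAt x (hA1 τ x hx)

theorem FamJet.comp {T' : Type*} {s : Set ℝ} {k : ℕ} {A : ∀ τ, ℝ → E τ} (hA : FamJet s k A)
    (g : T' → T) : FamJet s k (fun τ => A (g τ)) := by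
  induction k generalizing A with
  | zero =>
    obtain ⟨C, hC⟩ := hA
    exact ⟨C, fun τ => hC (g τ)⟩
  | succ k ih =>
    obtain ⟨⟨C, hC⟩, A', h1, h2⟩ := hA
    exact ⟨⟨C, fun τ => hC (g τ)⟩, _, fun τ => h1 (g τ), ih h2⟩

section Ring

variable {E : T → Type*} [∀ τ, NormedRing (E τ)]

theorem FamBdd.mul {s : Set S} {A B : ∀ τ, S → E τ} (hA : FamBdd s A) (hB : FamBdd s B) :
    FamBdd s (fun τ x => A τ x * B τ x) := by
  obtain ⟨C, hC⟩ := hA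
  obtain ⟨D, hD⟩ := hB
  exact ⟨C * D, fun τ x hx => (norm_mul_le _ _).trans
    (mul_le_mul (hC τ x hx) (hD τ x hx) (norm_nonneg _) ((norm_nonneg _).trans (hC τ x hx)))⟩

variable [∀ τ, NormedAlgebra ℝ (E τ)]

theorem FamJet.mul {s : Set ℝ} {k : ℕ} {A B : ∀ τ, ℝ → E τ} (hA : FamJet s k A)
    (hB : FamJet s k B) : FamJet s k (fun τ x => A τ x * B τ x) := by
  induction k generalizing A B with
  | zero => exact FamBdd.mul hA hB
  | succ k ih =>
    have hA' := hA.pred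
    have hB' := hB.pred
    obtain ⟨hA0, A', hA1, hA2⟩ := hA
    obtain ⟨hB0, B', hB1, hB2⟩ := hB
    exact ⟨hA0.mul hB0, _, fun τ x hx => (hA1 τ x hx).mul (hB1 τ x hx),
      (ih hA2 hB').add (ih hA' hB2)⟩

theorem FamJet.neg {s : Set ℝ} {k : ℕ} {A : ∀ τ, ℝ → E τ} (hA : FamJet s k A) :
    FamJet s k (fun τ x => -A τ x) :=
  hA.map (c := 1) (fun τ => -LinearMap.id) (fun τ x => by simp)

theorem FamJet.inverse [∀ τ, CompleteSpace (E τ)] {s : Set ℝ} {k : ℕ} {A : ∀ τ, ℝ → E τ}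
    (hA : FamJet s k A) (hu : ∀ τ, ∀ x ∈ s, IsUnit (A τ x))
    (hb : FamBdd s (fun τ x => Ring.inverse (A τ x))) :
    FamJet s k (fun τ x => Ring.inverse (A τ x)) := by
  induction k with
  | zero => exact hb
  | succ k ih =>
    have ih' := ih hA.pred
    obtain ⟨hA0, A', hA1, hA2⟩ := hA
    refine ⟨hb, fun τ x => -(Ring.inverse (A τ x) * A' τ x * Ring.inverse (A τ x)),
      fun τ x hx => ?_, ((ih'.mul hA2).mul ih').neg⟩
    obtain ⟨u, hu⟩ := hu τ x hx
    have h := hasFDerivAt_ringInverse (𝕜 := ℝ) u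
    rw [hu] at h
    have h2 := h.comp_hasDerivWithinAt x (hA1 τ x hx)
    have h3 : (-ContinuousLinearMap.mulLeftRight ℝ (E τ) ↑u⁻¹ ↑u⁻¹) (A' τ x)
        = -(Ring.inverse (A τ x) * A' τ x * Ring.inverse (A τ x)) := by
      rw [← hu, Ring.inverse_unit]
      simp
    rw [h3] at h2
    exact h2

end Ring

end Families

section MatrixExpressions

/-- The diagonal part of a square matrix. -/
def diagPart {ι : Type*} [DecidableEq ι] (A : Matrix ι ι ℝ) : Matrix ι ι ℝ :=
  Matrix.diagonal fun a => A a a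

/-- The diagonal part as a linear map. -/
def diagPartLinear (ι : Type*) [DecidableEq ι] : Matrix ι ι ℝ →ₗ[ℝ] Matrix ι ι ℝ where
  toFun := diagPart
  map_add' A B := (Matrix.diagonal_add (fun a => A a a) (fun a => B a a)).symm
  map_smul' c A := Matrix.diagonal_smul c (fun a => A a a)

/-- `R` is coercive with constant `c`. -/
def Coercive {ι : Type*} [Fintype ι] (c : ℝ) (R : Matrix ι ι ℝ) : Prop :=
  ∀ x : ι → ℝ, c * (x ⬝ᵥ x) ≤ x ⬝ᵥ (R *ᵥ x)

/-- Noncommutative expressions in `R`, two further matrices, `R⁻¹` and `(diag R⁻¹)⁻¹`. -/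
inductive MatExpr : Type
  | base : MatExpr
  | fst : MatExpr
  | snd : MatExpr
  | baseInv : MatExpr
  | diagInv : MatExpr
  | add : MatExpr → MatExpr → MatExpr
  | smul : ℝ → MatExpr → MatExpr
  | mul : MatExpr → MatExpr → MatExpr
  | diag : MatExpr → MatExpr
  | transpose : MatExpr → MatExpr

/-- The value of a matrix expression. -/
def MatExpr.eval {ι : Type*} [Fintype ι] [DecidableEq ι] (R D D' : Matrix ι ι ℝ) :
    MatExpr → Matrix ι ι ℝ
  | base => R
  | fst => D
  | snd => D'
  | baseInv => R⁻¹
  | diagInv => (diagPart R⁻¹)⁻¹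
  | add e f => e.eval R D D' + f.eval R D D'
  | smul c e => c • e.eval R D D'
  | mul e f => e.eval R D D' * f.eval R D D'
  | diag e => diagPart (e.eval R D D')
  | transpose e => (e.eval R D D')ᵀ

/-- The expression of `matML`. -/
def exprML : MatExpr := .smul (1 / 2) (((MatExpr.baseInv.mul .fst).mul .baseInv).mul .snd)

/-- The expression of `matGradCV`, as a function of the derivative matrix. -/
def exprGradCV (D : MatExpr) : MatExpr :=
  ((MatExpr.baseInv.mul (MatExpr.diagInv.mul .diagInv)).mul
    (((((MatExpr.baseInv.mul D).mul .baseInv).diag).mul .diagInv).add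
      (.smul (-1) (MatExpr.baseInv.mul D)))).mul .baseInv

/-- The expression of `matCV1`. -/
def exprCV1 : MatExpr :=
  .smul 2 (((((exprGradCV .fst).add (exprGradCV .fst).transpose).mul .base).mul
    ((exprGradCV .snd).add (exprGradCV .snd).transpose)).mul .base)

/-- The expression of `matCV2`. -/
def exprCV2 : MatExpr :=
  ((MatExpr.smul (-8) (((((((MatExpr.diagInv.mul .diagInv).mul .diagInv).mul
      ((MatExpr.baseInv.mul .fst).mul .baseInv).diag).mul .baseInv).mul .snd).mul .baseInv))).add
    (MatExpr.smul 2 (((((((MatExpr.diagInv.mul .diagInv).mul .baseInv).mul .fst).mul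
      .baseInv).mul .snd).mul .baseInv)))).add
    (MatExpr.smul 6 ((((((MatExpr.diagInv.mul .diagInv).mul .diagInv).mul .diagInv).mul
      ((MatExpr.baseInv.mul .fst).mul .baseInv).diag).mul
      ((MatExpr.baseInv.mul .snd).mul .baseInv).diag).mul .baseInv))

theorem eval_exprGradCV_fst {n : ℕ} (R D D' : Matrix (Fin n) (Fin n) ℝ) :
    (exprGradCV .fst).eval R D D' = matGradCV R D := by
  simp only [exprGradCV, MatExpr.eval, matGradCV, pow_two, neg_one_smul, ← sub_eq_add_neg]
  rfl

theorem eval_exprGradCV_snd {n : ℕ} (R D D' : Matrix (Fin n) (Fin n) ℝ) :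
    (exprGradCV .snd).eval R D D' = matGradCV R D' := by
  simp only [exprGradCV, MatExpr.eval, matGradCV, pow_two, neg_one_smul, ← sub_eq_add_neg]
  rfl

theorem eval_exprCV1 {n : ℕ} (R D D' : Matrix (Fin n) (Fin n) ℝ) :
    exprCV1.eval R D D' = matCV1 R D D' := by
  simp only [exprCV1, MatExpr.eval, matCV1, eval_exprGradCV_fst, eval_exprGradCV_snd]

theorem eval_exprCV2 {n : ℕ} (R D D' : Matrix (Fin n) (Fin n) ℝ) :
    exprCV2.eval R D D' = matCV2 R D D' := by
  simp only [exprCV2, MatExpr.eval, matCV2, pow_succ, pow_zero, one_mul]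
  rfl

variable {ι : Type*} [Fintype ι]

theorem norm_toLp_sq (x : ι → ℝ) : ‖WithLp.toLp 2 x‖ ^ 2 = x ⬝ᵥ x := by
  rw [EuclideanSpace.real_norm_sq_eq]
  simp [dotProduct, pow_two]

theorem Coercive.le_norm {c : ℝ} {R : Matrix ι ι ℝ} (hR : Coercive c R) (x : ι → ℝ) :
    c * ‖WithLp.toLp 2 x‖ ≤ ‖WithLp.toLp 2 (R *ᵥ x)‖ := by
  have h := hR x
  have h2 := real_inner_le_norm (WithLp.toLp 2 (R *ᵥ x)) (WithLp.toLp 2 x)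
  rw [EuclideanSpace.inner_toLp_toLp] at h2
  simp only [star_trivial] at h2
  rw [← norm_toLp_sq] at h
  rcases (norm_nonneg (WithLp.toLp 2 x)).eq_or_lt with h0 | h0
  · rw [← h0]; simp
  · refine le_of_mul_le_mul_right ?_ h0
    nlinarith

variable [DecidableEq ι]

theorem dotProduct_mulVec_le_norm (A : Matrix ι ι ℝ) (x y : ι → ℝ) :
    |x ⬝ᵥ (A *ᵥ y)| ≤ ‖A‖ * ‖WithLp.toLp 2 x‖ * ‖WithLp.toLp 2 y‖ := by
  have h := Matrix.l2_opNorm_mulVec A (WithLp.toLp 2 y)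
  have h2 := abs_real_inner_le_norm (WithLp.toLp 2 (A *ᵥ y)) (WithLp.toLp 2 x)
  rw [EuclideanSpace.inner_toLp_toLp] at h2
  simp only [star_trivial] at h2
  refine h2.trans ?_
  rw [mul_comm (‖A‖), mul_assoc, mul_comm]
  exact mul_le_mul_of_nonneg_left h (norm_nonneg _)

theorem opNorm_le_of_mulVec (A : Matrix ι ι ℝ) {c : ℝ} (hc : 0 ≤ c)
    (h : ∀ x : ι → ℝ, ‖WithLp.toLp 2 (A *ᵥ x)‖ ≤ c * ‖WithLp.toLp 2 x‖) : ‖A‖ ≤ c := by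
  rw [Matrix.cstar_norm_def]
  exact ContinuousLinearMap.opNorm_le_bound _ hc fun x => h x.ofLp

theorem abs_apply_le_opNorm (A : Matrix ι ι ℝ) (a b : ι) : |A a b| ≤ ‖A‖ := by
  have h := dotProduct_mulVec_le_norm A (Pi.single a 1) (Pi.single b 1)
  simpa using h

theorem norm_diagPart_le (A : Matrix ι ι ℝ) : ‖diagPart A‖ ≤ ‖A‖ := by
  rw [diagPart, Matrix.l2_opNorm_diagonal]
  exact (pi_norm_le_iff_of_nonneg (norm_nonneg _)).2 fun a => abs_apply_le_opNorm A a a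

theorem norm_transpose (A : Matrix ι ι ℝ) : ‖Aᵀ‖ = ‖A‖ := by
  rw [← Matrix.conjTranspose_eq_transpose_of_trivial, Matrix.l2_opNorm_conjTranspose]

theorem norm_one_le : ‖(1 : Matrix ι ι ℝ)‖ ≤ 1 := by
  refine opNorm_le_of_mulVec _ zero_le_one fun x => ?_
  simp

theorem abs_trace_le (A : Matrix ι ι ℝ) : |A.trace| ≤ Fintype.card ι * ‖A‖ := by
  rw [Matrix.trace]
  refine (Finset.abs_sum_le_sum_abs _ _).trans ?_
  refine (Finset.sum_le_card_nsmul _ _ ‖A‖ fun a _ => abs_apply_le_opNorm A a a).trans ?_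
  simp

theorem Coercive.isUnit_det {c : ℝ} (hc : 0 < c) {R : Matrix ι ι ℝ} (hR : Coercive c R) :
    IsUnit R.det := by
  rw [← Matrix.isUnit_iff_isUnit_det, ← Matrix.mulVec_injective_iff_isUnit]
  intro x y hxy
  have h := hR.le_norm (x - y)
  have h1 : R *ᵥ x = R *ᵥ y := hxy
  rw [Matrix.mulVec_sub, h1, sub_self] at h
  have h0 : ‖WithLp.toLp 2 (x - y)‖ = 0 := by
    have : ‖WithLp.toLp 2 (0 : ι → ℝ)‖ = 0 := by simp
    rw [this] at h
    nlinarith [norm_nonneg (WithLp.toLp 2 (x - y))]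
  have := norm_eq_zero.1 h0
  simpa [sub_eq_zero] using this

theorem Coercive.norm_inv_le {c : ℝ} (hc : 0 < c) {R : Matrix ι ι ℝ} (hR : Coercive c R) :
    ‖R⁻¹‖ ≤ c⁻¹ := by
  refine opNorm_le_of_mulVec _ (by positivity) fun x => ?_
  have h := hR.le_norm (R⁻¹ *ᵥ x)
  rw [Matrix.mulVec_mulVec, Matrix.mul_nonsing_inv _ (hR.isUnit_det hc), Matrix.one_mulVec] at h
  rw [inv_mul_eq_div, le_div_iff₀ hc, mul_comm]
  exact h

theorem Coercive.le_inv_diag {c C : ℝ} (hc : 0 < c) {R : Matrix ι ι ℝ} (hR : Coercive c R)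
    (hC : ‖R‖ ≤ C) (a : ι) : c / C ^ 2 ≤ R⁻¹ a a := by
  set e : ι → ℝ := Pi.single a 1 with he
  set y := R⁻¹ *ᵥ e with hy
  have hRy : R *ᵥ y = e := by
    rw [hy, Matrix.mulVec_mulVec, Matrix.mul_nonsing_inv _ (hR.isUnit_det hc), Matrix.one_mulVec]
  have h1 : R⁻¹ a a = y ⬝ᵥ (R *ᵥ y) := by
    rw [hRy, hy, he]; simp
  have h2 := hR y
  have h3 := Matrix.l2_opNorm_mulVec R (WithLp.toLp 2 y)
  have h4 : (1 : ℝ) ≤ C * ‖WithLp.toLp 2 y‖ := by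
    have : ‖WithLp.toLp 2 (R *ᵥ y)‖ = 1 := by rw [hRy, he]; simp
    calc (1 : ℝ) = _ := this.symm
      _ ≤ _ := h3
      _ ≤ _ := by gcongr
  have hC0 : 0 < C := by
    by_contra hneg
    nlinarith [norm_nonneg (WithLp.toLp 2 y), norm_nonneg R]
  rw [← norm_toLp_sq] at h2
  rw [h1, div_le_iff₀ (by positivity)]
  have h5 : (1 : ℝ) ≤ (C * ‖WithLp.toLp 2 y‖) ^ 2 := one_le_pow₀ h4
  calc c = c * 1 := (mul_one c).symm
    _ ≤ c * (C * ‖WithLp.toLp 2 y‖) ^ 2 := by gcongr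
    _ = c * ‖WithLp.toLp 2 y‖ ^ 2 * C ^ 2 := by ring
    _ ≤ _ := by gcongr

theorem Coercive.diagPart_inv {c C : ℝ} (hc : 0 < c) {R : Matrix ι ι ℝ} (hR : Coercive c R)
    (hC : ‖R‖ ≤ C) (hC0 : 0 < C) :
    IsUnit (diagPart R⁻¹).det ∧ ‖(diagPart R⁻¹)⁻¹‖ ≤ C ^ 2 / c := by
  have hpos : ∀ a, 0 < R⁻¹ a a := fun a =>
    lt_of_lt_of_le (by positivity) (hR.le_inv_diag hc hC a)
  have hu : IsUnit (diagPart R⁻¹).det := by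
    rw [diagPart, Matrix.det_diagonal, isUnit_iff_ne_zero]
    exact Finset.prod_ne_zero_iff.2 fun a _ => (hpos a).ne'
  refine ⟨hu, ?_⟩
  have hinv : (diagPart R⁻¹)⁻¹ = Matrix.diagonal fun a => (R⁻¹ a a)⁻¹ := by
    refine Matrix.inv_eq_right_inv ?_
    rw [diagPart, Matrix.diagonal_mul_diagonal, ← Matrix.diagonal_one]
    congr 1
    funext a
    exact mul_inv_cancel₀ (hpos a).ne'
  rw [hinv, Matrix.l2_opNorm_diagonal]
  refine (pi_norm_le_iff_of_nonneg (by positivity)).2 fun a => ?_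
  rw [Real.norm_eq_abs, abs_of_pos (inv_pos.2 (hpos a)), ← inv_div]
  exact inv_anti₀ (by positivity) (hR.le_inv_diag hc hC a)

end MatrixExpressions

section Classes

variable {T S : Type*} {ι : T → Type*} [∀ τ, Fintype (ι τ)] [∀ τ, DecidableEq (ι τ)]

/-- A class of families of matrices that is stable under the operations of matrix expressions. -/
structure MatClass (s : Set S) (Q : (∀ τ, S → Matrix (ι τ) (ι τ) ℝ) → Prop) : Prop where
  add : ∀ {A B}, Q A → Q B → Q (fun τ x => A τ x + B τ x)
  smul : ∀ (c : ℝ) {A}, Q A → Q (fun τ x => c • A τ x)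
  mul : ∀ {A B}, Q A → Q B → Q (fun τ x => A τ x * B τ x)
  diag : ∀ {A}, Q A → Q (fun τ x => diagPart (A τ x))
  transpose : ∀ {A}, Q A → Q (fun τ x => (A τ x)ᵀ)
  inv : ∀ {A}, Q A → (∀ τ, ∀ x ∈ s, IsUnit (A τ x).det) →
    FamBdd s (fun τ x => (A τ x)⁻¹) → Q (fun τ x => (A τ x)⁻¹)

theorem MatClass.eval {s : Set S} {Q : (∀ τ, S → Matrix (ι τ) (ι τ) ℝ) → Prop}
    (hQ : MatClass s Q) {R D D' : ∀ τ, S → Matrix (ι τ) (ι τ) ℝ} (hR : Q R) (hD : Q D)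
    (hD' : Q D') (hb : FamBdd s R) {c : ℝ} (hc : 0 < c)
    (hcoer : ∀ τ, ∀ x ∈ s, Coercive c (R τ x)) (e : MatExpr) :
    Q (fun τ x => e.eval (R τ x) (D τ x) (D' τ x)) := by
  have hinv : Q (fun τ x => (R τ x)⁻¹) :=
    hQ.inv hR (fun τ x hx => (hcoer τ x hx).isUnit_det hc)
      ⟨c⁻¹, fun τ x hx => (hcoer τ x hx).norm_inv_le hc⟩
  obtain ⟨C, hC⟩ := hb
  have hC' : ∀ τ, ∀ x ∈ s, ‖R τ x‖ ≤ max C 1 := fun τ x hx => (hC τ x hx).trans (le_max_left _ _)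
  have hpos : 0 < max C 1 := lt_of_lt_of_le one_pos (le_max_right _ _)
  induction e with
  | base => exact hR
  | fst => exact hD
  | snd => exact hD'
  | baseInv => exact hinv
  | diagInv =>
    exact hQ.inv (hQ.diag hinv)
      (fun τ x hx => ((hcoer τ x hx).diagPart_inv hc (hC' τ x hx) hpos).1)
      ⟨_, fun τ x hx => ((hcoer τ x hx).diagPart_inv hc (hC' τ x hx) hpos).2⟩
  | add e f he hf => exact hQ.add he hf
  | smul c e he => exact hQ.smul c he
  | mul e f he hf => exact hQ.mul he hf
  | diag e he => exact hQ.diag he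
  | transpose e he => exact hQ.transpose he

theorem matClass_famJet (s : Set ℝ) (k : ℕ) :
    MatClass (ι := ι) s (FamJet (E := fun τ => Matrix (ι τ) (ι τ) ℝ) s k) where
  add := FamJet.add
  smul c A hA := hA.map (c := |c|) (fun τ => c • LinearMap.id) (fun τ x => by simp [norm_smul])
  mul := FamJet.mul
  diag hA := hA.map (c := 1) (fun τ => diagPartLinear (ι τ))
    (fun τ x => (norm_diagPart_le x).trans (one_mul _).ge)
  transpose hA := hA.map (c := 1) (fun τ => (Matrix.transposeLinearEquiv (ι τ) (ι τ) ℝ ℝ).toLinearMap)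
    (fun τ x => by simpa using (norm_transpose x).le)
  inv {A} hA hu hb := by
    have : ∀ τ, CompleteSpace (Matrix (ι τ) (ι τ) ℝ) := fun τ => FiniteDimensional.complete ℝ _
    simp only [Matrix.nonsing_inv_eq_ringInverse] at hb ⊢
    exact hA.inverse (fun τ x hx => (Matrix.isUnit_iff_isUnit_det _).2 (hu τ x hx)) hb

/-- A uniformly bounded family of pairs of matrices, whose differences are bounded by a multiple of
`δ` in the norm dual to the operator norm. -/
def FamClose (δ : T → ℝ) (A : ∀ τ, Bool → Matrix (ι τ) (ι τ) ℝ) : Prop :=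
  FamBdd univ A ∧ ∃ C : ℝ, ∀ τ Z, |((A τ true - A τ false) * Z).trace| ≤ C * δ τ * ‖Z‖

theorem matClass_famClose {δ : T → ℝ} (hδ : ∀ τ, 0 ≤ δ τ) :
    MatClass (ι := ι) univ (FamClose (ι := ι) δ) where
  add {A B} hA hB := by
    obtain ⟨hA0, C, hC⟩ := hA
    obtain ⟨hB0, D, hD⟩ := hB
    refine ⟨hA0.add hB0, C + D, fun τ Z => ?_⟩
    have : (A τ true + B τ true - (A τ false + B τ false)) * Z
        = (A τ true - A τ false) * Z + (B τ true - B τ false) * Z := by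
      rw [← add_mul]; congr 1; abel
    rw [this, Matrix.trace_add, add_mul, add_mul]
    exact (abs_add_le _ _).trans (add_le_add (hC τ Z) (hD τ Z))
  smul c A hA := by
    obtain ⟨hA0, C, hC⟩ := hA
    refine ⟨hA0.map (c := |c|) (fun τ => c • LinearMap.id) (fun τ x => by simp [norm_smul]),
      |c| * C, fun τ Z => ?_⟩
    rw [← smul_sub, Matrix.smul_mul, Matrix.trace_smul, smul_eq_mul, abs_mul]
    calc |c| * _ ≤ |c| * (C * δ τ * ‖Z‖) := by gcongr; exact hC τ Z
      _ = _ := by ring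
  mul {A B} hA hB := by
    obtain ⟨hA0, C, hC⟩ := hA
    obtain ⟨hB0, D, hD⟩ := hB
    have hAB := hA0.mul hB0
    obtain ⟨a, ha⟩ := hA0
    obtain ⟨b, hb⟩ := hB0
    refine ⟨hAB, |C| * |b| + |D| * |a|, fun τ Z => ?_⟩
    have : (A τ true * B τ true - A τ false * B τ false) * Z
        = (A τ true - A τ false) * (B τ true * Z) + A τ false * ((B τ true - B τ false) * Z) := by
      noncomm_ring
    rw [this, Matrix.trace_add, Matrix.trace_mul_comm (A τ false), Matrix.mul_assoc]
    have h1 := hC τ (B τ true * Z)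
    have h2 := hD τ (Z * A τ false)
    have h3 : ‖B τ true * Z‖ ≤ |b| * ‖Z‖ := (norm_mul_le _ _).trans
      (by gcongr; exact (hb τ true trivial).trans (le_abs_self b))
    have h4 : ‖Z * A τ false‖ ≤ ‖Z‖ * |a| := (norm_mul_le _ _).trans
      (by gcongr; exact (ha τ false trivial).trans (le_abs_self a))
    have hd := hδ τ
    refine (abs_add_le _ _).trans ?_
    calc _ ≤ C * δ τ * ‖B τ true * Z‖ + D * δ τ * ‖Z * A τ false‖ := add_le_add h1 h2
      _ ≤ |C| * δ τ * (|b| * ‖Z‖) + |D| * δ τ * (‖Z‖ * |a|) := by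
        gcongr
        · exact le_abs_self C
        · exact le_abs_self D
      _ = _ := by ring
  diag {A} hA := by
    obtain ⟨⟨a, ha⟩, C, hC⟩ := hA
    refine ⟨⟨a, fun τ x hx => (norm_diagPart_le _).trans (ha τ x hx)⟩, |C|, fun τ Z => ?_⟩
    have : ((diagPart (A τ true) - diagPart (A τ false)) * Z).trace
        = ((A τ true - A τ false) * diagPart Z).trace := by
      simp only [Matrix.trace, diagPart, sub_mul, Matrix.diag_apply, Matrix.sub_apply,
        Matrix.diagonal_mul, Matrix.mul_diagonal]
    rw [this]
    have hd := hδ τ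
    refine (hC τ _).trans ?_
    gcongr
    · exact le_abs_self C
    · exact norm_diagPart_le Z
  transpose {A} hA := by
    obtain ⟨⟨a, ha⟩, C, hC⟩ := hA
    refine ⟨⟨a, fun τ x hx => (norm_transpose _).le.trans (ha τ x hx)⟩, C, fun τ Z => ?_⟩
    have := hC τ Zᵀ
    rwa [norm_transpose, ← Matrix.trace_transpose, Matrix.transpose_mul, Matrix.transpose_transpose,
      Matrix.trace_mul_comm, Matrix.transpose_sub] at this
  inv {A} hA hu hb := by
    refine ⟨hb, ?_⟩
    obtain ⟨-, C, hC⟩ := hA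
    obtain ⟨b, hb⟩ := hb
    refine ⟨|C| * (|b| * |b|), fun τ Z => ?_⟩
    have h1 : (A τ true)⁻¹ - (A τ false)⁻¹
        = -((A τ true)⁻¹ * ((A τ true - A τ false) * (A τ false)⁻¹)) := by
      rw [sub_mul, mul_sub, Matrix.mul_nonsing_inv _ (hu τ false trivial), ← mul_assoc,
        Matrix.nonsing_inv_mul _ (hu τ true trivial)]
      simp
    have h2 : (((A τ true)⁻¹ - (A τ false)⁻¹) * Z).trace
        = -((A τ true - A τ false) * ((A τ false)⁻¹ * Z * (A τ true)⁻¹)).trace := by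
      rw [h1, neg_mul, Matrix.trace_neg, mul_assoc, Matrix.trace_mul_comm]
      simp only [mul_assoc]
    rw [h2, abs_neg]
    have hn : ‖(A τ false)⁻¹ * Z * (A τ true)⁻¹‖ ≤ |b| * ‖Z‖ * |b| := by
      refine (norm_mul_le _ _).trans ?_
      gcongr
      · refine (norm_mul_le _ _).trans ?_
        gcongr
        exact (hb τ false trivial).trans (le_abs_self b)
      · exact (hb τ true trivial).trans (le_abs_self b)
    have hd := hδ τ
    calc _ ≤ C * δ τ * ‖(A τ false)⁻¹ * Z * (A τ true)⁻¹‖ := hC τ _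
      _ ≤ |C| * δ τ * (|b| * ‖Z‖ * |b|) := by gcongr; exact le_abs_self C
      _ = _ := by ring

end Classes

section Lattice

variable {d : ℕ}

/-- The weight `1 / (1 + |z|_∞^{d+1})` of a lattice vector. -/
def weight (z : Fin d → ℤ) : ℝ := 1 / (1 + ‖z‖ ^ (d + 1))

theorem weight_pos (z : Fin d → ℤ) : 0 < weight z := by unfold weight; positivity

theorem weight_neg (z : Fin d → ℤ) : weight (-z) = weight z := by simp [weight]

theorem norm_intCast_pi (z : Fin d → ℤ) : ‖(fun k => (z k : ℝ))‖ = ‖z‖ := by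
  refine le_antisymm ?_ ?_
  · refine (pi_norm_le_iff_of_nonneg (norm_nonneg _)).2 fun k => ?_
    simpa only [Int.norm_eq_abs, Real.norm_eq_abs] using norm_le_pi_norm z k
  · refine (pi_norm_le_iff_of_nonneg (norm_nonneg _)).2 fun k => ?_
    simpa only [Int.norm_eq_abs, Real.norm_eq_abs] using
      norm_le_pi_norm (fun k => (z k : ℝ)) k

theorem summable_weight : Summable (weight : (Fin d → ℤ) → ℝ) := by
  set b := Pi.basisFun ℝ (Fin d)
  set L := Submodule.span ℤ (Set.range b) with hL
  have hrank : Module.finrank ℤ L = d := by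
    rw [hL, finrank_span_eq_card (b.linearIndependent.restrict_scalars' ℤ)]
    simp
  have hmem : ∀ z : Fin d → ℤ, (fun k => (z k : ℝ)) ∈ L := fun z => by
    rw [hL, Module.Basis.mem_span_iff_repr_mem]
    intro i
    exact ⟨z i, by simp [b]⟩
  have h1 := ZLattice.summable_norm_pow_inv L (d + 1) (by omega)
  have h2 := h1.comp_injective (i := fun z : Fin d → ℤ => (⟨_, hmem z⟩ : L)) (fun z w h => by
    funext k
    have : (z k : ℝ) = w k := congrFun (Subtype.ext_iff.1 h) k
    exact_mod_cast this)
  have h3 : Summable fun z : Fin d → ℤ => ‖z‖⁻¹ ^ (d + 1) := by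
    refine h2.congr fun z => ?_
    simp only [Function.comp, ← norm_intCast_pi z, Submodule.coe_norm]
  have h4 : Summable fun z : Fin d → ℤ => ‖z‖⁻¹ ^ (d + 1) + if z = 0 then 1 else 0 :=
    h3.add (summable_of_ne_finset_zero (s := {0}) fun z hz => by simp_all)
  refine Summable.of_nonneg_of_le (fun z => (weight_pos z).le) (fun z => ?_) h4
  by_cases hz : z = 0
  · simp [hz, weight]
  · have : 0 < ‖z‖ := norm_pos_iff.2 hz
    rw [if_neg hz, add_zero, weight, inv_pow, one_div]
    exact inv_anti₀ (by positivity) (by linarith)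

theorem sum_weight_sub_le {ι : Type*} [Fintype ι] {z : ι → Fin d → ℤ} (hz : Function.Injective z)
    (w : Fin d → ℤ) : ∑ b, weight (w - z b) ≤ ∑' y : Fin d → ℤ, weight y := by
  have hinj : Function.Injective fun b => w - z b := fun a b h => hz (sub_right_injective h)
  rw [← tsum_fintype (L := .unconditional _)]
  exact Summable.tsum_le_tsum_of_inj _ hinj (fun c _ => (weight_pos c).le) (fun b => le_rfl)
    (Summable.of_finite) summable_weight

theorem one_le_norm_of_ne_zero {z : Fin d → ℤ} (hz : z ≠ 0) : 1 ≤ ‖z‖ := by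
  obtain ⟨k, hk⟩ := Function.ne_iff.1 hz
  refine le_trans ?_ (norm_le_pi_norm z k)
  rw [Int.norm_eq_abs]
  exact_mod_cast Int.one_le_abs hk

end Lattice

section Schur

variable {ι : Type*} [Fintype ι]

theorem norm_le_of_rowSum [DecidableEq ι] {A w : Matrix ι ι ℝ} {s : ℝ} (hs : 0 ≤ s)
    (hA : ∀ a b, |A a b| ≤ w a b) (hsymm : ∀ a b, w a b = w b a) (hrow : ∀ a, ∑ b, w a b ≤ s) :
    ‖A‖ ≤ s := by
  have hw : ∀ a b, 0 ≤ w a b := fun a b => (abs_nonneg _).trans (hA a b)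
  refine opNorm_le_of_mulVec _ hs fun x => ?_
  refine le_of_sq_le_sq ?_ (by positivity)
  rw [mul_pow, EuclideanSpace.real_norm_sq_eq, EuclideanSpace.real_norm_sq_eq]
  calc ∑ a, (A *ᵥ x) a ^ 2 ≤ ∑ a, s * ∑ b, w a b * x b ^ 2 := by
        refine Finset.sum_le_sum fun a _ => ?_
        refine (Finset.sum_sq_le_sum_mul_sum_of_sq_le_mul (f := fun b => w a b)
          (g := fun b => w a b * x b ^ 2) _ (fun b _ => hw a b)
          (fun b _ => mul_nonneg (hw a b) (sq_nonneg _)) (fun b _ => ?_)).trans ?_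
        · have h2 : A a b ^ 2 ≤ w a b ^ 2 := sq_le_sq.2 ((hA a b).trans (le_abs_self _))
          calc (A a b * x b) ^ 2 = A a b ^ 2 * x b ^ 2 := mul_pow _ _ _
            _ ≤ w a b ^ 2 * x b ^ 2 := by gcongr
            _ = w a b * (w a b * x b ^ 2) := by ring
        · exact mul_le_mul_of_nonneg_right (hrow a)
            (Finset.sum_nonneg fun b _ => mul_nonneg (hw a b) (sq_nonneg _))
    _ = s * ∑ b, (∑ a, w b a) * x b ^ 2 := by
        rw [← Finset.mul_sum, Finset.sum_comm]
        congr 1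
        refine Finset.sum_congr rfl fun b _ => ?_
        rw [Finset.sum_mul]
        exact Finset.sum_congr rfl fun a _ => by rw [hsymm]
    _ ≤ s * ∑ b, s * x b ^ 2 := by gcongr with b; exact hrow b
    _ = s ^ 2 * ∑ b, x b ^ 2 := by rw [← Finset.mul_sum]; ring

end Schur

section Configurations

variable {d : ℕ}

/-- A finite configuration of distinct lattice points, together with perturbation vectors of
sup-norm at most one. -/
structure Config (d : ℕ) : Type 1 where
  /-- the index set -/
  idx : Type
  [fintype : Fintype idx]
  [decEq : DecidableEq idx]
  /-- the lattice points -/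
  site : idx → Fin d → ℤ
  inj : Function.Injective site
  /-- the perturbations -/
  pert : idx → EuclideanSpace ℝ (Fin d)
  pert_le : ∀ a k, |pert a k| ≤ 1

instance (c : Config d) : Fintype c.idx := c.fintype

instance (c : Config d) : DecidableEq c.idx := c.decEq

/-- The perturbed points `z_a + ε x_a`. -/
def gridPoint {ι : Type*} (z : ι → Fin d → ℤ) (x : ι → EuclideanSpace ℝ (Fin d)) (ε : ℝ) (a : ι) :
    EuclideanSpace ℝ (Fin d) :=
  WithLp.toLp 2 (fun k => (z a k : ℝ)) + ε • x a

/-- The matrix of a kernel at the perturbed points. -/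
def kernelMatrix {ι : Type*} (h : EuclideanSpace ℝ (Fin d) → ℝ) (z : ι → Fin d → ℤ)
    (x : ι → EuclideanSpace ℝ (Fin d)) (ε : ℝ) : Matrix ι ι ℝ :=
  Matrix.of fun a b => h (gridPoint z x ε a - gridPoint z x ε b)

/-- The matrix of a kernel at the perturbed points of a configuration. -/
def Config.mat (c : Config d) (h : EuclideanSpace ℝ (Fin d) → ℝ) (ε : ℝ) :
    Matrix c.idx c.idx ℝ :=
  kernelMatrix h c.site c.pert ε

theorem gridPoint_sub {ι : Type*} (z : ι → Fin d → ℤ) (x : ι → EuclideanSpace ℝ (Fin d)) (ε : ℝ)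
    (a b : ι) : gridPoint z x ε a - gridPoint z x ε b
      = WithLp.toLp 2 (fun k => ((z a - z b) k : ℝ)) + ε • (x a - x b) := by
  ext k
  simp [gridPoint]
  ring

theorem Config.norm_sub_ge (c : Config d) {ε : ℝ} (hε : 0 ≤ ε) (a b : c.idx) :
    (1 - 2 * ε) * ‖c.site a - c.site b‖
      ≤ ‖gridPoint c.site c.pert ε a - gridPoint c.site c.pert ε b‖ := by
  by_cases hab : a = b
  · simp [hab]
  have hne : c.site a - c.site b ≠ 0 := sub_ne_zero.2 fun h => hab (c.inj h)
  have h1 := one_le_norm_of_ne_zero hne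
  have h2 : ‖c.site a - c.site b‖ ≤
      ‖gridPoint c.site c.pert ε a - gridPoint c.site c.pert ε b‖ + 2 * ε := by
    refine (pi_norm_le_iff_of_nonneg (by positivity)).2 fun k => ?_
    have h3 := PiLp.norm_apply_le
      (gridPoint c.site c.pert ε a - gridPoint c.site c.pert ε b) k
    rw [gridPoint_sub] at h3 ⊢
    have h4 : |ε * (c.pert a k - c.pert b k)| ≤ 2 * ε := by
      rw [abs_mul, abs_of_nonneg hε, mul_comm]
      gcongr
      exact (abs_sub _ _).trans (by linarith [c.pert_le a k, c.pert_le b k])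
    simp only [PiLp.add_apply, PiLp.smul_apply, PiLp.sub_apply, smul_eq_mul,
      Real.norm_eq_abs] at h3
    rw [Int.norm_eq_abs]
    have h5 := abs_sub_abs_le_abs_sub (((c.site a - c.site b) k : ℤ) : ℝ)
      (-(ε * (c.pert a k - c.pert b k)))
    rw [abs_neg, sub_neg_eq_add] at h5
    linarith
  nlinarith

theorem Config.inv_one_add_norm_le (c : Config d) {β ε : ℝ} (hβ : β < 1 / 2) (hε : ε ∈ Ico 0 β)
    (a b : c.idx) :
    1 / (1 + ‖gridPoint c.site c.pert ε a - gridPoint c.site c.pert ε b‖ ^ (d + 1))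
      ≤ (1 / (1 - 2 * β) ^ (d + 1)) * weight (c.site a - c.site b) := by
  have h := c.norm_sub_ge hε.1 a b
  have hr : 0 < 1 - 2 * β := by linarith
  have hr1 : (1 - 2 * β) ^ (d + 1) ≤ 1 := pow_le_one₀ hr.le (by linarith [hε.1, hε.2])
  rw [weight, one_div_mul_one_div]
  refine one_div_le_one_div_of_le (by positivity) ?_
  calc (1 - 2 * β) ^ (d + 1) * (1 + ‖c.site a - c.site b‖ ^ (d + 1))
      = (1 - 2 * β) ^ (d + 1) + ((1 - 2 * β) * ‖c.site a - c.site b‖) ^ (d + 1) := by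
        rw [mul_pow]; ring
    _ ≤ _ := by
      gcongr
      refine le_trans ?_ h
      gcongr
      exact hε.2.le

theorem Config.norm_le_of_weight (c : Config d) {A : Matrix c.idx c.idx ℝ} {C : ℝ} (hC : 0 ≤ C)
    (hA : ∀ a b, |A a b| ≤ C * weight (c.site a - c.site b)) :
    ‖A‖ ≤ C * ∑' y : Fin d → ℤ, weight y := by
  refine norm_le_of_rowSum (w := fun a b => C * weight (c.site a - c.site b))
    (mul_nonneg hC (tsum_nonneg fun y => (weight_pos y).le)) hA (fun a b => ?_) (fun a => ?_)
  · rw [← weight_neg, neg_sub]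
  · rw [← Finset.mul_sum]
    exact mul_le_mul_of_nonneg_left (sum_weight_sub_le c.inj _) hC

end Configurations

section Kernels

variable {d : ℕ}

/-- Regularity and decay of a kernel away from the origin. -/
structure RegularKernel (h : EuclideanSpace ℝ (Fin d) → ℝ) : Prop where
  differentiable : TimesDifferentiableOn 3 h {0}ᶜ
  bound : ∃ C : ℝ, ∀ t, |h t| ≤ C / (1 + ‖t‖ ^ (d + 1))
  bound_deriv : ∀ T > (0 : ℝ), ∀ k ∈ Finset.Icc 1 3, ∀ J : Fin k → Fin d,
    ∃ C : ℝ, ∀ t, T ≤ ‖t‖ → |spacePartial h J t| ≤ C / (1 + ‖t‖ ^ (d + 1))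

/-- The `m`-th derivative of `h` at `t` in the direction `u`. -/
def dirDeriv (h : EuclideanSpace ℝ (Fin d) → ℝ) (m : ℕ) (u t : EuclideanSpace ℝ (Fin d)) : ℝ :=
  iteratedFDerivWithin ℝ m h {0}ᶜ t fun _ => u

theorem dirDeriv_eq_sum (h : EuclideanSpace ℝ (Fin d) → ℝ) (m : ℕ)
    (u t : EuclideanSpace ℝ (Fin d)) :
    dirDeriv h m u t = ∑ J : Fin m → Fin d, (∏ l, u (J l)) * spacePartial h J t := by
  have hu : u = ∑ k, u k • EuclideanSpace.single k (1 : ℝ) := by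
    have := (EuclideanSpace.basisFun (Fin d) ℝ).sum_repr u
    simpa using this.symm
  have h1 : (fun _ : Fin m => u) = fun _ => ∑ k, u k • EuclideanSpace.single k (1 : ℝ) := by
    funext _; exact hu
  rw [dirDeriv, h1]
  refine ((iteratedFDerivWithin ℝ m h {0}ᶜ t).toMultilinearMap.map_sum _).trans ?_
  refine Finset.sum_congr rfl fun J _ => ?_
  exact (iteratedFDerivWithin ℝ m h {0}ᶜ t).toMultilinearMap.map_smul_univ _ _

theorem RegularKernel.exists_dirDeriv_bound {h : EuclideanSpace ℝ (Fin d) → ℝ}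
    (hh : RegularKernel h) {T : ℝ} (hT : 0 < T) {m : ℕ} (hm : m ≤ 3) :
    ∃ C : ℝ, 0 ≤ C ∧ ∀ t u : EuclideanSpace ℝ (Fin d), T ≤ ‖t‖ → (∀ k, |u k| ≤ 2) →
      |dirDeriv h m u t| ≤ C * (1 / (1 + ‖t‖ ^ (d + 1))) := by
  have key : ∀ J : Fin m → Fin d, ∃ C : ℝ, ∀ t, T ≤ ‖t‖ →
      |spacePartial h J t| ≤ C / (1 + ‖t‖ ^ (d + 1)) := by
    intro J
    rcases Nat.eq_zero_or_pos m with rfl | hm0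
    · obtain ⟨C, hC⟩ := hh.bound
      exact ⟨C, fun t _ => by simpa [spacePartial] using hC t⟩
    · exact hh.bound_deriv T hT m (Finset.mem_Icc.2 ⟨hm0, hm⟩) J
  choose C hC using key
  refine ⟨∑ J : Fin m → Fin d, 2 ^ m * |C J|, by positivity, fun t u ht hu => ?_⟩
  rw [dirDeriv_eq_sum, Finset.sum_mul]
  refine (Finset.abs_sum_le_sum_abs _ _).trans (Finset.sum_le_sum fun J _ => ?_)
  rw [abs_mul, mul_assoc, Finset.abs_prod]
  have h1 : ∏ l, |u (J l)| ≤ 2 ^ m :=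
    (Finset.prod_le_prod (fun l _ => abs_nonneg _) fun l _ => hu (J l)).trans (by simp)
  refine mul_le_mul h1 ((hC J t ht).trans ?_) (abs_nonneg _) (by positivity)
  rw [div_eq_mul_one_div]
  gcongr
  exact le_abs_self _

theorem RegularKernel.hasDerivAt_dirDeriv {h : EuclideanSpace ℝ (Fin d) → ℝ}
    (hh : RegularKernel h) {m : ℕ} (hm : m < 3) (w u : EuclideanSpace ℝ (Fin d)) {ε : ℝ}
    (hne : w + ε • u ≠ 0) :
    HasDerivAt (fun ε : ℝ => dirDeriv h m u (w + ε • u)) (dirDeriv h (m + 1) u (w + ε • u)) ε := by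
  have hmem : ({0}ᶜ : Set (EuclideanSpace ℝ (Fin d))) ∈ 𝓝 (w + ε • u) :=
    isOpen_compl_singleton.mem_nhds hne
  have h1 : HasFDerivAt (fun t => iteratedFDerivWithin ℝ m h {0}ᶜ t)
      (fderivWithin ℝ (iteratedFDerivWithin ℝ m h {0}ᶜ) {0}ᶜ (w + ε • u)) (w + ε • u) :=
    ((hh.differentiable m hm _ hne).hasFDerivWithinAt).hasFDerivAt hmem
  have h2 : HasDerivAt (fun ε : ℝ => w + ε • u) u ε := by
    simpa using ((hasDerivAt_id ε).smul_const u).const_add w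
  have h3 := h1.comp_hasDerivAt ε h2
  have h4 := (ContinuousMultilinearMap.apply ℝ (fun _ : Fin m => EuclideanSpace ℝ (Fin d)) ℝ
    fun _ => u).hasFDerivAt.comp_hasDerivAt ε h3
  rw [dirDeriv, iteratedFDerivWithin_succ_apply_left]
  exact h4

/-- The entries of the `m`-th derivative in `ε` of the matrix of a kernel. -/
def Config.jet (c : Config d) (h : EuclideanSpace ℝ (Fin d) → ℝ) (m : ℕ) (ε : ℝ) :
    Matrix c.idx c.idx ℝ :=
  Matrix.of fun a b => if a = b then (if m = 0 then h 0 else 0) else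
    dirDeriv h m (c.pert a - c.pert b)
      (WithLp.toLp 2 (fun k => ((c.site a - c.site b) k : ℝ)) + ε • (c.pert a - c.pert b))

theorem Config.jet_zero (c : Config d) (h : EuclideanSpace ℝ (Fin d) → ℝ) (ε : ℝ) :
    c.jet h 0 ε = c.mat h ε := by
  ext a b
  by_cases hab : a = b
  · simp [Config.jet, Config.mat, kernelMatrix, hab]
  · simp [Config.jet, Config.mat, kernelMatrix, hab, gridPoint_sub, dirDeriv]

theorem Config.norm_sub_pos (c : Config d) {β ε : ℝ} (hβ : β < 1 / 2) (hε : ε ∈ Ico 0 β)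
    {a b : c.idx} (hab : a ≠ b) :
    1 - 2 * β ≤ ‖gridPoint c.site c.pert ε a - gridPoint c.site c.pert ε b‖ := by
  have h1 := one_le_norm_of_ne_zero (sub_ne_zero.2 fun h => hab (c.inj h))
  have h2 := c.norm_sub_ge hε.1 a b
  have h3 := hε.2
  nlinarith

theorem RegularKernel.exists_jet_bound {h : EuclideanSpace ℝ (Fin d) → ℝ}
    (hh : RegularKernel h) {β : ℝ} (hβ : β < 1 / 2) {m : ℕ} (hm : m ≤ 3) :
    ∃ C : ℝ, 0 ≤ C ∧ ∀ c : Config d, ∀ ε ∈ Ico 0 β, ∀ a b,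
      |c.jet h m ε a b| ≤ C * weight (c.site a - c.site b) := by
  have hr : 0 < 1 - 2 * β := by linarith
  obtain ⟨C, hC0, hC⟩ := hh.exists_dirDeriv_bound hr hm
  have hr' : 0 ≤ 1 / (1 - 2 * β) ^ (d + 1) := by positivity
  refine ⟨|h 0| + C * (1 / (1 - 2 * β) ^ (d + 1)), by positivity, fun c ε hε a b => ?_⟩
  by_cases hab : a = b
  · subst hab
    have : |c.jet h m ε a a| ≤ |h 0| := by
      by_cases hm0 : m = 0 <;> simp [Config.jet, hm0]
    refine this.trans ?_
    have hw : weight (c.site a - c.site a) = 1 := by simp [weight]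
    rw [hw, mul_one]
    have := mul_nonneg hC0 hr'
    linarith
  · have h1 : c.jet h m ε a b = dirDeriv h m (c.pert a - c.pert b)
        (gridPoint c.site c.pert ε a - gridPoint c.site c.pert ε b) := by
      rw [gridPoint_sub]; simp [Config.jet, hab]
    rw [h1]
    refine (hC _ _ (c.norm_sub_pos hβ hε hab) fun k => ?_).trans ?_
    · rw [PiLp.sub_apply]
      exact (abs_sub _ _).trans (by linarith [c.pert_le a k, c.pert_le b k])
    · have h2 := mul_le_mul_of_nonneg_left (c.inv_one_add_norm_le hβ hε a b) hC0
      refine h2.trans ?_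
      rw [← mul_assoc]
      have := weight_pos (c.site a - c.site b)
      gcongr
      linarith [abs_nonneg (h 0)]

theorem RegularKernel.famJet {h : EuclideanSpace ℝ (Fin d) → ℝ} (hh : RegularKernel h) {β : ℝ}
    (hβ : β < 1 / 2) : FamJet (Ico 0 β) 3 (fun (c : Config d) ε => c.mat h ε) := by
  have hb : ∀ m ≤ 3, FamBdd (Ico 0 β) (fun (c : Config d) ε => c.jet h m ε) := fun m hm => by
    obtain ⟨C, hC0, hC⟩ := hh.exists_jet_bound hβ hm
    exact ⟨_, fun c ε hε => c.norm_le_of_weight hC0 (hC c ε hε)⟩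
  have hd : ∀ m < 3, ∀ c : Config d, ∀ ε ∈ Ico 0 β,
      HasDerivWithinAt (c.jet h m) (c.jet h (m + 1) ε) (Ico 0 β) ε := fun m hm c ε hε => by
    refine hasDerivWithinAt_pi.2 fun a => hasDerivWithinAt_pi.2 fun b => ?_
    by_cases hab : a = b
    · simpa [Config.jet, hab] using! hasDerivWithinAt_const ε (Ico 0 β) _
    · have hne := c.norm_sub_pos hβ hε hab
      rw [gridPoint_sub] at hne
      have := (hh.hasDerivAt_dirDeriv hm (WithLp.toLp 2 fun k => ((c.site a - c.site b) k : ℝ))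
        (c.pert a - c.pert b) (ε := ε) (norm_pos_iff.1 (by linarith))).hasDerivWithinAt
          (s := Ico 0 β)
      simpa [Config.jet, hab] using! this
  have h0 : (fun (c : Config d) ε => c.mat h ε) = fun c ε => c.jet h 0 ε := by
    funext c ε; exact (c.jet_zero h ε).symm
  rw [h0]
  exact ⟨hb 0 (by norm_num), _, hd 0 (by norm_num), hb 1 (by norm_num), _, hd 1 (by norm_num),
    hb 2 (by norm_num), _, hd 2 (by norm_num), hb 3 le_rfl⟩

end Kernels

section Coercivity

variable {d : ℕ}

theorem integrable_mul_cexp {h : EuclideanSpace ℝ (Fin d) → ℝ} (hint : Integrable h)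
    (t : EuclideanSpace ℝ (Fin d)) :
    Integrable fun f => (h f : ℂ) * Complex.exp (Complex.I * ((inner ℝ f t : ℝ) : ℂ)) := by
  refine hint.ofReal.mul_bdd (c := 1) (Continuous.aestronglyMeasurable (by fun_prop)) ?_
  refine Eventually.of_forall fun f => ?_
  rw [mul_comm, Complex.norm_exp_ofReal_mul_I]

/-- A function with nonnegative integrable Fourier transform is positive semidefinite. -/
theorem sum_mul_nonneg_of_fourier {h H : EuclideanSpace ℝ (Fin d) → ℝ} (hint : Integrable h)
    (h0 : ∀ f, 0 ≤ h f)
    (hH : ∀ t, (H t : ℂ) = ∫ f, (h f : ℂ) * Complex.exp (Complex.I * ((inner ℝ f t : ℝ) : ℂ)))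
    {ι : Type*} [Fintype ι] (p : ι → EuclideanSpace ℝ (Fin d)) (x : ι → ℝ) :
    0 ≤ ∑ a, ∑ b, x a * (H (p a - p b) * x b) := by
  set S : EuclideanSpace ℝ (Fin d) → ℂ := fun f =>
    ∑ a, (x a : ℂ) * Complex.exp (Complex.I * ((inner ℝ f (p a) : ℝ) : ℂ)) with hS
  have hconj : ∀ f, (starRingEnd ℂ) (S f)
      = ∑ a, (x a : ℂ) * Complex.exp (-(Complex.I * ((inner ℝ f (p a) : ℝ) : ℂ))) := fun f => by
    simp only [hS, map_sum, map_mul, Complex.conj_ofReal, ← Complex.exp_conj, Complex.conj_I,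
      neg_mul]
  have hpt : ∀ f, ∑ a, ∑ b, (x a : ℂ) * (((h f : ℂ) *
      Complex.exp (Complex.I * ((inner ℝ f (p a - p b) : ℝ) : ℂ))) * (x b : ℂ))
      = ((h f * Complex.normSq (S f) : ℝ) : ℂ) := fun f => by
    rw [Complex.ofReal_mul, ← Complex.mul_conj, hconj, hS, Finset.sum_mul_sum, Finset.mul_sum]
    refine Finset.sum_congr rfl fun a _ => ?_
    rw [Finset.mul_sum]
    refine Finset.sum_congr rfl fun b _ => ?_
    rw [inner_sub_right, Complex.ofReal_sub, mul_sub, sub_eq_add_neg, Complex.exp_add]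
    ring
  have key : ((∑ a, ∑ b, x a * (H (p a - p b) * x b) : ℝ) : ℂ)
      = ((∫ f, h f * Complex.normSq (S f) : ℝ) : ℂ) := by
    rw [← integral_complex_ofReal]
    simp_rw [← hpt]
    rw [integral_finsetSum _ fun a _ => integrable_finsetSum _ fun b _ =>
      ((integrable_mul_cexp hint _).mul_const _).const_mul _]
    push_cast
    refine Finset.sum_congr rfl fun a _ => ?_
    rw [integral_finsetSum _ fun b _ => ((integrable_mul_cexp hint _).mul_const _).const_mul _]
    refine Finset.sum_congr rfl fun b _ => ?_
    rw [integral_const_mul, integral_mul_const, hH]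
  rw [Complex.ofReal_inj] at key
  rw [key]
  exact integral_nonneg fun f => mul_nonneg (h0 f) (Complex.normSq_nonneg _)

theorem integral_gaussian_mul_cexp {b : ℝ} (hb : 0 < b) (t : EuclideanSpace ℝ (Fin d)) :
    (((Real.pi / b) ^ ((d : ℝ) / 2) * Real.exp (-(‖t‖ ^ 2 / (4 * b))) : ℝ) : ℂ)
      = ∫ f : EuclideanSpace ℝ (Fin d), ((Real.exp (-b * ‖f‖ ^ 2) : ℝ) : ℂ) *
        Complex.exp (Complex.I * ((inner ℝ f t : ℝ) : ℂ)) := by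
  have h := GaussianFourier.integral_cexp_neg_mul_sq_norm_add (V := EuclideanSpace ℝ (Fin d))
    (b := (b : ℂ)) (by simpa using hb) Complex.I t
  have h1 : ∀ f : EuclideanSpace ℝ (Fin d), ((Real.exp (-b * ‖f‖ ^ 2) : ℝ) : ℂ) *
        Complex.exp (Complex.I * ((inner ℝ f t : ℝ) : ℂ))
      = Complex.exp (-(b : ℂ) * (‖f‖ : ℂ) ^ 2 + Complex.I * ((inner ℝ t f : ℝ) : ℂ)) := fun f => by
    rw [Complex.exp_add, real_inner_comm]
    push_cast
    rfl
  simp_rw [h1]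
  rw [h, Complex.ofReal_mul, Complex.ofReal_cpow (by positivity)]
  simp only [finrank_euclideanSpace, Fintype.card_fin, Complex.I_sq]
  push_cast
  congr 2
  ring

theorem integrable_gaussian {b : ℝ} (hb : 0 < b) :
    Integrable fun f : EuclideanSpace ℝ (Fin d) => Real.exp (-b * ‖f‖ ^ 2) := by
  have h := (GaussianFourier.integrable_cexp_neg_mul_sq_norm_add
    (V := EuclideanSpace ℝ (Fin d)) (b := (b : ℂ)) (by simpa using hb) 0 0).re
  refine h.congr (Eventually.of_forall fun f => ?_)
  simp only [zero_mul, add_zero]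
  have : (-(b : ℂ) * (‖f‖ : ℂ) ^ 2) = ((-b * ‖f‖ ^ 2 : ℝ) : ℂ) := by push_cast; rfl
  rw [this, ← Complex.ofReal_exp]
  exact Complex.ofReal_re _

/-- Gaussian row sums of separated configurations become small for small variance. -/
theorem exists_gaussian_rowSum_le {β : ℝ} (hβ : β < 1 / 2) {η : ℝ} (hη : 0 < η) :
    ∃ b : ℝ, 0 < b ∧ ∃ C : ℝ, 0 ≤ C ∧ C * ∑' y : Fin d → ℤ, weight y ≤ η ∧
      ∀ c : Config d, ∀ ε ∈ Ico 0 β, ∀ a a', a ≠ a' →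
        Real.exp (-(‖gridPoint c.site c.pert ε a - gridPoint c.site c.pert ε a'‖ ^ 2 / (8 * b)))
          ≤ C * weight (c.site a - c.site a') := by
  set W := ∑' y : Fin d → ℤ, weight y with hW
  have hW0 : 0 ≤ W := tsum_nonneg fun y => (weight_pos y).le
  set r := 1 - 2 * β with hr
  have hr0 : 0 < r := by linarith
  set s := min 1 (η / (2 * (d + 1).factorial * (W + 1))) with hs
  have hs0 : 0 < s := lt_min one_pos (by positivity)
  refine ⟨s * r ^ 2 / 8, by positivity, 2 * (d + 1).factorial * s, by positivity, ?_, ?_⟩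
  · have h1 : s ≤ η / (2 * (d + 1).factorial * (W + 1)) := min_le_right _ _
    rw [le_div_iff₀ (by positivity)] at h1
    have h2 : (0 : ℝ) ≤ 2 * (d + 1).factorial * s := by positivity
    nlinarith
  · intro c ε hε a a' hne
    set t := ‖gridPoint c.site c.pert ε a - gridPoint c.site c.pert ε a'‖
    set n := ‖c.site a - c.site a'‖ with hn
    have hn1 : 1 ≤ n := one_le_norm_of_ne_zero (sub_ne_zero.2 fun h => hne (c.inj h))
    have ht : r * n ≤ t := by
      refine le_trans ?_ (c.norm_sub_ge hε.1 a a')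
      gcongr
      linarith [hε.2]
    set y := t ^ 2 / (8 * (s * r ^ 2 / 8)) with hy
    have hy1 : n / s ≤ y := by
      rw [hy, div_le_div_iff₀ hs0 (by positivity)]
      have : (r * n) ^ 2 ≤ t ^ 2 := by gcongr
      have h3 : n ≤ n ^ 2 := by nlinarith
      calc n * (8 * (s * r ^ 2 / 8)) = (r ^ 2 * n) * s := by ring
        _ ≤ (r ^ 2 * n ^ 2) * s := by gcongr
        _ = (r * n) ^ 2 * s := by ring
        _ ≤ t ^ 2 * s := by gcongr
    have hns : 0 ≤ n / s := by positivity
    have h4 := Real.pow_div_factorial_le_exp (n / s) hns (d + 1)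
    have h5 : Real.exp (n / s) ≤ Real.exp y := Real.exp_le_exp.2 hy1
    have h6 : (n / s) ^ (d + 1) / (d + 1).factorial ≤ Real.exp y := h4.trans h5
    rw [Real.exp_neg, weight, ← hn]
    have h7 : (0 : ℝ) < (d + 1).factorial := by positivity
    have h8 : (1 + n ^ (d + 1)) / (2 * (d + 1).factorial * s) ≤
        (n / s) ^ (d + 1) / (d + 1).factorial := by
      rw [div_pow, div_div, div_le_div_iff₀ (by positivity) (by positivity)]
      have h9 : 1 ≤ n ^ (d + 1) := one_le_pow₀ hn1
      have h10 : s ^ (d + 1) ≤ s := by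
        calc s ^ (d + 1) ≤ s ^ 1 := pow_le_pow_of_le_one hs0.le (min_le_left _ _) (by omega)
          _ = s := pow_one s
      calc (1 + n ^ (d + 1)) * (s ^ (d + 1) * (d + 1).factorial)
          ≤ (n ^ (d + 1) + n ^ (d + 1)) * (s * (d + 1).factorial) := by gcongr
        _ = _ := by ring
    calc (Real.exp y)⁻¹ ≤ ((1 + n ^ (d + 1)) / (2 * (d + 1).factorial * s))⁻¹ :=
          inv_anti₀ (by positivity) (h8.trans h6)
      _ = _ := by rw [inv_div, div_eq_mul_one_div]

theorem exists_coercive_of_fourier {k κ : EuclideanSpace ℝ (Fin d) → ℝ} (hcont : Continuous κ)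
    (hpos : ∀ f, 0 < κ f) (hint : Integrable κ)
    (hk : ∀ t, (k t : ℂ) = ∫ f, (κ f : ℂ) * Complex.exp (Complex.I * ((inner ℝ f t : ℝ) : ℂ)))
    {β : ℝ} (hβ : β < 1 / 2) :
    ∃ c : ℝ, 0 < c ∧ ∀ σ : Config d, ∀ ε ∈ Ico 0 β, Coercive c (σ.mat k ε) := by
  obtain ⟨b, hb, C, hC0, hCW, hC⟩ := exists_gaussian_rowSum_le (d := d) hβ (η := 1 / 6) (by norm_num)
  set A : ℝ := (Real.pi / (2 * b)) ^ ((d : ℝ) / 2) with hA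
  set A' : ℝ := (Real.pi / b) ^ ((d : ℝ) / 2) with hA'
  have hA0 : 0 < A := by positivity
  have hA'0 : 0 < A' := by positivity
  set η : ℝ := A / (2 * A') with hη
  have hη0 : 0 < η := by positivity
  have hηA : η * A' = A / 2 := by rw [hη]; field_simp
  set g : EuclideanSpace ℝ (Fin d) → ℝ := fun f =>
    Real.exp (-(2 * b) * ‖f‖ ^ 2) - η * Real.exp (-b * ‖f‖ ^ 2) with hg
  set q : EuclideanSpace ℝ (Fin d) → ℝ := fun t =>
    A * Real.exp (-(‖t‖ ^ 2 / (4 * (2 * b)))) - η * (A' * Real.exp (-(‖t‖ ^ 2 / (4 * b)))) with hq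
  have hgint : Integrable g :=
    (integrable_gaussian (by positivity)).sub ((integrable_gaussian hb).const_mul η)
  have hqg : ∀ t, (q t : ℂ) = ∫ f, (g f : ℂ) * Complex.exp (Complex.I * ((inner ℝ f t : ℝ) : ℂ)) := by
    intro t
    have e1 := integral_gaussian_mul_cexp (d := d) (b := 2 * b) (by positivity) t
    have e2 := integral_gaussian_mul_cexp (d := d) hb t
    have : ∀ f, (g f : ℂ) * Complex.exp (Complex.I * ((inner ℝ f t : ℝ) : ℂ))
        = ((Real.exp (-(2 * b) * ‖f‖ ^ 2) : ℝ) : ℂ) * Complex.exp (Complex.I * ((inner ℝ f t : ℝ) : ℂ))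
          - (η : ℂ) * (((Real.exp (-b * ‖f‖ ^ 2) : ℝ) : ℂ) *
            Complex.exp (Complex.I * ((inner ℝ f t : ℝ) : ℂ))) := fun f => by
      rw [hg, Complex.ofReal_sub, Complex.ofReal_mul]; ring
    simp_rw [this]
    rw [integral_sub (integrable_mul_cexp (integrable_gaussian (by positivity)) t)
      ((integrable_mul_cexp (integrable_gaussian hb) t).const_mul _), integral_const_mul, ← e1, ← e2,
      hq, Complex.ofReal_sub, Complex.ofReal_mul η]
  -- `κ` dominates a multiple of `g`
  obtain ⟨γ, hγ0, hγ⟩ : ∃ γ : ℝ, 0 < γ ∧ ∀ f, γ * g f ≤ κ f := by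
    set ρ := Real.sqrt (|Real.log η| / b) with hρ
    obtain ⟨f₀, -, hf₀⟩ := (isCompact_closedBall (0 : EuclideanSpace ℝ (Fin d)) ρ).exists_isMinOn
      ⟨0, Metric.mem_closedBall_self (Real.sqrt_nonneg _)⟩ hcont.continuousOn
    refine ⟨κ f₀, hpos f₀, fun f => ?_⟩
    have hsq : Real.exp (-(2 * b) * ‖f‖ ^ 2) = Real.exp (-b * ‖f‖ ^ 2) * Real.exp (-b * ‖f‖ ^ 2) := by
      rw [← Real.exp_add]; congr 1; ring
    have hle1 : Real.exp (-b * ‖f‖ ^ 2) ≤ 1 := Real.exp_le_one_iff.2 (by nlinarith [sq_nonneg ‖f‖])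
    have hp := Real.exp_pos (-b * ‖f‖ ^ 2)
    by_cases hf : f ∈ Metric.closedBall (0 : EuclideanSpace ℝ (Fin d)) ρ
    · have h1 : κ f₀ ≤ κ f := hf₀ hf
      have h2 : g f ≤ 1 := by rw [hg]; simp only; rw [hsq]; nlinarith
      nlinarith [hpos f₀]
    · have h1 : ρ < ‖f‖ := by simpa using hf
      have h2 : |Real.log η| ≤ b * ‖f‖ ^ 2 := by
        have := Real.lt_sq_of_sqrt_lt h1
        rw [div_lt_iff₀ hb] at this
        linarith
      have h3 : Real.exp (-b * ‖f‖ ^ 2) ≤ η := by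
        rw [← Real.exp_log hη0]
        refine Real.exp_le_exp.2 ?_
        linarith [neg_abs_le (Real.log η)]
      have h4 : g f ≤ 0 := by rw [hg]; simp only; rw [hsq]; nlinarith
      nlinarith [hpos f₀, hpos f]
  refine ⟨γ * (A / 4), by positivity, fun σ ε hε x => ?_⟩
  have hnn := sum_mul_nonneg_of_fourier (h := fun f => κ f - γ * g f) (H := fun t => k t - γ * q t)
    (hint.sub (hgint.const_mul γ)) (fun f => sub_nonneg.2 (hγ f)) (fun t => by
      have : ∀ f, ((κ f - γ * g f : ℝ) : ℂ) * Complex.exp (Complex.I * ((inner ℝ f t : ℝ) : ℂ))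
          = (κ f : ℂ) * Complex.exp (Complex.I * ((inner ℝ f t : ℝ) : ℂ))
            - (γ : ℂ) * ((g f : ℂ) * Complex.exp (Complex.I * ((inner ℝ f t : ℝ) : ℂ))) := fun f => by
        push_cast; ring
      simp_rw [this]
      rw [integral_sub (integrable_mul_cexp hint t) ((integrable_mul_cexp hgint t).const_mul _),
        integral_const_mul, ← hk, ← hqg]
      push_cast; ring) (gridPoint σ.site σ.pert ε) x
  have hsplit : x ⬝ᵥ (σ.mat k ε *ᵥ x) - γ * (x ⬝ᵥ (σ.mat q ε *ᵥ x))
      = ∑ a, ∑ b, x a * ((k (gridPoint σ.site σ.pert ε a - gridPoint σ.site σ.pert ε b)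
        - γ * q (gridPoint σ.site σ.pert ε a - gridPoint σ.site σ.pert ε b)) * x b) := by
    simp only [dotProduct, Matrix.mulVec, Finset.mul_sum, ← Finset.sum_sub_distrib, Config.mat,
      kernelMatrix, Matrix.of_apply]
    refine Finset.sum_congr rfl fun a _ => Finset.sum_congr rfl fun b _ => by ring
  -- diagonal dominance of the matrix of `q`
  set B : Matrix σ.idx σ.idx ℝ := σ.mat q ε - (A / 2) • (1 : Matrix σ.idx σ.idx ℝ) with hB
  have hBn : ‖B‖ ≤ A / 4 := by
    have h1 : ‖B‖ ≤ (3 / 2 * A * C) * ∑' y : Fin d → ℤ, weight y := by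
      refine σ.norm_le_of_weight (by positivity) fun a a' => ?_
      by_cases haa : a = a'
      · subst haa
        have : B a a = 0 := by
          simp only [hB, Config.mat, kernelMatrix, hq, Matrix.sub_apply, Matrix.of_apply, sub_self,
            norm_zero, Matrix.smul_apply, Matrix.one_apply_eq]
          simp
          linarith
        rw [this, abs_zero]
        have := weight_pos (σ.site a - σ.site a)
        positivity
      · have h2 := hC σ ε hε a a' haa
        simp only [hB, Config.mat, kernelMatrix, hq, Matrix.sub_apply, Matrix.of_apply,
            Matrix.smul_apply, Matrix.one_apply_ne haa, smul_zero, sub_zero]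
        set t := ‖gridPoint σ.site σ.pert ε a - gridPoint σ.site σ.pert ε a'‖
        rw [← mul_assoc η, hηA, show 4 * (2 * b) = 8 * b by ring]
        have h3 : Real.exp (-(t ^ 2 / (4 * b))) ≤ Real.exp (-(t ^ 2 / (8 * b))) := by
          refine Real.exp_le_exp.2 (neg_le_neg ?_)
          gcongr
          norm_num
        have h4 := Real.exp_pos (-(t ^ 2 / (4 * b)))
        rw [abs_le]
        constructor <;> nlinarith
    refine h1.trans ?_
    nlinarith
  have hBx := dotProduct_mulVec_le_norm B x x
  have hqx : x ⬝ᵥ (σ.mat q ε *ᵥ x) = A / 2 * (x ⬝ᵥ x) + x ⬝ᵥ (B *ᵥ x) := by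
    rw [hB, Matrix.sub_mulVec, dotProduct_sub, Matrix.smul_mulVec, Matrix.one_mulVec,
      dotProduct_smul, smul_eq_mul]
    ring
  rw [mul_assoc, ← pow_two, norm_toLp_sq] at hBx
  have hxx : 0 ≤ x ⬝ᵥ x := by rw [← norm_toLp_sq]; positivity
  have h5 : A / 4 * (x ⬝ᵥ x) ≤ x ⬝ᵥ (σ.mat q ε *ᵥ x) := by
    rw [hqx]
    have := neg_abs_le (x ⬝ᵥ (B *ᵥ x))
    nlinarith
  rw [← hsplit] at hnn
  nlinarith

theorem CovarianceCondition.exists_coercive {p : ℕ} {Θ : Set (Fin p → ℝ)}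
    {K : (Fin p → ℝ) → EuclideanSpace ℝ (Fin d) → ℝ} (hK : CovarianceCondition Θ K)
    {θ : Fin p → ℝ} (hθ : θ ∈ Θ) {β : ℝ} (hβ : β < 1 / 2) :
    ∃ c : ℝ, 0 < c ∧ ∀ σ : Config d, ∀ ε ∈ Ico 0 β, Coercive c (σ.mat (K θ) ε) := by
  have hre : ∀ f, ((fourierHat (K θ) f).re : ℂ) = fourierHat (K θ) f := fun f =>
    Complex.ext rfl (hK.fourier_real θ hθ f).symm
  have hc : Continuous fun f => fourierHat (K θ) f :=
    hK.fourier_continuous.comp_continuous (f := fun f => (f, θ)) (by fun_prop)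
      fun f => ⟨trivial, hθ⟩
  refine exists_coercive_of_fourier (κ := fun f => (fourierHat (K θ) f).re)
    (Complex.continuous_re.comp hc) (hK.fourier_pos θ hθ) (hK.fourier_integrable θ hθ).re
    (fun t => ?_) hβ
  simp_rw [hre]
  exact hK.fourier_inversion θ hθ t

end Coercivity

/-- The matrix `A` with the entries between indices of different labels set to zero. -/
def mask {ι J : Type*} [DecidableEq J] (l : ι → J) (A : Matrix ι ι ℝ) : Matrix ι ι ℝ :=
  Matrix.of fun a b => if l a = l b then A a b else 0

theorem mask_submatrix_sigma {ι J : Type*} [DecidableEq J] (l : ι → J) (A : Matrix ι ι ℝ) :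
    (mask l A).submatrix (Equiv.sigmaFiberEquiv l) (Equiv.sigmaFiberEquiv l)
      = Matrix.blockDiagonal' fun j => A.submatrix (Subtype.val : {a // l a = j} → ι) Subtype.val := by
  ext ⟨i, a, ha⟩ ⟨j, b, hb⟩
  by_cases h : i = j
  · subst h
    rw [Matrix.blockDiagonal'_apply_eq]
    simp [mask, Equiv.sigmaFiberEquiv, ha, hb]
  · rw [Matrix.blockDiagonal'_apply_ne _ _ _ h]
    simp [mask, Equiv.sigmaFiberEquiv, ha, hb, h]

section Blocks

variable {ι κ : Type*} [DecidableEq ι] [DecidableEq κ]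

theorem diagPart_submatrix (A : Matrix ι ι ℝ) (f : κ ≃ ι) :
    diagPart (A.submatrix f f) = (diagPart A).submatrix f f := by
  rw [diagPart, diagPart, Matrix.submatrix_diagonal_equiv]
  rfl

variable [Fintype ι] [Fintype κ]

theorem MatExpr.eval_submatrix (e : MatExpr) (R D D' : Matrix ι ι ℝ) (f : κ ≃ ι) :
    e.eval (R.submatrix f f) (D.submatrix f f) (D'.submatrix f f)
      = (e.eval R D D').submatrix f f := by
  induction e with
  | base => rfl
  | fst => rfl
  | snd => rfl
  | baseInv => exact Matrix.inv_submatrix_equiv R f f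
  | diagInv =>
    simp only [MatExpr.eval, Matrix.inv_submatrix_equiv, diagPart_submatrix]
  | add e f he hf => simp only [MatExpr.eval, he, hf]; rfl
  | smul c e he => simp only [MatExpr.eval, he]; rfl
  | mul e f he hf => simp only [MatExpr.eval, he, hf, Matrix.submatrix_mul_equiv]
  | diag e he => simp only [MatExpr.eval, he, diagPart_submatrix]
  | transpose e he => simp only [MatExpr.eval, he]; rfl

theorem MatExpr.trace_eval_submatrix (e : MatExpr) (R D D' : Matrix ι ι ℝ) (f : κ ≃ ι) :
    (e.eval (R.submatrix f f) (D.submatrix f f) (D'.submatrix f f)).trace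
      = (e.eval R D D').trace := by
  rw [e.eval_submatrix]
  exact f.sum_comp fun a => e.eval R D D' a a

variable {J : Type*} [DecidableEq J] {m : J → Type*} [∀ j, DecidableEq (m j)]

theorem diagPart_blockDiagonal' (A : ∀ j, Matrix (m j) (m j) ℝ) :
    diagPart (Matrix.blockDiagonal' A) = Matrix.blockDiagonal' fun j => diagPart (A j) := by
  simp only [diagPart, Matrix.blockDiagonal'_diagonal]
  congr 1
  funext a
  exact Matrix.blockDiagonal'_apply_eq A a.1 a.2 a.2

variable [Fintype J] [∀ j, Fintype (m j)]

theorem inv_blockDiagonal' {A : ∀ j, Matrix (m j) (m j) ℝ} (hA : ∀ j, IsUnit (A j).det) :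
    (Matrix.blockDiagonal' A)⁻¹ = Matrix.blockDiagonal' fun j => (A j)⁻¹ := by
  refine Matrix.inv_eq_right_inv ?_
  rw [← Matrix.blockDiagonal'_mul, ← Matrix.blockDiagonal'_one]
  congr 1
  funext j
  exact Matrix.mul_nonsing_inv _ (hA j)

theorem MatExpr.eval_blockDiagonal' (e : MatExpr) {R : ∀ j, Matrix (m j) (m j) ℝ}
    (D D' : ∀ j, Matrix (m j) (m j) ℝ) {c : ℝ} (hc : 0 < c) (hR : ∀ j, Coercive c (R j)) :
    e.eval (Matrix.blockDiagonal' R) (Matrix.blockDiagonal' D) (Matrix.blockDiagonal' D')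
      = Matrix.blockDiagonal' fun j => e.eval (R j) (D j) (D' j) := by
  have hinv : (Matrix.blockDiagonal' R)⁻¹ = Matrix.blockDiagonal' fun j => (R j)⁻¹ :=
    inv_blockDiagonal' fun j => (hR j).isUnit_det hc
  induction e with
  | base => rfl
  | fst => rfl
  | snd => rfl
  | baseInv => exact hinv
  | diagInv =>
    simp only [MatExpr.eval]
    rw [hinv, diagPart_blockDiagonal', inv_blockDiagonal' fun j => ?_]
    exact ((hR j).diagPart_inv hc (le_max_left _ 1) (lt_of_lt_of_le one_pos (le_max_right _ _))).1
  | add e f he hf => simp only [MatExpr.eval, he, hf]; exact (Matrix.blockDiagonal'_add _ _).symm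
  | smul c e he => simp only [MatExpr.eval, he]; exact (Matrix.blockDiagonal'_smul c _).symm
  | mul e f he hf => simp only [MatExpr.eval, he, hf]; exact (Matrix.blockDiagonal'_mul _ _).symm
  | diag e he => simp only [MatExpr.eval, he, diagPart_blockDiagonal']
  | transpose e he => simp only [MatExpr.eval, he]; exact Matrix.blockDiagonal'_transpose _

theorem MatExpr.trace_eval_mask (e : MatExpr) (l : ι → J) (R D D' : Matrix ι ι ℝ) {c : ℝ}
    (hc : 0 < c)
    (hR : ∀ j, Coercive c (R.submatrix (Subtype.val : {a // l a = j} → ι) Subtype.val)) :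
    (e.eval (mask l R) (mask l D) (mask l D')).trace
      = ∑ j, (e.eval (R.submatrix (Subtype.val : {a // l a = j} → ι) Subtype.val)
        (D.submatrix Subtype.val Subtype.val) (D'.submatrix Subtype.val Subtype.val)).trace := by
  rw [← e.trace_eval_submatrix _ _ _ (Equiv.sigmaFiberEquiv l), mask_submatrix_sigma,
    mask_submatrix_sigma, mask_submatrix_sigma, e.eval_blockDiagonal' _ _ hc hR,
    Matrix.trace_blockDiagonal']

end Blocks

section MaskCoercive

variable {ι J : Type*} [Fintype ι] [Fintype J] [DecidableEq J]

theorem Coercive.mask {c : ℝ} {R : Matrix ι ι ℝ} (hR : Coercive c R) (l : ι → J) :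
    Coercive c (mask l R) := by
  intro x
  have h1 : x ⬝ᵥ x = ∑ j, (fun a => if l a = j then x a else 0) ⬝ᵥ
      (fun a => if l a = j then x a else 0) := by
    simp only [dotProduct]
    rw [Finset.sum_comm]
    refine Finset.sum_congr rfl fun a _ => ?_
    simp
  have h2 : x ⬝ᵥ (PerturbedGrid.mask l R *ᵥ x) = ∑ j, (fun a => if l a = j then x a else 0) ⬝ᵥ
      (R *ᵥ (fun a => if l a = j then x a else 0)) := by
    simp only [dotProduct, Matrix.mulVec, Finset.mul_sum]
    rw [Finset.sum_comm]
    conv_rhs => rw [Finset.sum_comm]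
    rw [Finset.sum_comm]
    refine Finset.sum_congr rfl fun a _ => ?_
    rw [Finset.sum_comm]
    refine Finset.sum_congr rfl fun b _ => ?_
    by_cases h : l a = l b
    · simp [PerturbedGrid.mask, h]
    · simp [PerturbedGrid.mask, h]
  rw [h1, h2, Finset.mul_sum]
  exact Finset.sum_le_sum fun j _ => hR _

end MaskCoercive

section BlockApproximation

variable {d : ℕ}

/-- Three regular kernels, the first of which has uniformly coercive matrices. -/
structure AdmissibleKernels (k k₁ k₂ : EuclideanSpace ℝ (Fin d) → ℝ) : Prop where
  regular : RegularKernel k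
  regular₁ : RegularKernel k₁
  regular₂ : RegularKernel k₂
  coercive : ∀ β < (1 / 2 : ℝ), ∃ c : ℝ, 0 < c ∧ ∀ σ : Config d, ∀ ε ∈ Ico 0 β,
    Coercive c (σ.mat k ε)

/-- The trace of a matrix expression in the matrices of three kernels. -/
def exprTrace (e : MatExpr) (k k₁ k₂ : EuclideanSpace ℝ (Fin d) → ℝ) {ι : Type*} [Fintype ι]
    [DecidableEq ι] (z : ι → Fin d → ℤ) (x : ι → EuclideanSpace ℝ (Fin d)) (ε : ℝ) : ℝ :=
  (e.eval (kernelMatrix k z x ε) (kernelMatrix k₁ z x ε) (kernelMatrix k₂ z x ε)).trace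

/-- The trace of a matrix expression for a configuration. -/
def Config.trace (c : Config d) (e : MatExpr) (k k₁ k₂ : EuclideanSpace ℝ (Fin d) → ℝ) (ε : ℝ) :
    ℝ :=
  exprTrace e k k₁ k₂ c.site c.pert ε

/-- The configuration obtained by an injective change of the indices. -/
def Config.comp (c : Config d) {κ : Type} [Fintype κ] [DecidableEq κ] (f : κ → c.idx)
    (hf : Function.Injective f) : Config d where
  idx := κ
  site := c.site ∘ f
  inj := c.inj.comp hf
  pert := c.pert ∘ f
  pert_le a := c.pert_le (f a)

/-- The total weight of the pairs of points with different labels. -/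
def Config.crossWeight (c : Config d) {J : Type*} [DecidableEq J] (l : c.idx → J) : ℝ :=
  ∑ a, ∑ b, if l a = l b then 0 else weight (c.site a - c.site b)

theorem Config.crossWeight_nonneg (c : Config d) {J : Type*} [DecidableEq J] (l : c.idx → J) :
    0 ≤ c.crossWeight l :=
  Finset.sum_nonneg fun a _ => Finset.sum_nonneg fun b _ => by
    split_ifs
    · exact le_rfl
    · exact (weight_pos _).le

variable {k k₁ k₂ : EuclideanSpace ℝ (Fin d) → ℝ}

theorem AdmissibleKernels.famJet_eval (h : AdmissibleKernels k k₁ k₂) (e : MatExpr) {β : ℝ}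
    (hβ : β < 1 / 2) :
    FamJet (Ico 0 β) 3 (fun (c : Config d) ε => e.eval (c.mat k ε) (c.mat k₁ ε) (c.mat k₂ ε)) := by
  obtain ⟨c, hc, hcoer⟩ := h.coercive β hβ
  exact (matClass_famJet (Ico 0 β) 3).eval (h.regular.famJet hβ) (h.regular₁.famJet hβ)
    (h.regular₂.famJet hβ) (h.regular.famJet hβ).bdd hc hcoer e

theorem AdmissibleKernels.famJet_trace (h : AdmissibleKernels k k₁ k₂) (e : MatExpr) {β : ℝ}
    (hβ : β < 1 / 2) : FamJet (Ico 0 β) 3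
      (fun (c : Config d) ε => 1 / (Fintype.card c.idx : ℝ) * c.trace e k k₁ k₂ ε) := by
  refine (h.famJet_eval e hβ).map (E' := fun _ => ℝ) (c := 1)
    (fun c => (1 / (Fintype.card c.idx : ℝ)) • Matrix.traceLinearMap c.idx ℝ ℝ) fun c A => ?_
  change ‖1 / (Fintype.card c.idx : ℝ) * A.trace‖ ≤ _
  rw [Real.norm_eq_abs, abs_mul, abs_of_nonneg (by positivity), one_mul]
  have h1 := abs_trace_le A
  rcases Nat.eq_zero_or_pos (Fintype.card c.idx) with hn | hn
  · rw [hn]; simp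
  · have hn' : (0 : ℝ) < Fintype.card c.idx := by exact_mod_cast hn
    rw [one_div, inv_mul_le_iff₀ hn']
    exact h1

theorem AdmissibleKernels.exists_abs_trace_le (h : AdmissibleKernels k k₁ k₂) (e : MatExpr) {ε : ℝ}
    (hε : ε ∈ Ico (0 : ℝ) (1 / 2)) :
    ∃ C : ℝ, 0 ≤ C ∧ ∀ c : Config d, |c.trace e k k₁ k₂ ε| ≤ C * Fintype.card c.idx := by
  obtain ⟨β, hεβ, hβ⟩ := exists_between hε.2
  obtain ⟨C, hC⟩ := (h.famJet_eval e hβ).bdd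
  refine ⟨max C 0, le_max_right _ _, fun c => (abs_trace_le _).trans ?_⟩
  rw [mul_comm]
  gcongr
  exact (hC c ε ⟨hε.1, hεβ⟩).trans (le_max_left _ _)

theorem RegularKernel.famClose {h : EuclideanSpace ℝ (Fin d) → ℝ} (hh : RegularKernel h) {β ε : ℝ}
    (hβ : β < 1 / 2) (hε : ε ∈ Ico 0 β) :
    FamClose (T := Σ (c : Config d) (J : ℕ), c.idx → Fin J) (ι := fun τ => τ.1.idx)
      (fun τ => τ.1.crossWeight τ.2.2)
      (fun τ s => if s then τ.1.mat h ε else mask τ.2.2 (τ.1.mat h ε)) := by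
  obtain ⟨C, hC0, hC⟩ := hh.exists_jet_bound hβ (m := 0) (by norm_num)
  simp only [Config.jet_zero] at hC
  refine ⟨⟨C * ∑' y : Fin d → ℤ, weight y, fun τ s _ => ?_⟩, C, fun τ Z => ?_⟩
  · refine τ.1.norm_le_of_weight hC0 fun a b => ?_
    cases s
    · have := weight_pos (τ.1.site a - τ.1.site b)
      by_cases hl : τ.2.2 a = τ.2.2 b
      · simpa [mask, hl] using hC τ.1 ε hε a b
      · simp [mask, hl]; positivity
    · simpa using hC τ.1 ε hε a b
  · have h1 : ((τ.1.mat h ε - mask τ.2.2 (τ.1.mat h ε)) * Z).trace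
        = ∑ a, ∑ b, (if τ.2.2 a = τ.2.2 b then 0 else τ.1.mat h ε a b) * Z b a := by
      simp only [Matrix.trace, Matrix.diag_apply, Matrix.mul_apply, Matrix.sub_apply, mask,
        Matrix.of_apply]
      refine Finset.sum_congr rfl fun a _ => Finset.sum_congr rfl fun b _ => ?_
      split_ifs <;> simp
    simp only [if_true, Bool.false_eq_true, if_false]
    rw [h1, Config.crossWeight, Finset.mul_sum, Finset.sum_mul]
    refine (Finset.abs_sum_le_sum_abs _ _).trans (Finset.sum_le_sum fun a _ => ?_)
    rw [Finset.mul_sum, Finset.sum_mul]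
    refine (Finset.abs_sum_le_sum_abs _ _).trans (Finset.sum_le_sum fun b _ => ?_)
    rw [abs_mul]
    split_ifs
    · simp
    · exact mul_le_mul (hC τ.1 ε hε a b) (abs_apply_le_opNorm Z b a) (abs_nonneg _)
        (mul_nonneg hC0 (weight_pos _).le)

theorem Config.trace_comp_val (c : Config d) (e : MatExpr) (ε : ℝ) {J : Type*} [DecidableEq J]
    (l : c.idx → J) (j : J) :
    (c.comp (Subtype.val : {a // l a = j} → c.idx) Subtype.val_injective).trace e k k₁ k₂ ε
      = (e.eval ((c.mat k ε).submatrix (Subtype.val : {a // l a = j} → c.idx) Subtype.val)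
        ((c.mat k₁ ε).submatrix Subtype.val Subtype.val)
        ((c.mat k₂ ε).submatrix Subtype.val Subtype.val)).trace := rfl

theorem AdmissibleKernels.famClose_eval (h : AdmissibleKernels k k₁ k₂) (e : MatExpr)
    {β ε : ℝ} (hβ : β < 1 / 2) (hε : ε ∈ Ico 0 β) :
    FamClose (T := Σ (c : Config d) (J : ℕ), c.idx → Fin J) (ι := fun τ => τ.1.idx)
      (fun τ => τ.1.crossWeight τ.2.2)
      (fun τ s => e.eval (if s then τ.1.mat k ε else mask τ.2.2 (τ.1.mat k ε))
        (if s then τ.1.mat k₁ ε else mask τ.2.2 (τ.1.mat k₁ ε))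
        (if s then τ.1.mat k₂ ε else mask τ.2.2 (τ.1.mat k₂ ε))) := by
  obtain ⟨r, hr, hcoer⟩ := h.coercive β hβ
  have hc := matClass_famClose (T := Σ (c : Config d) (J : ℕ), c.idx → Fin J)
    (ι := fun τ => τ.1.idx) (δ := fun τ => τ.1.crossWeight τ.2.2)
    (fun τ => τ.1.crossWeight_nonneg _)
  have hk := h.regular.famClose hβ hε
  refine hc.eval hk (h.regular₁.famClose hβ hε) (h.regular₂.famClose hβ hε) hk.1 hr
    (fun τ s _ => ?_) e
  cases s
  · exact (hcoer τ.1 ε hε).mask _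
  · exact hcoer τ.1 ε hε

/-- Cutting a configuration into blocks changes the trace at most by a multiple of the weight of
the pairs of points in different blocks. -/
theorem AdmissibleKernels.exists_trace_sub_blocks_le (h : AdmissibleKernels k k₁ k₂) (e : MatExpr)
    {ε : ℝ} (hε : ε ∈ Ico (0 : ℝ) (1 / 2)) :
    ∃ C : ℝ, 0 ≤ C ∧ ∀ (c : Config d) (J : ℕ) (l : c.idx → Fin J),
      |c.trace e k k₁ k₂ ε - ∑ j, (c.comp (Subtype.val : {a // l a = j} → c.idx)
        Subtype.val_injective).trace e k k₁ k₂ ε| ≤ C * c.crossWeight l := by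
  obtain ⟨β, hεβ, hβ⟩ := exists_between hε.2
  have hε' : ε ∈ Ico 0 β := ⟨hε.1, hεβ⟩
  obtain ⟨r, hr, hcoer⟩ := h.coercive β hβ
  obtain ⟨-, C, hC⟩ := h.famClose_eval e hβ hε'
  refine ⟨|C|, abs_nonneg C, fun c J l => ?_⟩
  have h1 := hC ⟨c, J, l⟩ 1
  simp only [if_true, Bool.false_eq_true, if_false, mul_one, Matrix.trace_sub] at h1
  have h2 := e.trace_eval_mask l (c.mat k ε) (c.mat k₁ ε) (c.mat k₂ ε) hr
    fun j => hcoer (c.comp (Subtype.val : {a // l a = j} → c.idx) Subtype.val_injective) ε hε'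
  rw [h2] at h1
  simp only [Config.trace_comp_val]
  refine (show _ ≤ _ from h1).trans ?_
  have h3 := c.crossWeight_nonneg l
  calc C * c.crossWeight l * ‖(1 : Matrix c.idx c.idx ℝ)‖ ≤ |C| * c.crossWeight l * 1 := by
        gcongr
        · exact le_abs_self C
        · exact norm_one_le
    _ = _ := mul_one _

end BlockApproximation

section Cubes

variable {d : ℕ}

/-- The proportion of the `i < N` such that `i - m` is in `[0, N)`. -/
def overlap (N : ℕ) (m : ℤ) : ℝ :=
  ((Finset.univ.filter fun i : Fin N => 0 ≤ (i : ℤ) - m ∧ (i : ℤ) - m < N).card : ℝ) / N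

theorem overlap_nonneg (N : ℕ) (m : ℤ) : 0 ≤ overlap N m := by unfold overlap; positivity

theorem overlap_le_one (N : ℕ) (m : ℤ) : overlap N m ≤ 1 := by
  refine div_le_one_of_le₀ ?_ (Nat.cast_nonneg _)
  exact_mod_cast (Finset.card_le_univ _).trans (by simp)

theorem one_sub_le_overlap {N : ℕ} (hN : 0 < N) (m : ℤ) : 1 - |(m : ℝ)| / N ≤ overlap N m := by
  have hN' : (0 : ℝ) < N := by exact_mod_cast hN
  set s := Finset.univ.filter fun i : Fin N => 0 ≤ (i : ℤ) - m ∧ (i : ℤ) - m < N with hs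
  have h1 : (Finset.univ.filter fun i : Fin N => ¬ (0 ≤ (i : ℤ) - m ∧ (i : ℤ) - m < N)).card
      ≤ (Finset.Ico 0 m ∪ Finset.Ico (N + m) (N : ℤ)).card := by
    refine Finset.card_le_card_of_injOn (fun i : Fin N => (i : ℤ)) (fun i hi => ?_) ?_
    · simp only [Finset.coe_filter, Finset.mem_univ, true_and, Set.mem_ofPred_eq] at hi
      simp only [Finset.coe_union, Finset.coe_Ico, Set.mem_union, Set.mem_Ico]
      have := i.2
      omega
    · intro i _ j _ hij
      exact Fin.ext (by simpa using hij)
  have h2 : (Finset.Ico 0 m ∪ Finset.Ico (N + m) (N : ℤ)).card ≤ m.natAbs := by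
    refine (Finset.card_union_le _ _).trans ?_
    simp only [Int.card_Ico]
    omega
  have h3 := Finset.card_filter_add_card_filter_not (s := (Finset.univ : Finset (Fin N)))
    (fun i : Fin N => 0 ≤ (i : ℤ) - m ∧ (i : ℤ) - m < N)
  rw [Finset.card_univ, Fintype.card_fin, ← hs] at h3
  have h4 : (N : ℝ) ≤ s.card + |(m : ℝ)| := by
    have : N ≤ s.card + m.natAbs := by omega
    have h5 : ((m.natAbs : ℕ) : ℝ) = |(m : ℝ)| := by simp
    rw [← h5]
    exact_mod_cast this
  rw [overlap, ← hs, one_sub_div hN'.ne']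
  gcongr
  linarith

theorem tendsto_overlap (m : ℤ) : Tendsto (fun N => overlap N m) atTop (𝓝 1) := by
  have h1 : Tendsto (fun N : ℕ => 1 - |(m : ℝ)| / N) atTop (𝓝 1) := by
    simpa using (tendsto_const_div_atTop_nhds_zero_nat |(m : ℝ)|).const_sub 1
  refine tendsto_of_tendsto_of_tendsto_of_le_of_le' h1 tendsto_const_nhds ?_
    (Eventually.of_forall fun N => overlap_le_one N m)
  filter_upwards [eventually_gt_atTop 0] with N hN using one_sub_le_overlap hN m

/-- The average weight of the pairs formed by a point of a cube of side `N` and a lattice point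
outside of the cube. -/
def cubeLoss (d N : ℕ) : ℝ := ∑' y : Fin d → ℤ, weight y * (1 - ∏ k, overlap N (y k))

theorem cubeLoss_term_mem (N : ℕ) (y : Fin d → ℤ) :
    0 ≤ 1 - ∏ k, overlap N (y k) ∧ 1 - ∏ k, overlap N (y k) ≤ 1 := by
  have h1 : ∏ k, overlap N (y k) ≤ 1 :=
    Finset.prod_le_one (fun k _ => overlap_nonneg _ _) fun k _ => overlap_le_one _ _
  have h2 : 0 ≤ ∏ k, overlap N (y k) := Finset.prod_nonneg fun k _ => overlap_nonneg _ _
  constructor <;> linarith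

theorem tendsto_cubeLoss (d : ℕ) : Tendsto (cubeLoss d) atTop (𝓝 0) := by
  have h := tendsto_tsum_of_dominated_convergence (𝓕 := atTop)
    (f := fun (N : ℕ) (y : Fin d → ℤ) => weight y * (1 - ∏ k, overlap N (y k))) (g := fun _ => 0)
    (bound := weight) summable_weight (fun y => ?_) (Eventually.of_forall fun N y => ?_)
  · rw [tsum_zero] at h
    exact h
  · have h1 : Tendsto (fun N => ∏ k, overlap N (y k)) atTop (𝓝 (∏ _k : Fin d, 1)) :=
      tendsto_finsetProd _ fun k _ => tendsto_overlap (y k)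
    simpa using (h1.const_sub 1).const_mul (weight y)
  · have h1 := cubeLoss_term_mem N y
    rw [Real.norm_eq_abs, abs_of_nonneg (mul_nonneg (weight_pos y).le h1.1)]
    exact mul_le_of_le_one_right (weight_pos y).le h1.2

theorem card_shift_mem_cube {N : ℕ} (y : Fin d → ℤ) :
    ((Finset.univ.filter fun w : Fin d → Fin N =>
      ∀ k, 0 ≤ ((w k : ℕ) : ℤ) - y k ∧ ((w k : ℕ) : ℤ) - y k < N).card : ℝ)
      = (∏ k, overlap N (y k)) * (N : ℝ) ^ d := by
  have h1 : (Finset.univ.filter fun w : Fin d → Fin N =>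
      ∀ k, 0 ≤ ((w k : ℕ) : ℤ) - y k ∧ ((w k : ℕ) : ℤ) - y k < N)
      = Fintype.piFinset fun k => Finset.univ.filter fun i : Fin N =>
        0 ≤ (i : ℤ) - y k ∧ (i : ℤ) - y k < N := by
    ext w; simp
  rw [h1, Fintype.card_piFinset]
  rcases Nat.eq_zero_or_pos N with rfl | hN
  · rcases Nat.eq_zero_or_pos d with rfl | hd
    · simp
    · have : Nonempty (Fin d) := ⟨⟨0, hd⟩⟩
      simp [hd.ne']
  · have hN' : (N : ℝ) ≠ 0 := by exact_mod_cast hN.ne'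
    have h2 : (N : ℝ) ^ d = ∏ _k : Fin d, (N : ℝ) := by simp
    rw [h2, ← Finset.prod_mul_distrib]
    push_cast
    refine Finset.prod_congr rfl fun k _ => ?_
    rw [overlap, div_mul_cancel₀ _ hN']

theorem sum_cube_weight_le {N : ℕ} {ι : Type*} [Fintype ι]
    {z : ι → Fin d → ℤ} (hz : Function.Injective z) (q : Fin d → ℤ) (P : ι → Prop)
    [DecidablePred P] (hP : ∀ b, P b ↔ ∀ k, 0 ≤ z b k - q k ∧ z b k - q k < N) :
    ∑ w : Fin d → Fin N, ∑ b, (if P b then 0 else weight ((fun k => q k + ((w k : ℕ) : ℤ)) - z b))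
      ≤ (N : ℝ) ^ d * cubeLoss d N := by
  classical
  set In : (Fin d → Fin N) → (Fin d → ℤ) → Prop := fun w y =>
    ∀ k, 0 ≤ ((w k : ℕ) : ℤ) - y k ∧ ((w k : ℕ) : ℤ) - y k < N with hIn
  have hsum : ∀ w, Summable fun y : Fin d → ℤ => if In w y then 0 else weight y := fun w => by
    refine Summable.of_nonneg_of_le (fun y => ?_) (fun y => ?_) summable_weight
    · split_ifs
      exacts [le_rfl, (weight_pos y).le]
    · split_ifs
      exacts [(weight_pos y).le, le_rfl]
  calc ∑ w : Fin d → Fin N, ∑ b,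
        (if P b then 0 else weight ((fun k => q k + ((w k : ℕ) : ℤ)) - z b))
      ≤ ∑ w : Fin d → Fin N, ∑' y : Fin d → ℤ, if In w y then 0 else weight y := by
        refine Finset.sum_le_sum fun w _ => ?_
        have hinj : Function.Injective fun b => (fun k => q k + ((w k : ℕ) : ℤ)) - z b :=
          fun a b h => hz (sub_right_injective h)
        rw [← tsum_fintype (L := .unconditional _)]
        refine Summable.tsum_le_tsum_of_inj _ hinj (fun y _ => ?_) (fun b => ?_) Summable.of_finite
          (hsum w)
        · split_ifs
          exacts [le_rfl, (weight_pos y).le]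
        · refine le_of_eq (if_congr ?_ rfl rfl)
          rw [hP]
          refine forall_congr' fun k => ?_
          simp only [Pi.sub_apply]
          constructor <;> rintro ⟨h1, h2⟩ <;> constructor <;> omega
    _ = ∑' y : Fin d → ℤ, ∑ w : Fin d → Fin N, if In w y then 0 else weight y :=
        (Summable.tsum_finsetSum fun w _ => hsum w).symm
    _ = (N : ℝ) ^ d * cubeLoss d N := by
        rw [cubeLoss, ← tsum_mul_left]
        refine tsum_congr fun y => ?_
        have h1 : ∑ w, (if In w y then 0 else weight y)
            = ∑ w, (weight y - weight y * (if In w y then 1 else 0)) :=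
          Finset.sum_congr rfl fun w _ => by split_ifs <;> simp
        rw [h1, Finset.sum_sub_distrib, ← Finset.mul_sum, Finset.sum_boole,
          Finset.sum_const, Finset.card_univ, nsmul_eq_mul, card_shift_mem_cube]
        simp
        ring

end Cubes

section Enumeration

variable {d : ℕ}

/-- An enumeration of `ℕ^d` that exhausts the cubes `[0, N)^d` one after the other. -/
structure CubeEnum (d : ℕ) where
  /-- the enumeration -/
  equiv : ℕ ≃ (Fin d → ℕ)
  lt_pow_iff : ∀ N a, a < N ^ d ↔ ∀ k, equiv a k < N

theorem IsGridEnumeration.exists_cubeEnum {v : ℕ → Fin d → ℕ} (hv : IsGridEnumeration v)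
    (hd : 0 < d) : ∃ E : CubeEnum d, ∀ a k, v a k = E.equiv a k + 1 := by
  classical
  have hmem : ∀ {N a}, 0 < N → a < N ^ d → ∀ k, 1 ≤ v a k ∧ v a k ≤ N := fun {N a} hN ha => by
    have : v a ∈ v '' {i | i < N ^ d} := ⟨a, ha, rfl⟩
    rwa [hv N hN] at this
  have hinjN : ∀ N, 0 < N → Set.InjOn v {i | i < N ^ d} := fun N hN => by
    have h1 : v '' ((Finset.range (N ^ d) : Finset ℕ) : Set ℕ)
        = ((Fintype.piFinset fun _ : Fin d => Finset.Icc 1 N : Finset (Fin d → ℕ)) : Set _) := by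
      have : ((Finset.range (N ^ d) : Finset ℕ) : Set ℕ) = {i | i < N ^ d} := by ext; simp
      rw [this, hv N hN]; ext w; simp [Pi.le_def, forall_and]
    have h2 : (Finset.range (N ^ d)).image v = Fintype.piFinset fun _ : Fin d => Finset.Icc 1 N := by
      rw [← Finset.coe_inj, Finset.coe_image, h1]
    have h3 : ((Finset.range (N ^ d)).image v).card = (Finset.range (N ^ d)).card := by
      rw [h2, Fintype.card_piFinset]; simp
    have h4 := Finset.card_image_iff.1 h3
    intro a ha b hb hab
    exact h4 (by simpa using ha) (by simpa using hb) hab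
  have hlt : ∀ a : ℕ, a < (a + 1) ^ d := fun a =>
    lt_of_lt_of_le (Nat.lt_succ_self a) (Nat.le_self_pow hd.ne' _)
  have hinj : Function.Injective v := fun a b hab => by
    refine hinjN (max a b + 1) (Nat.succ_pos _) ?_ ?_ hab
    · exact (hlt a).trans_le (Nat.pow_le_pow_left (by omega) d)
    · exact (hlt b).trans_le (Nat.pow_le_pow_left (by omega) d)
  have hpos : ∀ a k, 1 ≤ v a k := fun a k => (hmem (Nat.succ_pos a) (hlt a) k).1
  have hpre : ∀ N, 0 < N → ∀ w : Fin d → ℕ, (∀ k, 1 ≤ w k ∧ w k ≤ N) → ∃ a, a < N ^ d ∧ v a = w := by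
    intro N hN w hw
    have : w ∈ {w : Fin d → ℕ | ∀ k, 1 ≤ w k ∧ w k ≤ N} := hw
    rw [← hv N hN] at this
    exact this
  have hbij : Function.Bijective fun a k => v a k - 1 := by
    constructor
    · intro a b hab
      refine hinj (funext fun k => ?_)
      have h1 : v a k - 1 = v b k - 1 := congrFun hab k
      have := hpos a k
      have := hpos b k
      omega
    · intro w
      obtain ⟨a, -, ha⟩ := hpre (∑ k, w k + 1) (Nat.succ_pos _) (fun k => w k + 1) fun k =>
        ⟨by omega, by
          have := Finset.single_le_sum (f := w) (fun i _ => Nat.zero_le _) (Finset.mem_univ k)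
          omega⟩
      exact ⟨a, funext fun k => by simp [ha]⟩
  refine ⟨⟨Equiv.ofBijective _ hbij, fun N a => ⟨fun h k => ?_, fun h => ?_⟩⟩, fun a k => ?_⟩
  · have hN : 0 < N := by
      rcases Nat.eq_zero_or_pos N with rfl | hN
      · simp [hd.ne'] at h
      · exact hN
    have := hmem hN h k
    simp only [Equiv.ofBijective_apply]
    omega
  · simp only [Equiv.ofBijective_apply] at h
    have hN : 0 < N := lt_of_le_of_lt (Nat.zero_le _) (h ⟨0, hd⟩)
    obtain ⟨b, hb, hvb⟩ := hpre N hN (v a) fun k => ⟨hpos a k, by have := h k; omega⟩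
    rwa [← hinj hvb]
  · simp only [Equiv.ofBijective_apply]
    have := hpos a k
    omega

namespace CubeEnum

variable (E : CubeEnum d)

/-- The lattice points of the enumeration. -/
def site (a : ℕ) : Fin d → ℤ := fun k => (E.equiv a k : ℤ)

theorem site_injective : Function.Injective E.site := fun _ _ h =>
  E.equiv.injective (funext fun k => Int.ofNat_inj.1 (congrFun h k))

/-- The number of the cube of side `N` that contains the point of number `a`. -/
def cube (N a : ℕ) : ℕ := E.equiv.symm fun k => E.equiv a k / N

/-- The number of the point at offset `w` in the `j`-th cube of side `N`. -/
def point {N : ℕ} (j : ℕ) (w : Fin d → Fin N) : ℕ := E.equiv.symm fun k => N * E.equiv j k + w k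

theorem equiv_point {N : ℕ} (j : ℕ) (w : Fin d → Fin N) (k : Fin d) :
    E.equiv (E.point j w) k = N * E.equiv j k + w k := by
  simp [point]

theorem cube_point {N : ℕ} (j : ℕ) (w : Fin d → Fin N) : E.cube N (E.point j w) = j := by
  rw [cube, Equiv.symm_apply_eq]
  funext k
  rw [equiv_point]
  have hw := (w k).2
  rw [Nat.mul_add_div (by omega), Nat.div_eq_of_lt hw, add_zero]

theorem point_injective {N : ℕ} (j : ℕ) :
    Function.Injective (E.point j : (Fin d → Fin N) → ℕ) := fun w w' h => by
  funext k
  have := congrArg (fun a => E.equiv a k) h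
  simp only [equiv_point] at this
  exact Fin.ext (by omega)

theorem cube_lt_iff {N : ℕ} (hN : 0 < N) (m a : ℕ) : E.cube N a < m ^ d ↔ a < (m * N) ^ d := by
  rw [E.lt_pow_iff, E.lt_pow_iff]
  simp only [cube, Equiv.apply_symm_apply]
  exact forall_congr' fun k => Nat.div_lt_iff_lt_mul hN

theorem cube_eq_iff {N : ℕ} (hN : 0 < N) (j a : ℕ) :
    E.cube N a = j ↔ ∀ k, 0 ≤ E.site a k - N * E.site j k ∧ E.site a k - N * E.site j k < N := by
  rw [cube, Equiv.symm_apply_eq, funext_iff]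
  refine forall_congr' fun k => ?_
  simp only [site]
  rw [Nat.div_eq_iff hN]
  have h1 : ((N * E.equiv j k : ℕ) : ℤ) = (N : ℤ) * E.equiv j k := by push_cast; ring
  rw [← h1, mul_comm]
  omega

/-- The configuration of the first `n` points. -/
def config (x : ℕ → EuclideanSpace ℝ (Fin d)) (hx : ∀ a k, |x a k| ≤ 1) (n : ℕ) : Config d where
  idx := Fin n
  site a := E.site a
  inj := E.site_injective.comp Fin.val_injective
  pert a := x a
  pert_le a := hx a

/-- The cube label of a point among the first ones; the points outside of the first `m^d` cubes get
a common label. -/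
def label (N m : ℕ) {n : ℕ} (a : Fin n) : Fin (m ^ d + 1) :=
  ⟨min (E.cube N a) (m ^ d), by omega⟩

theorem label_eq_castSucc {N m n : ℕ} (a : Fin n) (j : Fin (m ^ d)) :
    E.label N m a = j.castSucc ↔ E.cube N a = j := by
  rw [label, Fin.ext_iff]
  simp only [Fin.val_castSucc]
  have := j.2
  omega

/-- The points of a cube are parametrized by the offsets. -/
def fiberEquiv {N m n : ℕ} (hN : 0 < N) (hn : (m * N) ^ d ≤ n) (j : Fin (m ^ d)) :
    (Fin d → Fin N) ≃ {a : Fin n // E.label N m a = j.castSucc} where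
  toFun w := ⟨⟨E.point j w, ((E.cube_lt_iff hN m _).1 (by rw [E.cube_point]; exact j.2)).trans_le hn⟩,
    (E.label_eq_castSucc _ j).2 (E.cube_point _ _)⟩
  invFun a k := ⟨E.equiv a.1 k % N, Nat.mod_lt _ hN⟩
  left_inv w := by
    funext k
    refine Fin.ext ?_
    simp only [equiv_point]
    rw [Nat.mul_add_mod, Nat.mod_eq_of_lt (w k).2]
  right_inv a := by
    have ha := (E.label_eq_castSucc a.1 j).1 a.2
    refine Subtype.ext (Fin.ext ?_)
    simp only
    rw [point, Equiv.symm_apply_eq]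
    funext k
    rw [← ha, cube, Equiv.apply_symm_apply]
    exact Nat.div_add_mod _ _

theorem card_last_fiber {N m n : ℕ} (hN : 0 < N) (hn : (m * N) ^ d ≤ n) :
    (Fintype.card {a : Fin n // E.label N m a = Fin.last (m ^ d)} : ℝ)
      = n - ((m * N) ^ d : ℕ) := by
  have h1 : Fintype.card (Σ j, {a : Fin n // E.label N m a = j}) = n := by
    rw [Fintype.card_congr (Equiv.sigmaFiberEquiv _), Fintype.card_fin]
  rw [Fintype.card_sigma, Fin.sum_univ_castSucc] at h1
  have h2 : ∀ j : Fin (m ^ d), Fintype.card {a : Fin n // E.label N m a = j.castSucc} = N ^ d :=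
    fun j => by rw [← Fintype.card_congr (E.fiberEquiv hN hn j)]; simp
  simp only [h2, Finset.sum_const, Finset.card_univ, Fintype.card_fin, smul_eq_mul] at h1
  have h3 : (m * N) ^ d + Fintype.card {a : Fin n // E.label N m a = Fin.last (m ^ d)} = n := by
    rw [mul_pow]; exact h1
  rw [eq_sub_iff_add_eq, add_comm]
  exact_mod_cast h3

/-- The lattice points of the standard cube of side `N`. -/
def _root_.PerturbedGrid.cubeSite (d N : ℕ) (w : Fin d → Fin N) : Fin d → ℤ :=
  fun k => ((w k : ℕ) : ℤ)

theorem site_point {N : ℕ} (j : ℕ) (w : Fin d → Fin N) :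
    E.site (E.point j w) = fun k => N * E.site j k + ((w k : ℕ) : ℤ) := by
  funext k
  simp only [site, equiv_point]
  push_cast
  ring

theorem kernelMatrix_point (h : EuclideanSpace ℝ (Fin d) → ℝ) (x : ℕ → EuclideanSpace ℝ (Fin d))
    (ε : ℝ) {N : ℕ} (j : ℕ) :
    kernelMatrix h (fun w : Fin d → Fin N => E.site (E.point j w)) (fun w => x (E.point j w)) ε
      = kernelMatrix h (cubeSite d N) (fun w => x (E.point j w)) ε := by
  ext w w'
  simp only [kernelMatrix, Matrix.of_apply, gridPoint_sub]
  congr 4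
  funext k
  simp [site_point, cubeSite]

theorem trace_fiber {N m n : ℕ} (hN : 0 < N) (hn : (m * N) ^ d ≤ n) (j : Fin (m ^ d))
    (e : MatExpr) (k k₁ k₂ : EuclideanSpace ℝ (Fin d) → ℝ) (x : ℕ → EuclideanSpace ℝ (Fin d))
    (hx : ∀ a k, |x a k| ≤ 1) (ε : ℝ) :
    ((E.config x hx n).comp (Subtype.val : {a : Fin n // E.label N m a = j.castSucc} → Fin n)
      Subtype.val_injective).trace e k k₁ k₂ ε
      = exprTrace e k k₁ k₂ (cubeSite d N) (fun w => x (E.point j w)) ε := by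
  rw [exprTrace, ← E.kernelMatrix_point k, ← E.kernelMatrix_point k₁, ← E.kernelMatrix_point k₂]
  exact (e.trace_eval_submatrix (ι := {a : Fin n // E.label N m a = j.castSucc})
    (kernelMatrix k (fun a => E.site a.1) (fun a => x a.1) ε)
    (kernelMatrix k₁ (fun a => E.site a.1) (fun a => x a.1) ε)
    (kernelMatrix k₂ (fun a => E.site a.1) (fun a => x a.1) ε) (E.fiberEquiv hN hn j)).symm

theorem crossWeight_label_le {N m n : ℕ} (hN : 0 < N) (hn : (m * N) ^ d ≤ n)
    (x : ℕ → EuclideanSpace ℝ (Fin d)) (hx : ∀ a k, |x a k| ≤ 1) :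
    (E.config x hx n).crossWeight (fun a : Fin n => E.label N m a)
      ≤ ((m * N) ^ d : ℕ) * cubeLoss d N
        + (n - ((m * N) ^ d : ℕ)) * ∑' y : Fin d → ℤ, weight y := by
  have hinj : Function.Injective fun a : Fin n => E.site a :=
    E.site_injective.comp Fin.val_injective
  have h1 : (E.config x hx n).crossWeight (fun a : Fin n => E.label N m a)
      = ∑ a : Fin n, ∑ b : Fin n,
        if E.label N m a = E.label N m b then 0 else weight (E.site a - E.site b) := rfl
  rw [h1, ← (Equiv.sigmaFiberEquiv fun a : Fin n => E.label N m a).sum_comp, Fintype.sum_sigma,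
    Fin.sum_univ_castSucc]
  refine add_le_add ?_ ?_
  · have h2 : ∀ j : Fin (m ^ d), ∑ a : {a : Fin n // E.label N m a = j.castSucc}, (∑ b : Fin n,
        if E.label N m a.1 = E.label N m b then 0 else weight (E.site a.1 - E.site b))
        ≤ (N : ℝ) ^ d * cubeLoss d N := fun j => by
      rw [← (E.fiberEquiv hN hn j).sum_comp]
      have h3 := sum_cube_weight_le hinj (fun k => N * E.site j k) (N := N)
        (fun b : Fin n => E.label N m b = j.castSucc)
        (fun b => (E.label_eq_castSucc b j).trans (E.cube_eq_iff hN j b))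
      refine le_trans (le_of_eq ?_) h3
      refine Finset.sum_congr rfl fun w _ => Finset.sum_congr rfl fun b _ => ?_
      have h4 := ((E.fiberEquiv hN hn j) w).2
      rw [h4]
      refine if_congr eq_comm rfl ?_
      congr 2
      exact E.site_point j w
    refine (Finset.sum_le_sum fun j _ => h2 j).trans (le_of_eq ?_)
    simp [mul_pow, mul_assoc]
  · rw [← E.card_last_fiber hN hn]
    refine (Finset.sum_le_card_nsmul _ _ (∑' y : Fin d → ℤ, weight y) fun a _ => ?_).trans
      (le_of_eq (by simp))
    refine le_trans (Finset.sum_le_sum fun b _ => ?_) (sum_weight_sub_le hinj (E.site a.1))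
    split_ifs
    · exact (weight_pos _).le
    · exact le_rfl

theorem exists_trace_sub_cubes_le {k k₁ k₂ : EuclideanSpace ℝ (Fin d) → ℝ}
    (h : AdmissibleKernels k k₁ k₂) (e : MatExpr) {ε : ℝ} (hε : ε ∈ Ico (0 : ℝ) (1 / 2)) :
    ∃ C : ℝ, 0 ≤ C ∧ ∀ x : ℕ → EuclideanSpace ℝ (Fin d), (∀ a k, |x a k| ≤ 1) →
      ∀ N m n : ℕ, 0 < N → (m * N) ^ d ≤ n →
      |exprTrace e k k₁ k₂ (fun a : Fin n => E.site a) (fun a : Fin n => x a) ε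
        - ∑ j ∈ Finset.range (m ^ d),
          exprTrace e k k₁ k₂ (cubeSite d N) (fun w => x (E.point j w)) ε|
        ≤ C * (((m * N) ^ d : ℕ) * cubeLoss d N + (n - ((m * N) ^ d : ℕ))) := by
  obtain ⟨C, hC0, hC⟩ := h.exists_trace_sub_blocks_le e hε
  obtain ⟨B, hB0, hB⟩ := h.exists_abs_trace_le e hε
  set W := ∑' y : Fin d → ℤ, weight y with hW
  have hW0 : 0 ≤ W := tsum_nonneg fun y => (weight_pos y).le
  refine ⟨C + C * W + B, by positivity, fun x hx N m n hN hn => ?_⟩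
  have h1 := hC (E.config x hx n) (m ^ d + 1) (fun a => E.label N m a)
  rw [Fin.sum_univ_castSucc] at h1
  have h2 := hB ((E.config x hx n).comp (Subtype.val :
    {a : Fin n // E.label N m a = Fin.last (m ^ d)} → Fin n) Subtype.val_injective)
  have h2' := h2.trans_eq (congrArg (B * ·) (E.card_last_fiber hN hn))
  have h3 := E.crossWeight_label_le hN hn x hx
  have h4 : ∑ j : Fin (m ^ d), ((E.config x hx n).comp
      (Subtype.val : {a : Fin n // E.label N m a = j.castSucc} → Fin n)
        Subtype.val_injective).trace e k k₁ k₂ ε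
      = ∑ j ∈ Finset.range (m ^ d),
          exprTrace e k k₁ k₂ (cubeSite d N) (fun w => x (E.point j w)) ε := by
    rw [Finset.sum_range]
    exact Finset.sum_congr rfl fun j _ => E.trace_fiber hN hn j e k k₁ k₂ x hx ε
  have h5 : (0 : ℝ) ≤ n - ((m * N) ^ d : ℕ) := sub_nonneg.2 (by exact_mod_cast hn)
  have h6 : 0 ≤ cubeLoss d N :=
    tsum_nonneg fun y => mul_nonneg (weight_pos y).le (cubeLoss_term_mem N y).1
  have h7 : (0 : ℝ) ≤ ((m * N) ^ d : ℕ) := Nat.cast_nonneg _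
  have h8 : ∀ t s r u : ℝ, |t - (s + r)| ≤ C * u → |r| ≤ B * (n - ((m * N) ^ d : ℕ)) →
      u ≤ ((m * N) ^ d : ℕ) * cubeLoss d N + (n - ((m * N) ^ d : ℕ)) * W →
      |t - s| ≤ (C + C * W + B) * (((m * N) ^ d : ℕ) * cubeLoss d N + (n - ((m * N) ^ d : ℕ))) := by
    intro t s r u h1 h2 h3
    generalize ((n : ℝ) - ((m * N) ^ d : ℕ)) = p at *
    generalize (((m * N) ^ d : ℕ) : ℝ) = q at *
    have h9 : |t - s| ≤ |t - (s + r)| + |r| := by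
      have := abs_add_le (t - (s + r)) r
      rwa [show t - (s + r) + r = t - s by ring] at this
    have h10 := mul_le_mul_of_nonneg_left h3 hC0
    have h11 : 0 ≤ q * cubeLoss d N := mul_nonneg h7 h6
    have h12 : 0 ≤ C * W := mul_nonneg hC0 hW0
    nlinarith [mul_nonneg hC0 h5, mul_nonneg h12 h11, mul_nonneg hB0 h11]
  refine h8 _ _ _ _ ?_ h2' h3
  rw [← h4]
  exact h1

end CubeEnum

end Enumeration

section Measurability

variable {α ι : Type*} [MeasurableSpace α] [DecidableEq ι]

theorem measurable_diagPart_apply {A : α → Matrix ι ι ℝ}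
    (hA : ∀ a b, Measurable fun x => A x a b) (a b : ι) :
    Measurable fun x => diagPart (A x) a b := by
  simp only [diagPart, Matrix.diagonal_apply]
  split_ifs
  · exact hA a a
  · exact measurable_const

variable [Fintype ι]

theorem measurable_det {A : α → Matrix ι ι ℝ} (hA : ∀ a b, Measurable fun x => A x a b) :
    Measurable fun x => (A x).det := by
  simp only [Matrix.det_apply]
  exact Finset.measurable_fun_sum _ fun s _ =>
    (Finset.measurable_fun_prod _ fun i _ => hA _ _).const_smul (Equiv.Perm.sign s)

theorem measurable_inv_apply {A : α → Matrix ι ι ℝ} (hA : ∀ a b, Measurable fun x => A x a b)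
    (a b : ι) : Measurable fun x => (A x)⁻¹ a b := by
  simp only [Matrix.inv_def, Ring.inverse_eq_inv', Matrix.smul_apply, smul_eq_mul,
    Matrix.adjugate_apply]
  refine (measurable_det hA).inv.mul (measurable_det fun i j => ?_)
  simp only [Matrix.updateRow_apply]
  split_ifs
  · exact measurable_const
  · exact hA i j

theorem MatExpr.measurable_eval (e : MatExpr) {R D D' : α → Matrix ι ι ℝ}
    (hR : ∀ a b, Measurable fun x => R x a b) (hD : ∀ a b, Measurable fun x => D x a b)
    (hD' : ∀ a b, Measurable fun x => D' x a b) (a b : ι) :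
    Measurable fun x => e.eval (R x) (D x) (D' x) a b := by
  induction e generalizing a b with
  | base => exact hR a b
  | fst => exact hD a b
  | snd => exact hD' a b
  | baseInv => exact measurable_inv_apply hR a b
  | diagInv => exact measurable_inv_apply (measurable_diagPart_apply (measurable_inv_apply hR)) a b
  | add e f he hf => exact (he a b).add (hf a b)
  | smul c e he => exact (he a b).const_mul c
  | mul e f he hf =>
    simp only [MatExpr.eval, Matrix.mul_apply]
    exact Finset.measurable_fun_sum _ fun i _ => (he a i).mul (hf i b)
  | diag e he => exact measurable_diagPart_apply he a b
  | transpose e he => exact he b a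

variable {d : ℕ}

theorem RegularKernel.measurable {h : EuclideanSpace ℝ (Fin d) → ℝ} (hh : RegularKernel h) :
    Measurable h := by
  refine measurable_of_continuousOn_compl_singleton 0 ?_
  have h1 := (ContinuousMultilinearMap.apply ℝ (fun _ : Fin 0 => EuclideanSpace ℝ (Fin d)) ℝ
    fun _ => 0).continuous.comp_continuousOn (hh.differentiable 0 (by norm_num)).continuousOn
  exact h1.congr fun t _ => by simp

theorem measurable_exprTrace {k k₁ k₂ : EuclideanSpace ℝ (Fin d) → ℝ}
    (h : AdmissibleKernels k k₁ k₂) (e : MatExpr) (z : ι → Fin d → ℤ) (ε : ℝ) :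
    Measurable fun x : ι → EuclideanSpace ℝ (Fin d) => exprTrace e k k₁ k₂ z x ε := by
  have hm : ∀ {h : EuclideanSpace ℝ (Fin d) → ℝ}, Measurable h → ∀ a b, Measurable
      fun x : ι → EuclideanSpace ℝ (Fin d) => kernelMatrix h z x ε a b := fun hh a b => by
    simp only [kernelMatrix, Matrix.of_apply, gridPoint]
    exact hh.comp (by fun_prop)
  exact Finset.measurable_fun_sum _ fun a _ => e.measurable_eval (hm h.regular.measurable)
    (hm h.regular₁.measurable) (hm h.regular₂.measurable) a a

end Measurability

section Limits

theorem exists_tendsto_of_eventually_near {u : ℕ → ℝ} {b D : ℕ → ℝ} (hD : Tendsto D atTop (𝓝 0))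
    (hu : ∀ N, 0 < N → ∀ η > 0, ∀ᶠ n in atTop, |u n - b N| ≤ D N + η) :
    ∃ L, Tendsto u atTop (𝓝 L) := by
  refine cauchySeq_tendsto_of_complete (Metric.cauchySeq_iff'.2 fun η hη => ?_)
  have h1 : ∀ᶠ N in atTop, D N < η / 8 := hD.eventually_lt_const (by positivity)
  obtain ⟨N, hN, hN0⟩ := (h1.and (eventually_gt_atTop 0)).exists
  obtain ⟨n₀, hn₀⟩ := eventually_atTop.1 (hu N hN0 (η / 8) (by positivity))
  refine ⟨n₀, fun n hn => ?_⟩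
  have h2 := hn₀ n hn
  have h3 := hn₀ n₀ le_rfl
  rw [Real.dist_eq]
  calc |u n - u n₀| ≤ |u n - b N| + |u n₀ - b N| := by
        rw [show u n - u n₀ = (u n - b N) - (u n₀ - b N) by ring]; exact abs_sub _ _
    _ < η := by linarith

theorem tendsto_of_eventually_near {u w : ℕ → ℝ} {b D : ℕ → ℝ} {L : ℝ}
    (hD : Tendsto D atTop (𝓝 0))
    (hu : ∀ N, 0 < N → ∀ η > 0, ∀ᶠ n in atTop, |u n - b N| ≤ D N + η)
    (hw : ∀ N, 0 < N → ∀ η > 0, ∀ᶠ n in atTop, |w n - b N| ≤ D N + η)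
    (hL : Tendsto u atTop (𝓝 L)) : Tendsto w atTop (𝓝 L) := by
  refine Metric.tendsto_atTop'.2 fun η hη => ?_
  have h1 : ∀ᶠ N in atTop, D N < η / 8 := hD.eventually_lt_const (by positivity)
  obtain ⟨N, hN, hN0⟩ := (h1.and (eventually_gt_atTop 0)).exists
  have h2 : ∀ᶠ n in atTop, dist (u n) L < η / 8 := Metric.tendsto_nhds.1 hL _ (by positivity)
  obtain ⟨n₀, hn₀⟩ := eventually_atTop.1
    (((hu N hN0 (η / 8) (by positivity)).and (hw N hN0 (η / 8) (by positivity))).and h2)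
  refine ⟨n₀, fun n hn => ?_⟩
  obtain ⟨⟨h3, h4⟩, h5⟩ := hn₀ n hn.le
  rw [Real.dist_eq] at h5 ⊢
  rw [abs_le] at h3 h4
  rw [abs_lt] at h5 ⊢
  constructor <;> linarith

/-- Every `n` lies between two consecutive values of `(m N)^d`. -/
theorem exists_pow_le_lt {d N : ℕ} (hd : 0 < d) (hN : 0 < N) (n : ℕ) :
    ∃ m : ℕ, (m * N) ^ d ≤ n ∧ n < ((m + 1) * N) ^ d := by
  have hex : ∃ m : ℕ, n < ((m + 1) * N) ^ d := ⟨n, by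
    calc n < n + 1 := Nat.lt_succ_self n
      _ ≤ (n + 1) * N := Nat.le_mul_of_pos_right _ hN
      _ ≤ _ := Nat.le_self_pow hd.ne' _⟩
  classical
  refine ⟨Nat.find hex, ?_, Nat.find_spec hex⟩
  rcases Nat.eq_zero_or_pos (Nat.find hex) with h | h
  · rw [h]; simp [hd.ne']
  · have := Nat.find_min hex (Nat.sub_lt h one_pos)
    have h1 : Nat.find hex - 1 + 1 = Nat.find hex := Nat.sub_add_cancel h
    rw [h1] at this
    exact not_lt.1 this

/-- If partial sums along cubes approximate a sequence, an average limit of the terms controls the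
averages of the sequence. -/
theorem eventually_near_of_cubes {d N : ℕ} (hd : 0 < d) (hN : 0 < N) {T Y : ℕ → ℝ} {C δ a : ℝ}
    (hC : ∀ m n : ℕ, (m * N) ^ d ≤ n → |T n - ∑ j ∈ Finset.range (m ^ d), Y j|
      ≤ C * (((m * N) ^ d : ℕ) * δ + (n - ((m * N) ^ d : ℕ))))
    (hY : Tendsto (fun n : ℕ => (∑ j ∈ Finset.range n, Y j) / n) atTop (𝓝 a)) {η : ℝ}
    (hη : 0 < η) :
    ∀ᶠ n : ℕ in atTop, |1 / (n : ℝ) * T n - a / (N : ℝ) ^ d| ≤ C * δ + η := by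
  choose m hm1 hm2 using exists_pow_le_lt hd hN
  have hN' : (0 : ℝ) < N := by exact_mod_cast hN
  have hm : Tendsto m atTop atTop := by
    refine tendsto_atTop.2 fun b => ?_
    filter_upwards [eventually_ge_atTop ((b * N) ^ d)] with n hn
    by_contra hlt
    have h1 := (hm2 n).trans_le (Nat.pow_le_pow_left (Nat.mul_le_mul_right N (not_le.1 hlt)) d)
    omega
  have hratio : Tendsto (fun n : ℕ => (((m n * N) ^ d : ℕ) : ℝ) / n) atTop (𝓝 1) := by
    have h1 : Tendsto (fun n : ℕ => ((m n : ℝ) / (m n + 1)) ^ d) atTop (𝓝 1) := by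
      have := ((tendsto_natCast_div_add_atTop (1 : ℝ)).comp hm).pow d
      simpa using this
    refine tendsto_of_tendsto_of_tendsto_of_le_of_le' h1 tendsto_const_nhds ?_ ?_
    · filter_upwards [eventually_gt_atTop 0] with n hn
      have hn' : (0 : ℝ) < n := by exact_mod_cast hn
      rw [div_pow, div_le_div_iff₀ (by positivity) hn']
      have h2 : (n : ℝ) ≤ (((m n + 1) * N) ^ d : ℕ) := by exact_mod_cast (hm2 n).le
      push_cast at h2 ⊢
      calc (m n : ℝ) ^ d * n ≤ (m n : ℝ) ^ d * ((m n + 1) * N) ^ d := by gcongr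
        _ = _ := by rw [mul_pow, mul_pow]; ring
    · filter_upwards with n
      exact div_le_one_of_le₀ (by exact_mod_cast hm1 n) (Nat.cast_nonneg _)
  have hmd : Tendsto (fun n => m n ^ d) atTop atTop := (tendsto_pow_atTop hd.ne').comp hm
  have hc : Tendsto (fun n : ℕ => (((m n * N) ^ d : ℕ) : ℝ) / n * (1 / (N : ℝ) ^ d) *
      ((∑ j ∈ Finset.range (m n ^ d), Y j) / ((m n ^ d : ℕ) : ℝ))) atTop (𝓝 (a / (N : ℝ) ^ d)) := by
    have := (hratio.mul_const (1 / (N : ℝ) ^ d)).mul (hY.comp hmd)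
    rw [show 1 * (1 / (N : ℝ) ^ d) * a = a / (N : ℝ) ^ d by ring] at this
    exact this
  have hD : Tendsto (fun n : ℕ => C * ((((m n * N) ^ d : ℕ) : ℝ) / n * δ +
      (1 - (((m n * N) ^ d : ℕ) : ℝ) / n))) atTop (𝓝 (C * δ)) := by
    have := ((hratio.mul_const δ).add (hratio.const_sub 1)).const_mul C
    simpa using this
  have e1 := hD.eventually_lt_const (show C * δ < C * δ + η / 2 by linarith)
  have e2 := Metric.tendsto_nhds.1 hc (η / 2) (by positivity)
  filter_upwards [e1, e2, eventually_gt_atTop 0, hm.eventually_gt_atTop 0] with n h1 h2 hn hmn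
  have hn' : (0 : ℝ) < n := by exact_mod_cast hn
  have hmn' : (0 : ℝ) < m n := by exact_mod_cast hmn
  rw [Real.dist_eq] at h2
  have h3 : (((m n * N) ^ d : ℕ) : ℝ) / n * (1 / (N : ℝ) ^ d) *
      ((∑ j ∈ Finset.range (m n ^ d), Y j) / ((m n ^ d : ℕ) : ℝ))
      = 1 / (n : ℝ) * ∑ j ∈ Finset.range (m n ^ d), Y j := by
    push_cast
    rw [mul_pow]
    field_simp
  rw [h3] at h2
  have h4 : |1 / (n : ℝ) * T n - 1 / (n : ℝ) * ∑ j ∈ Finset.range (m n ^ d), Y j|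
      ≤ C * ((((m n * N) ^ d : ℕ) : ℝ) / n * δ + (1 - (((m n * N) ^ d : ℕ) : ℝ) / n)) := by
    rw [← mul_sub, abs_mul, abs_of_pos (by positivity)]
    refine (mul_le_mul_of_nonneg_left (hC (m n) n (hm1 n)) (by positivity)).trans (le_of_eq ?_)
    field_simp
  have h5 := abs_sub_le (1 / (n : ℝ) * T n) (1 / (n : ℝ) * ∑ j ∈ Finset.range (m n ^ d), Y j)
    (a / (N : ℝ) ^ d)
  linarith

end Limits

section AlmostSure

variable {d : ℕ} {Ω : Type*} [MeasurableSpace Ω] {P : Measure Ω}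
  {μ : Measure (EuclideanSpace ℝ (Fin d))} {X : ℕ → Ω → EuclideanSpace ℝ (Fin d)}

theorem ae_abs_le_one (hμ : IsPerturbationLaw μ) (hX : ∀ a, HasLaw (X a) μ P) :
    ∀ᵐ ω ∂P, ∀ a k, |X a ω k| ≤ 1 := by
  refine ae_all_iff.2 fun a => ?_
  have h1 : ∀ᵐ x ∂μ, ∀ k, |x k| ≤ 1 := by
    filter_upwards [μ.support_mem_ae] with x hx using hμ.support_subset hx
  rw [← (hX a).map_eq] at h1
  exact ae_of_ae_map (hX a).aemeasurable h1

theorem indepFun_of_injective (hindep : iIndepFun X P) (hX : ∀ a, AEMeasurable (X a) P)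
    {κ : Type*} [Fintype κ] {s t : κ → ℕ} (hst : ∀ w w', s w ≠ t w')
    {g : (κ → EuclideanSpace ℝ (Fin d)) → ℝ} (hg : Measurable g) :
    IndepFun (fun ω => g fun w => X (s w) ω) (fun ω => g fun w => X (t w) ω) P := by
  classical
  have h1 := hindep.indepFun_finset₀ (Finset.univ.image s) (Finset.univ.image t) (by
    rw [Finset.disjoint_left]
    intro a ha hb
    obtain ⟨w, -, hw⟩ := Finset.mem_image.1 ha
    obtain ⟨w', -, hw'⟩ := Finset.mem_image.1 hb
    exact hst w w' (hw.trans hw'.symm)) hX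
  exact h1.comp
    (φ := fun y => g fun w => y ⟨s w, Finset.mem_image_of_mem s (Finset.mem_univ w)⟩)
    (ψ := fun y => g fun w => y ⟨t w, Finset.mem_image_of_mem t (Finset.mem_univ w)⟩)
    (hg.comp (by fun_prop)) (hg.comp (by fun_prop))

theorem identDistrib_of_injective (hindep : iIndepFun X P) (hX : ∀ a, HasLaw (X a) μ P)
    {κ : Type*} [Fintype κ] {s t : κ → ℕ} (hs : Function.Injective s) (ht : Function.Injective t)
    {g : (κ → EuclideanSpace ℝ (Fin d)) → ℝ} (hg : Measurable g) :
    IdentDistrib (fun ω => g fun w => X (s w) ω) (fun ω => g fun w => X (t w) ω) P P := by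
  have h1 : ∀ {s : κ → ℕ}, Function.Injective s →
      P.map (fun ω w => X (s w) ω) = Measure.pi fun _ => μ := fun hs => by
    rw [(hindep.precomp hs).map_fun_eq_pi_map fun w => (hX _).aemeasurable]
    simp only [(hX _).map_eq]
  have h2 : IdentDistrib (fun ω w => X (s w) ω) (fun ω w => X (t w) ω) P P :=
    ⟨aemeasurable_pi_lambda _ fun w => (hX _).aemeasurable,
      aemeasurable_pi_lambda _ fun w => (hX _).aemeasurable, by rw [h1 hs, h1 ht]⟩
  exact h2.comp hg

/-- The averaged trace has a deterministic almost sure limit. -/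
theorem exists_ae_tendsto_trace [IsProbabilityMeasure P] (hd : 0 < d) (E : CubeEnum d)
    (hμ : IsPerturbationLaw μ) (hX : ∀ a, HasLaw (X a) μ P) (hindep : iIndepFun X P)
    {k k₁ k₂ : EuclideanSpace ℝ (Fin d) → ℝ} (h : AdmissibleKernels k k₁ k₂) (e : MatExpr) {ε : ℝ}
    (hε : ε ∈ Ico (0 : ℝ) (1 / 2)) :
    ∃ L : ℝ, ∀ᵐ ω ∂P, Tendsto (fun n : ℕ => 1 / (n : ℝ) *
      exprTrace e k k₁ k₂ (fun a : Fin n => E.site a) (fun a : Fin n => X a ω) ε) atTop (𝓝 L) := by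
  obtain ⟨C, hC0, hC⟩ := E.exists_trace_sub_cubes_le h e hε
  obtain ⟨B, hB0, hB⟩ := h.exists_abs_trace_le e hε
  have hgood := ae_abs_le_one hμ hX
  set g : ∀ N : ℕ, ((Fin d → Fin N) → EuclideanSpace ℝ (Fin d)) → ℝ := fun N x =>
    exprTrace e k k₁ k₂ (cubeSite d N) x ε with hg
  have hgm : ∀ N, Measurable (g N) := fun N => measurable_exprTrace h e _ ε
  set Y : ℕ → ℕ → Ω → ℝ := fun N j ω => g N fun w => X (E.point j w) ω with hY
  have hslln : ∀ᵐ ω ∂P, ∀ N, Tendsto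
      (fun n : ℕ => (∑ j ∈ Finset.range n, Y N j ω) / n) atTop (𝓝 (∫ ω, Y N 0 ω ∂P)) := by
    refine ae_all_iff.2 fun N => strong_law_ae_real (Y N) ?_ ?_ ?_
    · refine Integrable.of_bound (C := B * Fintype.card (Fin d → Fin N)) ?_ ?_
      · exact ((hgm N).comp_aemeasurable (aemeasurable_pi_lambda _ fun w =>
          (hX _).aemeasurable)).aestronglyMeasurable
      · filter_upwards [hgood] with ω hω
        exact hB ⟨Fin d → Fin N, cubeSite d N, fun w w' hw => funext fun k =>
          Fin.ext (Int.ofNat_inj.1 (congrFun hw k)), fun w => X (E.point 0 w) ω,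
          fun w => hω _⟩
    · intro i j hij
      refine indepFun_of_injective hindep (fun a => (hX a).aemeasurable) (fun w w' hw => hij ?_)
        (hgm N)
      rw [← E.cube_point i w, ← E.cube_point j w', hw]
    · exact fun j => identDistrib_of_injective hindep hX (E.point_injective j)
        (E.point_injective 0) (hgm N)
  have hnear : ∀ᵐ ω ∂P, ∀ N, 0 < N → ∀ η > 0, ∀ᶠ n : ℕ in atTop, |1 / (n : ℝ) *
      exprTrace e k k₁ k₂ (fun a : Fin n => E.site a) (fun a : Fin n => X a ω) ε
        - (∫ ω, Y N 0 ω ∂P) / (N : ℝ) ^ d| ≤ C * cubeLoss d N + η := by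
    filter_upwards [hgood, hslln] with ω hω hω' N hN η hη
    exact eventually_near_of_cubes hd hN (fun m n hn => hC (fun a => X a ω) hω N m n hN hn)
      (hω' N) hη
  have hD : Tendsto (fun N => C * cubeLoss d N) atTop (𝓝 0) := by
    simpa using (tendsto_cubeLoss d).const_mul C
  obtain ⟨ω₀, hω₀⟩ := hnear.exists
  obtain ⟨L, hL⟩ := exists_tendsto_of_eventually_near hD hω₀
  exact ⟨L, hnear.mono fun ω hω => tendsto_of_eventually_near hD hω₀ hω hL⟩

end AlmostSure

section Taylor

theorem abs_taylor_le {s : Set ℝ} (hs : Convex ℝ s) {g g₁ g₂ : ℝ → ℝ} {C : ℝ}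
    (h₁ : ∀ x ∈ s, HasDerivWithinAt g (g₁ x) s x)
    (h₂ : ∀ x ∈ s, HasDerivWithinAt g₁ (g₂ x) s x) (hC : ∀ x ∈ s, |g₂ x| ≤ C) {x y : ℝ}
    (hx : x ∈ s) (hy : y ∈ s) : |g y - g x - (y - x) * g₁ x| ≤ C * (y - x) ^ 2 := by
  have hsub : uIcc x y ⊆ s := by
    rw [← segment_eq_uIcc]
    exact hs.segment_subset hx hy
  have hC0 : 0 ≤ C := (abs_nonneg _).trans (hC x hx)
  have hb : ∀ z ∈ uIcc x y, ‖g₁ z - g₁ x‖ ≤ C * |y - x| := fun z hz => by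
    refine (hs.norm_image_sub_le_of_norm_hasDerivWithin_le h₂ hC hx (hsub hz)).trans ?_
    rw [Real.norm_eq_abs]
    exact mul_le_mul_of_nonneg_left (abs_sub_left_of_mem_uIcc hz) hC0
  have hd : ∀ z ∈ uIcc x y, HasDerivWithinAt (fun z => g z - z * g₁ x) (g₁ z - g₁ x)
      (uIcc x y) z := fun z hz => by
    have := ((h₁ z (hsub hz)).mono hsub).fun_sub ((hasDerivWithinAt_id z _).mul_const (g₁ x))
    simpa using this
  have h := (convex_uIcc x y).norm_image_sub_le_of_norm_hasDerivWithin_le hd hb left_mem_uIcc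
    right_mem_uIcc
  rw [Real.norm_eq_abs, Real.norm_eq_abs, mul_assoc, ← abs_mul, abs_mul_self, ← pow_two] at h
  convert h using 2
  ring

/-- A limit of functions with uniform second order Taylor bounds: the derivatives converge. -/
theorem exists_tendsto_deriv_of_taylor {β C x : ℝ} {φ ψ : ℕ → ℝ → ℝ} {S : ℝ → ℝ}
    (hx : x ∈ Ico 0 β)
    (hφ : ∀ n, ∀ y ∈ Ico 0 β, |φ n y - φ n x - (y - x) * ψ n x| ≤ C * (y - x) ^ 2)
    (hS : ∀ y ∈ Ico 0 β, Tendsto (fun n => φ n y) atTop (𝓝 (S y))) :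
    ∃ l, Tendsto (fun n => ψ n x) atTop (𝓝 l) := by
  set h : ℕ → ℝ := fun N => (β - x) / (N + 2) with hh
  have hβx : 0 < β - x := sub_pos.2 hx.2
  have hpos : ∀ N, 0 < h N := fun N => by positivity
  have hmem : ∀ N, x + h N ∈ Ico 0 β := fun N => by
    refine ⟨add_nonneg hx.1 (hpos N).le, ?_⟩
    have : h N < β - x := div_lt_self hβx (by
      have : (0 : ℝ) ≤ N := Nat.cast_nonneg N
      linarith)
    linarith
  have hlim : Tendsto h atTop (𝓝 0) :=
    tendsto_const_nhds.div_atTop (tendsto_natCast_atTop_atTop.atTop_add tendsto_const_nhds)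
  refine exists_tendsto_of_eventually_near (b := fun N => (S (x + h N) - S x) / h N)
    (D := fun N => C * h N) (by simpa using hlim.const_mul C) fun N _ η hη => ?_
  have h1 : Tendsto (fun n => (φ n (x + h N) - φ n x) / h N) atTop
      (𝓝 ((S (x + h N) - S x) / h N)) :=
    ((hS _ (hmem N)).sub (hS _ hx)).div_const _
  filter_upwards [Metric.tendsto_nhds.1 h1 η hη] with n hn
  rw [Real.dist_eq] at hn
  have h2 := hφ n _ (hmem N)
  rw [add_sub_cancel_left] at h2
  have h3 : |ψ n x - (φ n (x + h N) - φ n x) / h N| ≤ C * h N := by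
    have h4 : ψ n x - (φ n (x + h N) - φ n x) / h N
        = -((φ n (x + h N) - φ n x - h N * ψ n x) / h N) := by
      have := (hpos N).ne'
      field_simp
      ring
    rw [h4, abs_neg, abs_div, abs_of_pos (hpos N), div_le_iff₀ (hpos N)]
    calc _ ≤ C * h N ^ 2 := h2
      _ = _ := by ring
  have h5 := abs_sub_le (ψ n x) ((φ n (x + h N) - φ n x) / h N) ((S (x + h N) - S x) / h N)
  linarith

theorem Ico_mem_nhdsWithin {β x b : ℝ} (hx : x ∈ Ico 0 β) : Ico 0 β ∈ 𝓝[Ico 0 b] x := by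
  have h1 : Iio β ∈ 𝓝[Ico 0 b] x := mem_nhdsWithin_of_mem_nhds (Iio_mem_nhds hx.2)
  filter_upwards [h1, self_mem_nhdsWithin] with y hy hy'
  exact ⟨hy'.1, hy⟩

theorem hasDerivWithinAt_of_taylor {β b C x l : ℝ} {S : ℝ → ℝ} (hx : x ∈ Ico 0 β)
    (hS : ∀ y ∈ Ico 0 β, |S y - S x - (y - x) * l| ≤ C * (y - x) ^ 2) :
    HasDerivWithinAt S l (Ico 0 b) x := by
  rw [hasDerivWithinAt_iff_isLittleO]
  have h1 : (fun y => S y - S x - (y - x) • l) =O[𝓝[Ico 0 b] x] fun y => (y - x) ^ 2 := by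
    refine Asymptotics.IsBigO.of_bound C ?_
    filter_upwards [Ico_mem_nhdsWithin (b := b) hx] with y hy
    rw [Real.norm_eq_abs, Real.norm_eq_abs, abs_of_nonneg (sq_nonneg (y - x)), smul_eq_mul]
    exact hS y hy
  refine h1.trans_isLittleO ?_
  have h2 : Tendsto (fun y : ℝ => y - x) (𝓝[Ico 0 b] x) (𝓝 0) := by
    have : Tendsto (fun y : ℝ => y - x) (𝓝 x) (𝓝 (x - x)) := tendsto_id.sub_const x
    rw [sub_self] at this
    exact this.mono_left nhdsWithin_le_nhds
  simpa [pow_two] using (Asymptotics.isLittleO_one_iff ℝ |>.2 h2).mul_isBigO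
    (Asymptotics.isBigO_refl (fun y : ℝ => y - x) _)

theorem contDiffOn_two_of_hasDerivWithinAt {b : ℝ} {f f₁ f₂ : ℝ → ℝ}
    (h₁ : ∀ x ∈ Ico 0 b, HasDerivWithinAt f (f₁ x) (Ico 0 b) x)
    (h₂ : ∀ x ∈ Ico 0 b, HasDerivWithinAt f₁ (f₂ x) (Ico 0 b) x)
    (hc : ContinuousOn f₂ (Ico 0 b)) :
    ContDiffOn ℝ 2 f (Ico 0 b) ∧
      ∀ x ∈ Ico 0 b, iteratedDerivWithin 2 f (Ico 0 b) x = f₂ x := by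
  have hu : UniqueDiffOn ℝ (Ico 0 b) := uniqueDiffOn_Ico 0 b
  have e₁ : ∀ x ∈ Ico 0 b, derivWithin f (Ico 0 b) x = f₁ x := fun x hx =>
    (h₁ x hx).derivWithin (hu x hx)
  have e₂ : ∀ x ∈ Ico 0 b, derivWithin f₁ (Ico 0 b) x = f₂ x := fun x hx =>
    (h₂ x hx).derivWithin (hu x hx)
  have c₁ : ContDiffOn ℝ 1 f₁ (Ico 0 b) := by
    rw [show (1 : WithTop ℕ∞) = 0 + 1 by norm_num, contDiffOn_succ_iff_derivWithin hu]
    exact ⟨fun x hx => (h₂ x hx).differentiableWithinAt, by simp,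
      contDiffOn_zero.2 (hc.congr e₂)⟩
  refine ⟨?_, fun x hx => ?_⟩
  · rw [show (2 : WithTop ℕ∞) = 1 + 1 by norm_num, contDiffOn_succ_iff_derivWithin hu]
    exact ⟨fun x hx => (h₁ x hx).differentiableWithinAt, by simp, c₁.congr e₁⟩
  · rw [iteratedDerivWithin_succ, ← e₂ x hx]
    refine derivWithin_congr (fun y hy => ?_) ?_
    · rw [iteratedDerivWithin_one]; exact e₁ y hy
    · rw [iteratedDerivWithin_one]; exact e₁ x hx

end Taylor

section Jets

/-- `f₁` and `f₂` are the first two derivatives of the functions `f τ` on `[0, b)`, with uniform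
Taylor bounds on the intervals `[0, β)`, `β < b`. -/
structure TaylorBounded {T : Type*} (b : ℝ) (f f₁ f₂ : T → ℝ → ℝ) : Prop where
  hasDeriv : ∀ τ, ∀ x ∈ Ico 0 b, HasDerivWithinAt (f τ) (f₁ τ x) (Ico 0 b) x
  hasDeriv₁ : ∀ τ, ∀ x ∈ Ico 0 b, HasDerivWithinAt (f₁ τ) (f₂ τ x) (Ico 0 b) x
  bound : ∀ β < b, ∃ C : ℝ, ∀ τ, ∀ x ∈ Ico 0 β, |f τ x| ≤ C ∧ |f₁ τ x| ≤ C ∧ |f₂ τ x| ≤ C ∧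
    ∀ y ∈ Ico 0 β, |f τ y - f τ x - (y - x) * f₁ τ x| ≤ C * (y - x) ^ 2 ∧
      |f₁ τ y - f₁ τ x - (y - x) * f₂ τ x| ≤ C * (y - x) ^ 2 ∧ |f₂ τ y - f₂ τ x| ≤ C * |y - x|

theorem TaylorBounded.of_famJet {T : Type*} {b : ℝ} {f : T → ℝ → ℝ}
    (hf : ∀ β < b, FamJet (Ico 0 β) 3 f) :
    TaylorBounded b f (fun τ => derivWithin (f τ) (Ico 0 b))
      (fun τ => derivWithin (derivWithin (f τ) (Ico 0 b)) (Ico 0 b)) := by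
  have hu : UniqueDiffOn ℝ (Ico 0 b) := uniqueDiffOn_Ico 0 b
  have key : ∀ β < b, ∃ C : ℝ, ∃ f₁ f₂ f₃ : T → ℝ → ℝ, ∀ τ, ∀ x ∈ Ico 0 β,
      (|f τ x| ≤ C ∧ |f₁ τ x| ≤ C ∧ |f₂ τ x| ≤ C ∧ |f₃ τ x| ≤ C) ∧
      HasDerivWithinAt (f τ) (f₁ τ x) (Ico 0 β) x ∧
      HasDerivWithinAt (f₁ τ) (f₂ τ x) (Ico 0 β) x ∧
      HasDerivWithinAt (f₂ τ) (f₃ τ x) (Ico 0 β) x ∧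
      HasDerivWithinAt (f τ) (f₁ τ x) (Ico 0 b) x ∧
      derivWithin (f τ) (Ico 0 b) x = f₁ τ x ∧
      HasDerivWithinAt (derivWithin (f τ) (Ico 0 b)) (f₂ τ x) (Ico 0 b) x ∧
      derivWithin (derivWithin (f τ) (Ico 0 b)) (Ico 0 b) x = f₂ τ x := by
    intro β hβ
    obtain ⟨⟨C₀, hC₀⟩, f₁, hd₁, ⟨C₁, hC₁⟩, f₂, hd₂, ⟨C₂, hC₂⟩, f₃, hd₃, ⟨C₃, hC₃⟩⟩ := hf β hβ
    refine ⟨max (max C₀ C₁) (max C₂ C₃), f₁, f₂, f₃, fun τ x hx => ?_⟩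
    have hxb : x ∈ Ico 0 b := ⟨hx.1, hx.2.trans hβ⟩
    have e₁ : ∀ y ∈ Ico 0 β, HasDerivWithinAt (f τ) (f₁ τ y) (Ico 0 b) y := fun y hy =>
      (hd₁ τ y hy).mono_of_mem_nhdsWithin (Ico_mem_nhdsWithin hy)
    have e₂ : ∀ y ∈ Ico 0 β, derivWithin (f τ) (Ico 0 b) y = f₁ τ y := fun y hy =>
      (e₁ y hy).derivWithin (hu y ⟨hy.1, hy.2.trans hβ⟩)
    have e₃ : HasDerivWithinAt (derivWithin (f τ) (Ico 0 b)) (f₂ τ x) (Ico 0 b) x :=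
      ((hd₂ τ x hx).congr e₂ (e₂ x hx)).mono_of_mem_nhdsWithin (Ico_mem_nhdsWithin hx)
    refine ⟨⟨(hC₀ τ x hx).trans ?_, (hC₁ τ x hx).trans ?_, (hC₂ τ x hx).trans ?_,
      (hC₃ τ x hx).trans ?_⟩, hd₁ τ x hx, hd₂ τ x hx, hd₃ τ x hx, e₁ x hx, e₂ x hx, e₃,
      e₃.derivWithin (hu x hxb)⟩ <;> simp
  refine ⟨fun τ x hx => ?_, fun τ x hx => ?_, fun β hβ => ?_⟩
  · obtain ⟨β, h1, h2⟩ := exists_between hx.2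
    obtain ⟨C, f₁, f₂, f₃, h⟩ := key β h2
    obtain ⟨-, -, -, -, h3, h4, -⟩ := h τ x ⟨hx.1, h1⟩
    rwa [h4]
  · obtain ⟨β, h1, h2⟩ := exists_between hx.2
    obtain ⟨C, f₁, f₂, f₃, h⟩ := key β h2
    obtain ⟨-, -, -, -, -, -, h3, h4⟩ := h τ x ⟨hx.1, h1⟩
    rwa [h4]
  · obtain ⟨C, f₁, f₂, f₃, h⟩ := key β hβ
    have hcv : Convex ℝ (Ico 0 β) := convex_Ico 0 β
    refine ⟨C, fun τ x hx => ?_⟩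
    obtain ⟨⟨b0, b1, b2, -⟩, -, -, -, -, h4, -, h6⟩ := h τ x hx
    rw [h4, h6]
    refine ⟨b0, b1, b2, fun y hy => ?_⟩
    obtain ⟨-, -, -, -, -, h4', -, h6'⟩ := h τ y hy
    rw [h4', h6']
    refine ⟨abs_taylor_le hcv (fun z hz => (h τ z hz).2.1) (fun z hz => (h τ z hz).2.2.1)
      (fun z hz => (h τ z hz).1.2.2.1) hx hy,
      abs_taylor_le hcv (fun z hz => (h τ z hz).2.2.1) (fun z hz => (h τ z hz).2.2.2.1)
      (fun z hz => (h τ z hz).1.2.2.2) hx hy, ?_⟩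
    exact hcv.norm_image_sub_le_of_norm_hasDerivWithin_le (fun z hz => (h τ z hz).2.2.2.1)
      (fun z hz => (h τ z hz).1.2.2.2) hx hy

theorem continuousOn_of_lipschitz_bounds {b : ℝ} {f : ℝ → ℝ}
    (h : ∀ β < b, ∃ C : ℝ, ∀ x ∈ Ico 0 β, ∀ y ∈ Ico 0 β, |f y - f x| ≤ C * |y - x|) :
    ContinuousOn f (Ico 0 b) := by
  intro x hx
  obtain ⟨β, h1, h2⟩ := exists_between hx.2
  have hx' : x ∈ Ico 0 β := ⟨hx.1, h1⟩
  obtain ⟨C, hC⟩ := h β h2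
  have h3 : Tendsto (fun y : ℝ => C * |y - x|) (𝓝[Ico 0 b] x) (𝓝 0) := by
    have : Continuous fun y : ℝ => C * |y - x| := by fun_prop
    have h4 := this.tendsto x
    simp only [sub_self, abs_zero, mul_zero] at h4
    exact h4.mono_left nhdsWithin_le_nhds
  refine tendsto_iff_norm_sub_tendsto_zero.2 (squeeze_zero' (Eventually.of_forall fun y =>
    norm_nonneg _) ?_ h3)
  filter_upwards [Ico_mem_nhdsWithin (b := b) hx'] with y hy using hC x hx' y hy

theorem TaylorBounded.contDiffOn {T : Type*} {b : ℝ} {f f₁ f₂ : T → ℝ → ℝ}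
    (hf : TaylorBounded b f f₁ f₂) (τ : T) :
    ContDiffOn ℝ 2 (f τ) (Ico 0 b) ∧
      ∀ x ∈ Ico 0 b, iteratedDerivWithin 2 (f τ) (Ico 0 b) x = f₂ τ x := by
  refine contDiffOn_two_of_hasDerivWithinAt (hf.hasDeriv τ) (hf.hasDeriv₁ τ)
    (continuousOn_of_lipschitz_bounds fun β hβ => ?_)
  obtain ⟨C, hC⟩ := hf.bound β hβ
  exact ⟨C, fun x hx y hy => ((hC τ x hx).2.2.2 y hy).2.2⟩

/-- Under uniform Taylor bounds, pointwise limits are `C²` and the second derivatives converge. -/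
theorem TaylorBounded.limit {b : ℝ} {φ φ₁ φ₂ : ℕ → ℝ → ℝ} {S : ℝ → ℝ}
    (hφ : ∀ β < b, ∃ C : ℝ, ∀ n, ∀ x ∈ Ico 0 β, ∀ y ∈ Ico 0 β,
      |φ n y - φ n x - (y - x) * φ₁ n x| ≤ C * (y - x) ^ 2 ∧
      |φ₁ n y - φ₁ n x - (y - x) * φ₂ n x| ≤ C * (y - x) ^ 2 ∧
      |φ₂ n y - φ₂ n x| ≤ C * |y - x|)
    (hS : ∀ x ∈ Ico 0 b, Tendsto (fun n => φ n x) atTop (𝓝 (S x))) :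
    ContDiffOn ℝ 2 S (Ico 0 b) ∧ ∀ x ∈ Ico 0 b,
      Tendsto (fun n => φ₂ n x) atTop (𝓝 (iteratedDerivWithin 2 S (Ico 0 b) x)) := by
  have hS₁ : ∀ x : ℝ, ∃ l, x ∈ Ico 0 b → Tendsto (fun n => φ₁ n x) atTop (𝓝 l) := fun x => by
    by_cases hx : x ∈ Ico 0 b
    · obtain ⟨β, h1, h2⟩ := exists_between hx.2
      obtain ⟨C, hC⟩ := hφ β h2
      obtain ⟨l, hl⟩ := exists_tendsto_deriv_of_taylor (x := x) ⟨hx.1, h1⟩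
        (fun n y hy => (hC n x ⟨hx.1, h1⟩ y hy).1) fun y hy => hS y ⟨hy.1, hy.2.trans h2⟩
      exact ⟨l, fun _ => hl⟩
    · exact ⟨0, fun h => absurd h hx⟩
  choose S₁ hS₁ using hS₁
  have hS₂ : ∀ x : ℝ, ∃ l, x ∈ Ico 0 b → Tendsto (fun n => φ₂ n x) atTop (𝓝 l) := fun x => by
    by_cases hx : x ∈ Ico 0 b
    · obtain ⟨β, h1, h2⟩ := exists_between hx.2
      obtain ⟨C, hC⟩ := hφ β h2
      obtain ⟨l, hl⟩ := exists_tendsto_deriv_of_taylor (x := x) ⟨hx.1, h1⟩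
        (fun n y hy => (hC n x ⟨hx.1, h1⟩ y hy).2.1) fun y hy => hS₁ y ⟨hy.1, hy.2.trans h2⟩
      exact ⟨l, fun _ => hl⟩
    · exact ⟨0, fun h => absurd h hx⟩
  choose S₂ hS₂ using hS₂
  have hlim : ∀ β < b, ∃ C : ℝ, ∀ x ∈ Ico 0 β, ∀ y ∈ Ico 0 β,
      |S y - S x - (y - x) * S₁ x| ≤ C * (y - x) ^ 2 ∧
      |S₁ y - S₁ x - (y - x) * S₂ x| ≤ C * (y - x) ^ 2 ∧
      |S₂ y - S₂ x| ≤ C * |y - x| := fun β hβ => by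
    obtain ⟨C, hC⟩ := hφ β hβ
    refine ⟨C, fun x hx y hy => ?_⟩
    have hx' : x ∈ Ico 0 b := ⟨hx.1, hx.2.trans hβ⟩
    have hy' : y ∈ Ico 0 b := ⟨hy.1, hy.2.trans hβ⟩
    refine ⟨?_, ?_, ?_⟩
    · exact le_of_tendsto' (((hS y hy').sub (hS x hx')).sub ((hS₁ x hx').const_mul _)).abs
        fun n => (hC n x hx y hy).1
    · exact le_of_tendsto' (((hS₁ y hy').sub (hS₁ x hx')).sub ((hS₂ x hx').const_mul _)).abs
        fun n => (hC n x hx y hy).2.1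
    · exact le_of_tendsto' ((hS₂ y hy').sub (hS₂ x hx')).abs fun n => (hC n x hx y hy).2.2
  obtain ⟨h1, h2⟩ := contDiffOn_two_of_hasDerivWithinAt (f := S) (f₁ := S₁) (f₂ := S₂) (b := b)
    (fun x hx => by
      obtain ⟨β, h1, h2⟩ := exists_between hx.2
      obtain ⟨C, hC⟩ := hlim β h2
      exact hasDerivWithinAt_of_taylor ⟨hx.1, h1⟩ fun y hy => (hC x ⟨hx.1, h1⟩ y hy).1)
    (fun x hx => by
      obtain ⟨β, h1, h2⟩ := exists_between hx.2
      obtain ⟨C, hC⟩ := hlim β h2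
      exact hasDerivWithinAt_of_taylor ⟨hx.1, h1⟩ fun y hy => (hC x ⟨hx.1, h1⟩ y hy).2.1)
    (continuousOn_of_lipschitz_bounds fun β hβ => by
      obtain ⟨C, hC⟩ := hlim β hβ
      exact ⟨C, fun x hx y hy => (hC x hx y hy).2.2⟩)
  exact ⟨h1, fun x hx => by rw [h2 x hx]; exact hS₂ x hx⟩

end Jets

section Exchange

variable {Ω : Type*} [MeasurableSpace Ω] {P : Measure Ω}

theorem aemeasurable_of_hasDerivWithinAt {b x : ℝ} {F : Ω → ℝ → ℝ} {F' : Ω → ℝ}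
    (hx : x ∈ Ico 0 b) (hF : ∀ y ∈ Ico 0 b, AEMeasurable (fun ω => F ω y) P)
    (hd : ∀ᵐ ω ∂P, HasDerivWithinAt (F ω) (F' ω) (Ico 0 b) x) : AEMeasurable F' P := by
  have hbx : 0 < b - x := sub_pos.2 hx.2
  set y : ℕ → ℝ := fun N => x + (b - x) / (N + 2) with hy
  have hpos : ∀ N : ℕ, 0 < (b - x) / ((N : ℝ) + 2) := fun N => by positivity
  have hmem : ∀ N, y N ∈ Ico 0 b := fun N => by
    refine ⟨add_nonneg hx.1 (hpos N).le, ?_⟩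
    have : (b - x) / ((N : ℝ) + 2) < b - x := div_lt_self hbx (by
      have : (0 : ℝ) ≤ N := Nat.cast_nonneg N
      linarith)
    simp only [hy]
    linarith
  have hlim : Tendsto y atTop (𝓝[Ico 0 b \ {x}] x) := by
    refine tendsto_nhdsWithin_iff.2 ⟨?_, Eventually.of_forall fun N => ⟨hmem N, ?_⟩⟩
    · have h1 : Tendsto (fun N : ℕ => (b - x) / ((N : ℝ) + 2)) atTop (𝓝 0) :=
        tendsto_const_nhds.div_atTop (tendsto_natCast_atTop_atTop.atTop_add tendsto_const_nhds)
      simpa using h1.const_add x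
    · have := hpos N
      simp only [hy, Set.mem_singleton_iff]
      linarith
  refine aemeasurable_of_tendsto_metrizable_ae atTop
    (f := fun N ω => (y N - x)⁻¹ * (F ω (y N) - F ω x))
    (fun N => ((hF _ (hmem N)).sub (hF x hx)).const_mul _) ?_
  filter_upwards [hd] with ω hω
  exact (hasDerivWithinAt_iff_tendsto_slope.1 hω).comp hlim

/-- Exchange of the second derivative and the limit, for functions with uniform jets. -/
theorem secondDerivativeExchange_of_famJet [IsProbabilityMeasure P] {T f : Ω → ℕ → ℝ → ℝ}
    {S : ℝ → ℝ} {G : Set Ω} (hG : ∀ᵐ ω ∂P, ω ∈ G) (hT : ∀ ω n ε, T ω n ε = n * f ω n ε)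
    (hm : ∀ n, ∀ ε ∈ Ico (0 : ℝ) (1 / 2), AEMeasurable (fun ω => f ω n ε) P)
    (hj : ∀ β < (1 / 2 : ℝ), FamJet (Ico 0 β) 3 fun (τ : G × ℕ) => f τ.1 τ.2)
    (hlim : IsAlmostSureLimit P T S) : SecondDerivativeExchange P T S := by
  set I := Ico (0 : ℝ) (1 / 2) with hI
  set f₁ : Ω → ℕ → ℝ → ℝ := fun ω n => derivWithin (f ω n) I with hf₁
  set f₂ : Ω → ℕ → ℝ → ℝ := fun ω n => derivWithin (f₁ ω n) I with hf₂
  have hb : TaylorBounded (1 / 2) (fun τ : G × ℕ => f τ.1 τ.2) (fun τ : G × ℕ => f₁ τ.1 τ.2)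
    (fun τ : G × ℕ => f₂ τ.1 τ.2) := TaylorBounded.of_famJet hj
  have hm₁ : ∀ n, ∀ ε ∈ I, AEMeasurable (fun ω => f₁ ω n ε) P := fun n ε hε =>
    aemeasurable_of_hasDerivWithinAt hε (hm n)
      (hG.mono fun ω hω => hb.hasDeriv (⟨ω, hω⟩, n) ε hε)
  have hm₂ : ∀ n, ∀ ε ∈ I, AEMeasurable (fun ω => f₂ ω n ε) P := fun n ε hε =>
    aemeasurable_of_hasDerivWithinAt hε (hm₁ n)
      (hG.mono fun ω hω => hb.hasDeriv₁ (⟨ω, hω⟩, n) ε hε)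
  have hint : ∀ n, ∀ ε ∈ I, Integrable (fun ω => f ω n ε) P ∧ Integrable (fun ω => f₁ ω n ε) P ∧
      Integrable (fun ω => f₂ ω n ε) P := fun n ε hε => by
    obtain ⟨β, h1, h2⟩ := exists_between hε.2
    obtain ⟨C, hC⟩ := hb.bound β h2
    refine ⟨Integrable.of_bound (hm n ε hε).aestronglyMeasurable C ?_,
      Integrable.of_bound (hm₁ n ε hε).aestronglyMeasurable C ?_,
      Integrable.of_bound (hm₂ n ε hε).aestronglyMeasurable C ?_⟩
    · exact hG.mono fun ω hω => (hC (⟨ω, hω⟩, n) ε ⟨hε.1, h1⟩).1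
    · exact hG.mono fun ω hω => (hC (⟨ω, hω⟩, n) ε ⟨hε.1, h1⟩).2.1
    · exact hG.mono fun ω hω => (hC (⟨ω, hω⟩, n) ε ⟨hε.1, h1⟩).2.2.1
  have hT' : ∀ ω n, T ω n = fun ε => (n : ℝ) * f ω n ε := fun ω n => funext fun ε => hT ω n ε
  have hcd : ∀ ω ∈ G, ∀ n, ContDiffOn ℝ 2 (T ω n) I ∧
      ∀ ε ∈ I, iteratedDerivWithin 2 (T ω n) I ε = n * f₂ ω n ε := fun ω hω n => by
    obtain ⟨h1, h2⟩ := hb.contDiffOn (⟨ω, hω⟩, n)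
    rw [hT']
    refine ⟨contDiffOn_const.mul h1, fun ε hε => ?_⟩
    rw [← h2 ε hε]
    exact iteratedDerivWithin_const_mul hε (uniqueDiffOn_Ico _ _) _ (h1 ε hε)
  have hlimE : ∀ ε ∈ I, Tendsto (fun n => ∫ ω, f ω n ε ∂P) atTop (𝓝 (S ε)) := fun ε hε => by
    obtain ⟨β, h1, h2⟩ := exists_between hε.2
    obtain ⟨C, hC⟩ := hb.bound β h2
    have h3 := tendsto_integral_of_dominated_convergence (μ := P) (F := fun n ω => f ω n ε)
      (f := fun _ => S ε) (fun _ => C) (fun n => (hm n ε hε).aestronglyMeasurable)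
      (integrable_const C)
      (fun n => hG.mono fun ω hω => (hC (⟨ω, hω⟩, n) ε ⟨hε.1, h1⟩).1) (by
        filter_upwards [hlim ε hε] with ω hω
        refine hω.congr' ?_
        filter_upwards [eventually_gt_atTop 0] with n hn
        have hn' : (n : ℝ) ≠ 0 := by exact_mod_cast hn.ne'
        rw [hT]
        field_simp)
    simpa using h3
  obtain ⟨hS, hS₂⟩ := TaylorBounded.limit (b := 1 / 2) (φ := fun n ε => ∫ ω, f ω n ε ∂P)
    (φ₁ := fun n ε => ∫ ω, f₁ ω n ε ∂P) (φ₂ := fun n ε => ∫ ω, f₂ ω n ε ∂P) (S := S)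
    (fun β hβ => by
      obtain ⟨C, hC⟩ := hb.bound β hβ
      refine ⟨C, fun n x hx y hy => ?_⟩
      obtain ⟨i0, i1, i2⟩ := hint n x ⟨hx.1, hx.2.trans hβ⟩
      obtain ⟨j0, j1, j2⟩ := hint n y ⟨hy.1, hy.2.trans hβ⟩
      have hP : ∀ {g : Ω → ℝ} {c : ℝ}, (∀ ω ∈ G, |g ω| ≤ c) → |∫ ω, g ω ∂P| ≤ c := fun {g c} hg => by
        have := norm_integral_le_of_norm_le_const (μ := P) (f := g) (C := c) (hG.mono hg)
        simpa using this
      have ij0 : Integrable (fun ω => f ω n y - f ω n x) P := j0.sub i0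
      have ij1 : Integrable (fun ω => f₁ ω n y - f₁ ω n x) P := j1.sub i1
      refine ⟨?_, ?_, ?_⟩
      · rw [← integral_const_mul, ← integral_sub j0 i0,
          ← integral_sub ij0 (i1.const_mul _)]
        exact hP fun ω hω => ((hC (⟨ω, hω⟩, n) x hx).2.2.2 y hy).1
      · rw [← integral_const_mul, ← integral_sub j1 i1,
          ← integral_sub ij1 (i2.const_mul _)]
        exact hP fun ω hω => ((hC (⟨ω, hω⟩, n) x hx).2.2.2 y hy).2.1
      · rw [← integral_sub j2 i2]
        exact hP fun ω hω => ((hC (⟨ω, hω⟩, n) x hx).2.2.2 y hy).2.2)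
    hlimE
  have hae : ∀ n, ∀ ε ∈ I, (fun ω => iteratedDerivWithin 2 (T ω n) I ε)
      =ᵐ[P] fun ω => n * f₂ ω n ε := fun n ε hε => hG.mono fun ω hω => (hcd ω hω n).2 ε hε
  refine ⟨hS, hG.mono fun ω hω n => (hcd ω hω n).1, fun ε hε => ⟨fun n => ?_, ?_⟩⟩
  · exact ((hint n ε hε).2.2.const_mul _).congr (hae n ε hε).symm
  · refine (hS₂ ε hε).congr' ?_
    filter_upwards [eventually_gt_atTop 0] with n hn
    have hn' : (n : ℝ) ≠ 0 := by exact_mod_cast hn.ne'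
    rw [integral_congr_ae (hae n ε hε), integral_const_mul]
    field_simp

end Exchange

section Main

variable {p d : ℕ}

theorem SmoothCovarianceCondition.regularKernel {Θ : Set (Fin p → ℝ)}
    {K : (Fin p → ℝ) → EuclideanSpace ℝ (Fin d) → ℝ} (hK : SmoothCovarianceCondition Θ K)
    {θ : Fin p → ℝ} (hθ : θ ∈ Θ) : RegularKernel (K θ) where
  differentiable := hK.differentiable_space θ hθ
  bound := by
    obtain ⟨C, hC⟩ := hK.bound 0 (by norm_num) Fin.elim0
    exact ⟨C, fun t => by simpa [thetaPartial] using hC θ hθ t⟩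
  bound_deriv T hT k hk J := hK.bound_space T hT θ hθ k hk J

theorem SmoothCovarianceCondition.regularKernel_theta {Θ : Set (Fin p → ℝ)}
    {K : (Fin p → ℝ) → EuclideanSpace ℝ (Fin d) → ℝ} (hK : SmoothCovarianceCondition Θ K)
    {θ : Fin p → ℝ} (hθ : θ ∈ Θ) (i : Fin p) : RegularKernel (thetaPartial₁ Θ K i θ) where
  differentiable := hK.differentiable_space_theta θ hθ i
  bound := by
    obtain ⟨C, hC⟩ := hK.bound 1 (by norm_num) fun _ => i
    exact ⟨C, fun t => hC θ hθ t⟩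
  bound_deriv T hT k hk J := hK.bound_space_theta T hT θ hθ i k hk J

theorem gridMatrix_eq_kernelMatrix {v : ℕ → Fin d → ℕ} {E : CubeEnum d}
    (hE : ∀ a k, v a k = E.equiv a k + 1) (h : EuclideanSpace ℝ (Fin d) → ℝ)
    (x : ℕ → EuclideanSpace ℝ (Fin d)) (ε : ℝ) (n : ℕ) :
    gridMatrix h v x ε n
      = kernelMatrix h (fun a : Fin n => E.site a) (fun a : Fin n => x a) ε := by
  ext a b
  simp only [gridMatrix, kernelMatrix, Matrix.of_apply]
  congr 1
  ext k
  simp [obsPoint, gridPoint, hE, CubeEnum.site]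
  ring

/-- The almost sure limit and the exchange property for the trace of a matrix expression. -/
theorem exists_limit_of_expr {Ω : Type*} [MeasurableSpace Ω] {P : Measure Ω}
    [IsProbabilityMeasure P] (hd : 0 < d) {v : ℕ → Fin d → ℕ} {E : CubeEnum d}
    (hE : ∀ a k, v a k = E.equiv a k + 1) {μ : Measure (EuclideanSpace ℝ (Fin d))}
    {X : ℕ → Ω → EuclideanSpace ℝ (Fin d)}
    (hμ : IsPerturbationLaw μ) (hX : ∀ a, HasLaw (X a) μ P) (hindep : iIndepFun X P)
    {k k₁ k₂ : EuclideanSpace ℝ (Fin d) → ℝ} (h : AdmissibleKernels k k₁ k₂) (e : MatExpr)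
    {T : Ω → ℕ → ℝ → ℝ}
    (hT : ∀ ω n ε, T ω n ε = (e.eval (gridMatrix k v (fun a => X a ω) ε n)
      (gridMatrix k₁ v (fun a => X a ω) ε n) (gridMatrix k₂ v (fun a => X a ω) ε n)).trace) :
    ∃ S : ℝ → ℝ, IsAlmostSureLimit P T S ∧ SecondDerivativeExchange P T S := by
  have hT' : ∀ ω n ε, T ω n ε
      = exprTrace e k k₁ k₂ (fun a : Fin n => E.site a) (fun a : Fin n => X a ω) ε := fun ω n ε => by
    rw [hT, gridMatrix_eq_kernelMatrix hE, gridMatrix_eq_kernelMatrix hE,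
      gridMatrix_eq_kernelMatrix hE]
    rfl
  have hex : ∀ ε : ℝ, ∃ L : ℝ, ε ∈ Ico (0 : ℝ) (1 / 2) → ∀ᵐ ω ∂P,
      Tendsto (fun n : ℕ => (1 / (n : ℝ)) * T ω n ε) atTop (𝓝 L) := fun ε => by
    by_cases hε : ε ∈ Ico (0 : ℝ) (1 / 2)
    · obtain ⟨L, hL⟩ := exists_ae_tendsto_trace hd E hμ hX hindep h e hε
      refine ⟨L, fun _ => ?_⟩
      simpa only [hT'] using hL
    · exact ⟨0, fun h => absurd h hε⟩
  choose S hS using hex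
  have hlim : IsAlmostSureLimit P T S := fun ε hε => hS ε hε
  refine ⟨S, hlim, secondDerivativeExchange_of_famJet (f := fun ω n ε => 1 / (n : ℝ) * T ω n ε)
    (ae_abs_le_one hμ hX) (fun ω n ε => ?_) (fun n ε _ => ?_) (fun β hβ => ?_) hlim⟩
  · rcases Nat.eq_zero_or_pos n with rfl | hn
    · simp [hT, Matrix.trace]
    · have hn' : (n : ℝ) ≠ 0 := by exact_mod_cast hn.ne'
      field_simp
  · simp only [hT']
    exact ((measurable_exprTrace h e (fun a : Fin n => E.site a) ε).comp_aemeasurable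
      (aemeasurable_pi_lambda _ fun a => (hX a).aemeasurable)).const_mul _
  · have hjet := (h.famJet_trace e hβ).comp
      fun τ : {ω | ∀ a k, |X a ω k| ≤ 1} × ℕ => E.config (fun a => X a τ.1.1) τ.1.2 τ.2
    refine Eq.mp ?_ hjet
    congr 1
    funext τ ε
    rw [hT']
    change 1 / (Fintype.card (Fin τ.2) : ℝ) * _ = _
    rw [Fintype.card_fin]
    rfl

end Main

end

end PerturbedGrid

theorem mainTheorem8 {p d : ℕ} (hd : 0 < d)
    -- the parametric model and the true parameter, in the interior of the parameter box
    (θinf θsup : ℝ) (θ₀ : Fin p → ℝ) (hθ₀ : ∀ i, θinf < θ₀ i ∧ θ₀ i < θsup)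
    (K : (Fin p → ℝ) → EuclideanSpace ℝ (Fin d) → ℝ)
    (hK : PerturbedGrid.SmoothCovarianceCondition (PerturbedGrid.paramBox p θinf θsup) K)
    -- the grid and its random perturbation
    (v : ℕ → Fin d → ℕ) (hv : PerturbedGrid.IsGridEnumeration v)
    (μ : MeasureTheory.Measure (EuclideanSpace ℝ (Fin d)))
    (hμ : PerturbedGrid.IsPerturbationLaw μ)
    {Ω : Type*} [MeasurableSpace Ω] (P : MeasureTheory.Measure Ω)
    [MeasureTheory.IsProbabilityMeasure P]
    (X : ℕ → Ω → EuclideanSpace ℝ (Fin d))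
    (hX_law : ∀ a, ProbabilityTheory.HasLaw (X a) μ P)
    (hX_indep : ProbabilityTheory.iIndepFun X P) :
    ∃ S_ML S_CV1 S_CV2 : ℝ → Matrix (Fin p) (Fin p) ℝ, ∀ i j : Fin p,
      let trML : Ω → ℕ → ℝ → ℝ := fun ω => PerturbedGrid.traceAt PerturbedGrid.matML
        (PerturbedGrid.paramBox p θinf θsup) K θ₀ v i j (fun a => X a ω)
      let trCV1 : Ω → ℕ → ℝ → ℝ := fun ω => PerturbedGrid.traceAt PerturbedGrid.matCV1
        (PerturbedGrid.paramBox p θinf θsup) K θ₀ v i j (fun a => X a ω)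
      let trCV2 : Ω → ℕ → ℝ → ℝ := fun ω => PerturbedGrid.traceAt PerturbedGrid.matCV2
        (PerturbedGrid.paramBox p θinf θsup) K θ₀ v i j (fun a => X a ω)
      (PerturbedGrid.IsAlmostSureLimit P trML (fun ε => S_ML ε i j) ∧
        PerturbedGrid.SecondDerivativeExchange P trML (fun ε => S_ML ε i j)) ∧
      (PerturbedGrid.IsAlmostSureLimit P trCV1 (fun ε => S_CV1 ε i j) ∧
        PerturbedGrid.SecondDerivativeExchange P trCV1 (fun ε => S_CV1 ε i j)) ∧
      (PerturbedGrid.IsAlmostSureLimit P trCV2 (fun ε => S_CV2 ε i j) ∧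
        PerturbedGrid.SecondDerivativeExchange P trCV2 (fun ε => S_CV2 ε i j)) := by
  have hθ : θ₀ ∈ PerturbedGrid.paramBox p θinf θsup := fun i => ⟨(hθ₀ i).1.le, (hθ₀ i).2.le⟩
  obtain ⟨E, hE⟩ := hv.exists_cubeEnum hd
  have hadm : ∀ i j, PerturbedGrid.AdmissibleKernels (K θ₀)
      (PerturbedGrid.thetaPartial₁ (PerturbedGrid.paramBox p θinf θsup) K i θ₀)
      (PerturbedGrid.thetaPartial₁ (PerturbedGrid.paramBox p θinf θsup) K j θ₀) := fun i j =>
    { regular := hK.regularKernel hθ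
      regular₁ := hK.regularKernel_theta hθ i
      regular₂ := hK.regularKernel_theta hθ j
      coercive := fun β hβ => hK.toCovarianceCondition.exists_coercive hθ hβ }
  choose S₁ hS₁ using fun i j => PerturbedGrid.exists_limit_of_expr hd hE hμ hX_law hX_indep
    (hadm i j) PerturbedGrid.exprML
    (T := fun ω => PerturbedGrid.traceAt PerturbedGrid.matML
        (PerturbedGrid.paramBox p θinf θsup) K θ₀ v i j (fun a => X a ω)) fun ω n ε => rfl
  choose S₂ hS₂ using fun i j => PerturbedGrid.exists_limit_of_expr hd hE hμ hX_law hX_indep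
    (hadm i j) PerturbedGrid.exprCV1
    (T := fun ω => PerturbedGrid.traceAt PerturbedGrid.matCV1
        (PerturbedGrid.paramBox p θinf θsup) K θ₀ v i j (fun a => X a ω)) fun ω n ε => by
      rw [PerturbedGrid.eval_exprCV1]; rfl
  choose S₃ hS₃ using fun i j => PerturbedGrid.exists_limit_of_expr hd hE hμ hX_law hX_indep
    (hadm i j) PerturbedGrid.exprCV2
    (T := fun ω => PerturbedGrid.traceAt PerturbedGrid.matCV2
        (PerturbedGrid.paramBox p θinf θsup) K θ₀ v i j (fun a => X a ω)) fun ω n ε => by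
      rw [PerturbedGrid.eval_exprCV2]; rfl
  exact ⟨fun ε => Matrix.of fun i j => S₁ i j ε, fun ε => Matrix.of fun i j => S₂ i j ε,
    fun ε => Matrix.of fun i j => S₃ i j ε, fun i j => ⟨hS₁ i j, hS₂ i j, hS₃ i j⟩⟩
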